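/- Let $n\ge 1$, let $\Omega\subset\mathbb R^n$ be a nonempty bounded open set (no regularity of $\partial\Omega$ is needed), $\tau>0$, $\theta>1$, $k\in\mathbb R$, and let $\mu:[0,\infty)\to[0,\infty)$ be locally absolutely continuous with $$\mu(0)>0,\qquad \tilde\mu:=\int_0^\infty\mu(s)\,ds<1,\qquad \mu'(t)\le-\alpha\,\mu(t)\ \text{ for a.e. } t>0,$$ for some $\alpha>0$. Consider the problem $$u_{tt}(x,t)-\Delta u(x,t)+\int_0^\infty\mu(s)\,\Delta u(x,t-s)\,ds+\theta|k|e^{\tau}u_t(x,t)+k\,u_t(x,t-\tau)=0\quad\text{in }\Omega\times(0,\infty),\qquad(\ast)$$ with $u=0$ on $\partial\Omega\times(0,\infty)$ and $u$ prescribed on $\Omega\times(-\infty,0]$. Put $\eta^t(s)=u(t)-u(t-s)$. A solution is a weak solution with finite-energy data: $u\in C([0,\infty);H^1_0(\Omega))\cap C^1([0,\infty);L^2(\Omega))$, $u(t)\in H^1_0(\Omega)$ for $t<0$ depends measurably on $t$, with $\int_0^\infty\mu(s)\|\nabla\eta^0(s)\|_{L^2(\Omega)}^2ds<\infty$, the values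 of $u_t$ on $(-\tau,0)$ are a datum in $L^2((-\tau,0);L^2(\Omega))$ (possibly independent of $u|_{(-\infty,0]}$), and $(\ast)$ holds when tested with every $\varphi\in H^1_0(\Omega)$ and integrated over $(0,t)$, for every $t\ge0$. Its energy is $$F(t)=\frac12\int_\Omega u_t^2(x,t)\,dx+\frac{1-\tilde\mu}2\int_\Omega|\nabla u(x,t)|^2dx+\frac12\int_0^\infty\!\!\int_\Omega\mu(s)|\nabla\eta^t(x,s)|^2dx\,ds+\frac{\theta|k|e^\tau}2\int_{t-\tau}^te^{-(t-s)}\!\int_\Omega u_t^2(x,s)\,dx\,ds .$$ Let $C_P$ be the smallest positive constant with $\int_\Omega w^2dx\le C_P\int_\Omega|\nabla w|^2dx$ for all $w\in H^1_0(\Omega)$, and put $$\bar k=\min\Big\{\frac{1-\tilde\mu}{2C_P(\theta e^\tau+1)},\ \frac{\tilde\mu}{2\theta}e^{-\tau}\Big\},\qquad C_0=2+\theta|k|e^\tau,\qquad C_1=4\Big(1+\frac{\tilde\mu}{\alpha(1-\tilde\mu)}+\frac{C_P}{1-\tilde\mu}+\frac1{2(\theta-1)}\Big),$$ $$C_2=\frac4{\tilde\mu}\Big(1+\frac1{2(\theta-1)}+\frac{\mu(0)}{\tilde\mu}C_P\Big)+4C_P+\frac2\alpha\Big(2+(6+2\theta|k|e^\tau)\frac{1-\tilde\mu}{\tilde\mu}+C_P|k|(\theta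 e^\tau+1)\Big),$$ $$C(k)=C_0C_2+C_1+C_2+1+\frac1\alpha .$$ Then $\bar k>0$; the constants $C(k)$, $|k|<\bar k$, are positive and bounded above by a constant depending only on $\mu,\alpha,\Omega,\tau,\theta$; and if $|k|<\bar k$, then for every solution $F$ is integrable on $(S,\infty)$ and $$\int_S^\infty F(t)\,dt\le C(k)\,F(S)\qquad\text{for all } S>0 .$$ -/

import Mathlib

open MeasureTheory Set
open scoped ContDiff InnerProductSpace

noncomputable section

namespace ViscoDelay

/-- The physical space `ℝⁿ` with its Euclidean norm. -/
abbrev Space (n : ℕ) : Type := EuclideanSpace ℝ (Fin n)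

/-- `L²(Ω)` (real valued). -/
abbrev L2 {n : ℕ} (Ω : Set (Space n)) : Type := Lp ℝ 2 (volume.restrict Ω)

/-- `L²(Ω; ℝⁿ)`. -/
abbrev L2Vec {n : ℕ} (Ω : Set (Space n)) : Type := Lp (Space n) 2 (volume.restrict Ω)

/-- `L²(Ω) × L²(Ω; ℝⁿ)` with the Hilbert norm `(‖w‖² + ‖g‖²)^{1/2}`. A function `w ∈ H¹(Ω)` is
represented by the pair `(w, ∇w)`, so that this norm is the `H¹` norm. -/
abbrev L2Pair {n : ℕ} (Ω : Set (Space n)) : Type := WithLp 2 (L2 Ω × L2Vec Ω)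

/-- The space `C_c^∞(Ω)` inside `H¹(Ω)`: the pairs `(φ, ∇φ)`, where `φ` is smooth with compact
support contained in `Ω`. -/
def testPairs {n : ℕ} (Ω : Set (Space n)) : Submodule ℝ (L2Pair Ω) where
  carrier := {p | ∃ φ : Space n → ℝ, ContDiff ℝ ∞ φ ∧ HasCompactSupport φ ∧ tsupport φ ⊆ Ω ∧
    p.fst =ᵐ[volume.restrict Ω] φ ∧ p.snd =ᵐ[volume.restrict Ω] gradient φ}
  add_mem' := by
    rintro p q ⟨φ, h1, h2, h3, h4, h5⟩ ⟨ψ, k1, k2, k3, k4, k5⟩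
    refine ⟨φ + ψ, h1.add k1, h2.add k2, ?_, ?_, ?_⟩
    · exact (tsupport_add φ ψ).trans (union_subset h3 k3)
    · filter_upwards [Lp.coeFn_add p.fst q.fst, h4, k4] with x hx hx1 hx2
      simp only [WithLp.add_fst, hx, Pi.add_apply, hx1, hx2]
    · filter_upwards [Lp.coeFn_add p.snd q.snd, h5, k5] with x hx hx1 hx2
      have d1 : DifferentiableAt ℝ φ x := (h1.differentiable (by simp)) x
      have d2 : DifferentiableAt ℝ ψ x := (k1.differentiable (by simp)) x
      simp only [WithLp.add_snd, hx, Pi.add_apply, hx1, hx2, gradient, fderiv_add d1 d2, map_add]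
  zero_mem' := by
    refine ⟨0, contDiff_const, HasCompactSupport.zero, ?_, ?_, ?_⟩
    · simp [tsupport]
    · simpa using Lp.coeFn_zero ℝ 2 (volume.restrict Ω)
    · have h0 : gradient (0 : Space n → ℝ) = 0 := by
        funext x
        simp [gradient]
      rw [h0]
      simpa using Lp.coeFn_zero (Space n) 2 (volume.restrict Ω)
  smul_mem' := by
    rintro c p ⟨φ, h1, h2, h3, h4, h5⟩
    refine ⟨c • φ, h1.const_smul c, ?_, ?_, ?_, ?_⟩
    · exact h2.smul_left (f := fun _ => c)
    · exact (tsupport_smul_subset_right (fun _ => c) φ).trans h3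
    · filter_upwards [Lp.coeFn_smul c p.fst, h4] with x hx hx1
      simp only [WithLp.smul_fst, hx, Pi.smul_apply, hx1]
    · filter_upwards [Lp.coeFn_smul c p.snd, h5] with x hx hx1
      have d1 : DifferentiableAt ℝ φ x := (h1.differentiable (by simp)) x
      simp only [WithLp.smul_snd, hx, Pi.smul_apply, hx1, gradient, fderiv_const_smul d1,
        map_smul]

/-- `H¹₀(Ω)`: the closure of `C_c^∞(Ω)` in the `H¹` norm, as a space of pairs `(w, ∇w)`. -/
def H10 {n : ℕ} (Ω : Set (Space n)) : Submodule ℝ (L2Pair Ω) :=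
  (testPairs Ω).topologicalClosure

/-- The inclusion `H¹₀(Ω) → L²(Ω)`. -/
def val {n : ℕ} {Ω : Set (Space n)} (w : H10 Ω) : L2 Ω := (w : L2Pair Ω).fst

/-- The weak gradient of an element of `H¹₀(Ω)`. -/
def grad {n : ℕ} {Ω : Set (Space n)} (w : H10 Ω) : L2Vec Ω := (w : L2Pair Ω).snd

/-- The Poincaré constant: the smallest positive constant `C` with
`∫_Ω w² dx ≤ C ∫_Ω |∇w|² dx` for all `w ∈ H¹₀(Ω)`. -/
def poincareConst {n : ℕ} (Ω : Set (Space n)) : ℝ :=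
  sInf {C : ℝ | 0 < C ∧ ∀ w : H10 Ω, ‖val w‖ ^ 2 ≤ C * ‖grad w‖ ^ 2}

/-- The total mass `∫₀^∞ μ(s) ds` of the memory kernel. -/
def muTilde (μ : ℝ → ℝ) : ℝ := ∫ s in Ioi (0 : ℝ), μ s

/-- The assumptions on the memory kernel `μ : [0, ∞) → [0, ∞)` (values of `μ` at negative
arguments are never used). -/
structure IsMemoryKernel (μ : ℝ → ℝ) (α : ℝ) : Prop where
  nonneg : ∀ s, 0 ≤ s → 0 ≤ μ s
  locallyAC : ∀ b, 0 ≤ b → AbsolutelyContinuousOnInterval μ 0 b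
  pos_zero : 0 < μ 0
  integrable : IntegrableOn μ (Ioi 0)
  mass_lt_one : muTilde μ < 1
  rate_pos : 0 < α
  deriv_le : ∀ᵐ t ∂(volume.restrict (Ioi (0 : ℝ))), deriv μ t ≤ -α * μ t

/-- The relative history `η^t(s) = u(t) - u(t - s)`. -/
def eta {n : ℕ} {Ω : Set (Space n)} (u : ℝ → H10 Ω) (t s : ℝ) : H10 Ω := u t - u (t - s)

/-- Finite-energy solutions of the auxiliary problem
`u_tt - Δu + ∫₀^∞ μ(s) Δu(t-s) ds + θ|k|e^τ u_t + k u_t(t-τ) = 0` in `Ω × (0, ∞)`,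
with `u = 0` on `∂Ω × (0, ∞)` and a prescribed past.

`u t ∈ H¹₀(Ω)` is the displacement; its restriction to `(-∞, 0]` is the initial history.
`v t ∈ L²(Ω)` is the velocity; it equals `u_t(t)` for `t ≥ 0`, and on `(-τ, 0)` it is the initial
datum of the delayed term.
The initial data range over all of the energy space
`H¹₀(Ω) × L²(Ω) × L²_μ((0,∞); H¹₀(Ω)) × L²((0,1); L²(Ω))`,
in which the last component (the velocity in the past) is an independent datum; the case in which
`v` is the time derivative of the history on `(-τ, 0)` as well is contained in this. -/
structure IsSolution {n : ℕ} (Ω : Set (Space n)) (μ : ℝ → ℝ) (τ θ k : ℝ)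
    (u : ℝ → H10 Ω) (v : ℝ → L2 Ω) : Prop where
  /-- `η⁰ ∈ L²_μ((0,∞); H¹₀(Ω))`: measurability and finite norm. -/
  history_meas : AEStronglyMeasurable u (volume.restrict (Iio 0))
  history_integrable :
    IntegrableOn (fun s => μ s * ‖grad (eta u 0 s)‖ ^ 2) (Ioi 0)
  /-- The past velocity is in `L²((-τ, 0); L²(Ω))`. -/
  delay_memLp : MemLp v 2 (volume.restrict (Ioo (-τ) 0))
  /-- `u ∈ C([0,∞); H¹₀(Ω)) ∩ C¹([0,∞); L²(Ω))` with `u_t = v`. -/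
  cont_u : ContinuousOn u (Ici 0)
  cont_v : ContinuousOn v (Ici 0)
  deriv_u : ∀ t, 0 ≤ t → HasDerivWithinAt (fun r => val (u r)) (v t) (Ici 0) t
  /-- The equation, tested with `φ ∈ H¹₀(Ω)` and integrated over `(0, t)`. -/
  equation : ∀ φ : H10 Ω, ∀ t, 0 ≤ t →
    ⟪v t, val φ⟫_ℝ - ⟪v 0, val φ⟫_ℝ
      + ∫ r in (0 : ℝ)..t,
          (⟪grad (u r), grad φ⟫_ℝ
            - (∫ s in Ioi (0 : ℝ), μ s * ⟪grad (u (r - s)), grad φ⟫_ℝ)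
            + θ * |k| * Real.exp τ * ⟪v r, val φ⟫_ℝ
            + k * ⟪v (r - τ), val φ⟫_ℝ) = 0

/-- The energy `F(t)`, with `u_t = v`. The norms are those of `L²(Ω)` and `L²(Ω; ℝⁿ)`. -/
def energy {n : ℕ} {Ω : Set (Space n)} (μ : ℝ → ℝ) (τ θ k : ℝ)
    (u : ℝ → H10 Ω) (v : ℝ → L2 Ω) (t : ℝ) : ℝ :=
  1 / 2 * ‖v t‖ ^ 2
    + (1 - muTilde μ) / 2 * ‖grad (u t)‖ ^ 2
    + 1 / 2 * (∫ s in Ioi (0 : ℝ), μ s * ‖grad (eta u t s)‖ ^ 2)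
    + θ * |k| * Real.exp τ / 2 * ∫ s in (t - τ)..t, Real.exp (-(t - s)) * ‖v s‖ ^ 2

/-- The smallness threshold for `|k|`; `m` is the mass of the kernel, `P` the Poincaré constant. -/
def kBar (m P τ θ : ℝ) : ℝ :=
  min ((1 - m) / (2 * P * (θ * Real.exp τ + 1))) (m / (2 * θ) * Real.exp (-τ))

/-- `C₀ = 2 + θ|k|e^τ`. -/
def constC0 (τ θ k : ℝ) : ℝ := 2 + θ * |k| * Real.exp τ

/-- `C₁ = 4 (1 + m/(α(1-m)) + P/(1-m) + 1/(2(θ-1)))`. -/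
def constC1 (m P α θ : ℝ) : ℝ :=
  4 * (1 + m / (α * (1 - m)) + P / (1 - m) + 1 / (2 * (θ - 1)))

/-- `C₂`; `μ₀` is the value of the kernel at `0`. -/
def constC2 (μ₀ m P α τ θ k : ℝ) : ℝ :=
  4 / m * (1 + 1 / 2 * (1 / (θ - 1)) + μ₀ / m * P) + 4 * P
    + 2 / α * (2 + (6 + 2 * θ * |k| * Real.exp τ) * ((1 - m) / m)
        + P * |k| * (θ * Real.exp τ + 1))

/-- `C = C* + 1 + 1/α` with `C* = C₀C₂ + C₁ + C₂`. -/
def constC (μ₀ m P α τ θ k : ℝ) : ℝ :=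
  (constC0 τ θ k * constC2 μ₀ m P α τ θ k + constC1 m P α θ + constC2 μ₀ m P α τ θ k)
    + 1 + 1 / α

end ViscoDelay

end

/-!
The argument is the energy method with two multipliers, followed by a regularization which makes the
formal computations legitimate for finite-energy solutions.

*Abstract form.* Write `ι : V → H` and `G : V → W` for the embedding `H¹₀(Ω) → L²(Ω)` and the weak
gradient, `m` for the mass of the kernel, `P` for the Poincaré constant, `ν = -μ'` and
`a = θ|k|e^τ`. Only the bounds `‖ι x‖² ≤ P‖G x‖²` and `‖x‖ ≤ K‖G x‖` are needed, so everything up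
to the last part is done for abstract spaces. All memory integrals are written as integrals over
the past time `r = t - s` against the kernel cut off at lag zero (`causal`); then the history
`u(r)` is a parameter which does not move with `t`, and one Leibniz rule
(`DecayKernel.integral_memory_sub`), for a merely absolutely continuous kernel, differentiates them
all.

*Estimates for regular solutions.* Testing with `u_t` gives (`energy_dissipation`)
`∫_S^T D + |k|(θ-1)/2 ∫_S^T ‖u_t(t-τ)‖² + ∫_S^T (delay part of F) ≤ F(S) - F(T)`, where
`D(t) = ½ ∫ ν(s)‖Gη^t(s)‖² ds` is the dissipation of the memory; the weight `θ|k|e^τ` of the delay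
term is chosen to absorb the delayed force. As `ν ≥ αμ`, the dissipation controls the memory part of
the energy (`memory_le_dissipation`). Testing with `u` (`displacement_multiplier`) bounds
`∫‖Gu‖²` by `∫‖u_t‖²` and terms already controlled; testing with the mean history
`ψ = ∫ μ(s) η^t(s) ds` (`memory_multiplier`) bounds `∫‖u_t‖²` by a small multiple of `∫‖Gu‖²` and
controlled terms, because `ψ_t` contains `m u_t`. The two conditions contained in `|k| < k̄` absorb
the lower order terms, and adding the inequalities gives `∫_S^T F ≤ C(k) F(S)`
(`RegularSolution.integral_totalEnergy_le`).

*Finite-energy solutions.* The equation is linear with coefficients constant in time, so the forward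
(Steklov) averages `δ⁻¹ ∫_0^δ u(t + r) dr` of a solution solve it again (`regular_steklov`). They
are differentiable in time with values in `V`, hence regular. By Jensen's inequality the energy of
the average is at most the average of the energy; together with Lebesgue differentiation and Fatou's
lemma this gives convergence of the energies as `δ → 0` (`tendsto_totalEnergy_steklov`), and the
estimate passes to the limit (`WeakSolution.integral_totalEnergy_le`).

*Back to `Ω`.* The Poincaré constant is attained as a bound, and is positive because `H¹₀(Ω)`
contains a nonzero function. The energy is nonnegative and continuous, so the bound, being uniform
in `T`, gives integrability on `(S, ∞)`. Finally `C(k)` is nondecreasing in `|k|`, so `C(k̄)` is an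
upper bound for it.
-/

namespace ViscoDelay

open Filter Topology

/-! ### Memory kernels -/

/-- A memory kernel `μ` defined on all of `ℝ`, with decay rate `ν = -μ'`, exponent `α` and mass `m`.
The extension to negative arguments is required to be continuous, nonnegative and antitone, which
makes `μ (t - r) ≤ μ (-r)` available for all `t ≥ 0`. The rate `ν` is an everywhere defined
nonnegative measurable function which is `-μ'` almost everywhere on `(0, ∞)`. -/
structure DecayKernel (μ ν : ℝ → ℝ) (α m : ℝ) : Prop where
  cont : Continuous μ
  anti : Antitone μ
  nonneg : ∀ s, 0 ≤ μ s
  pos_zero : 0 < μ 0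
  integrable : IntegrableOn μ (Ioi 0)
  mass : ∫ s in Ioi 0, μ s = m
  mass_lt_one : m < 1
  rate_pos : 0 < α
  ac : ∀ b, 0 ≤ b → AbsolutelyContinuousOnInterval μ 0 b
  meas_rate : Measurable ν
  rate_nonneg : ∀ s, 0 ≤ ν s
  deriv_eq : ∀ᵐ s, 0 < s → deriv μ s = -ν s
  le_rate : ∀ᵐ s, 0 < s → α * μ s ≤ ν s

lemma absolutelyContinuousOnInterval_congr {f g : ℝ → ℝ} {a b : ℝ}
    (hf : AbsolutelyContinuousOnInterval f a b) (h : EqOn f g (uIcc a b)) :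
    AbsolutelyContinuousOnInterval g a b := by
  rw [absolutelyContinuousOnInterval_iff] at hf ⊢
  intro ε hε
  obtain ⟨δ, hδ, H⟩ := hf ε hε
  refine ⟨δ, hδ, fun E hE hlt => ?_⟩
  refine lt_of_eq_of_lt (Finset.sum_congr rfl fun i hi => ?_) (H E hE hlt)
  rw [h (hE.1 i hi).1, h (hE.1 i hi).2]

namespace DecayKernel

variable {μ ν : ℝ → ℝ} {α m : ℝ}

lemma acOn (h : DecayKernel μ ν α m) {a b : ℝ} (ha : 0 ≤ a) (hab : a ≤ b) :
    AbsolutelyContinuousOnInterval μ a b := by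
  refine (h.ac b (ha.trans hab)).mono ?_
  rw [uIcc_of_le hab, uIcc_of_le (ha.trans hab)]
  exact Icc_subset_Icc_left ha

lemma intervalIntegrable_rate (h : DecayKernel μ ν α m) {a b : ℝ} (ha : 0 ≤ a) (hab : a ≤ b) :
    IntervalIntegrable ν volume a b := by
  refine (h.acOn ha hab).intervalIntegrable_deriv.neg.congr_ae ?_
  rw [EventuallyEq, ae_restrict_iff' measurableSet_uIoc]
  filter_upwards [h.deriv_eq] with s hs hs'
  rw [uIoc_of_le hab] at hs'
  simp [hs (ha.trans_lt hs'.1)]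

lemma integral_rate (h : DecayKernel μ ν α m) {a b : ℝ} (ha : 0 ≤ a) (hab : a ≤ b) :
    ∫ s in a..b, ν s = μ a - μ b := by
  have := (h.acOn ha hab).integral_deriv_eq_sub
  rw [← neg_sub, ← this, ← intervalIntegral.integral_neg]
  refine intervalIntegral.integral_congr_ae ?_
  filter_upwards [h.deriv_eq] with s hs hs'
  rw [uIoc_of_le hab] at hs'
  simp [hs (ha.trans_lt hs'.1)]

lemma integrableOn_rate (h : DecayKernel μ ν α m) : IntegrableOn ν (Ioi 0) := by
  refine integrableOn_Ioi_of_intervalIntegral_norm_bounded (μ 0) 0 (l := atTop) (b := fun x => x)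
    (fun i => ?_) tendsto_id ?_
  · rcases le_total 0 i with hi | hi
    · exact (intervalIntegrable_iff_integrableOn_Ioc_of_le hi).1
        (h.intervalIntegrable_rate le_rfl hi)
    · simp [Ioc_eq_empty (not_lt.2 hi)]
  · filter_upwards [eventually_ge_atTop 0] with i hi
    simp_rw [Real.norm_of_nonneg (h.rate_nonneg _)]
    rw [h.integral_rate le_rfl hi]
    linarith [h.nonneg i]

lemma integral_Ioi_rate_le (h : DecayKernel μ ν α m) : ∫ s in Ioi 0, ν s ≤ μ 0 := by
  refine le_of_tendsto (intervalIntegral_tendsto_integral_Ioi 0 h.integrableOn_rate tendsto_id) ?_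
  filter_upwards [eventually_ge_atTop 0] with i hi
  simp only [id]
  rw [h.integral_rate le_rfl hi]
  linarith [h.nonneg i]

lemma mass_pos (h : DecayKernel μ ν α m) : 0 < m := by
  rw [← h.mass, setIntegral_pos_iff_support_of_nonneg_ae
    (Eventually.of_forall fun s => h.nonneg s) h.integrable]
  obtain ⟨ε, hε, H⟩ := Metric.eventually_nhds_iff.1 (h.cont.continuousAt.eventually
    (lt_mem_nhds h.pos_zero : ∀ᶠ y in 𝓝 (μ 0), 0 < y))
  have : Ioo 0 ε ⊆ Function.support μ ∩ Ioi 0 := fun s hs =>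
    ⟨(H (by simpa [abs_of_pos hs.1] using hs.2)).ne', hs.1⟩
  refine lt_of_lt_of_le ?_ (measure_mono this)
  simpa using hε

end DecayKernel

/-- The extension `s ↦ μ (max s 0)`, constant on `(-∞, 0]`, of a kernel on `[0, ∞)`. It is antitone
by the fundamental theorem of calculus, its derivative being at most `-αμ ≤ 0`. -/
lemma IsMemoryKernel.decayKernel {μ : ℝ → ℝ} {α : ℝ} (h : IsMemoryKernel μ α) :
    DecayKernel (fun s => μ (max s 0)) (fun s => |deriv (fun s => μ (max s 0)) s|) α
      (muTilde μ) := by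
  set κ : ℝ → ℝ := fun s => μ (max s 0) with hκ
  have hcontOn : ContinuousOn μ (Ici 0) := by
    intro x hx
    have hx0 : (0 : ℝ) ≤ x := hx
    have h1 := (h.locallyAC (x + 1) (by linarith)).continuousOn
    rw [uIcc_of_le (by linarith)] at h1
    refine (h1 x ⟨hx, by linarith⟩).mono_of_mem_nhdsWithin ?_
    rw [← Ici_inter_Iic]
    exact inter_mem self_mem_nhdsWithin (mem_nhdsWithin_of_mem_nhds (Iic_mem_nhds (by linarith)))
  have hcont : Continuous κ :=
    hcontOn.comp_continuous (by fun_prop) fun s => mem_Ici.2 (le_max_right _ _)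
  have hEq : ∀ s, 0 ≤ s → κ s = μ s := fun s hs => by simp [hκ, hs]
  have hac : ∀ b, 0 ≤ b → AbsolutelyContinuousOnInterval κ 0 b := fun b hb =>
    absolutelyContinuousOnInterval_congr (h.locallyAC b hb) fun s hs => by
      rw [uIcc_of_le hb] at hs
      exact (hEq s hs.1).symm
  have hderiv : ∀ s, 0 < s → deriv κ s = deriv μ s := fun s hs =>
    EventuallyEq.deriv_eq (by filter_upwards [lt_mem_nhds hs] with t ht using hEq t ht.le)
  have hle : ∀ᵐ s, 0 < s → deriv κ s ≤ -α * κ s := by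
    have := (ae_restrict_iff' measurableSet_Ioi).1 h.deriv_le
    filter_upwards [this] with s hs hs0
    rw [hderiv s hs0, hEq s hs0.le]
    exact hs hs0
  have hnn : ∀ s, 0 ≤ κ s := fun s => h.nonneg _ (le_max_right _ _)
  have hnp : ∀ᵐ s, 0 < s → deriv κ s ≤ 0 := by
    filter_upwards [hle] with s hs hs0
    nlinarith [hs hs0, mul_nonneg h.rate_pos.le (hnn s)]
  have hantiOn : ∀ a b, 0 ≤ a → a ≤ b → κ b ≤ κ a := by
    intro a b ha hab
    have h1 : AbsolutelyContinuousOnInterval κ a b := (hac b (ha.trans hab)).mono (by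
      rw [uIcc_of_le hab, uIcc_of_le (ha.trans hab)]
      exact Icc_subset_Icc_left ha)
    have h2 := h1.integral_deriv_eq_sub
    have h3 : ∫ x in a..b, deriv κ x ≤ ∫ x in a..b, (0 : ℝ) := by
      refine intervalIntegral.integral_mono_ae_restrict hab h1.intervalIntegrable_deriv (by simp) ?_
      have : ∀ᵐ s ∂(volume.restrict (Icc a b)), s ≠ a := by
        refine ae_restrict_of_ae ?_
        simp [ae_iff, measure_singleton]
      filter_upwards [this, ae_restrict_of_ae hnp, ae_restrict_mem measurableSet_Icc]
        with s h1 h2 h3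
      exact h2 (ha.trans_lt (lt_of_le_of_ne h3.1 (Ne.symm h1)))
    simp at h3
    linarith
  have hsplit : ∀ s, κ s = κ (max s 0) := fun s => by simp [hκ]
  refine ⟨hcont, ?_, hnn, by simpa [hκ] using h.pos_zero, ?_, ?_, h.mass_lt_one, h.rate_pos, hac,
    by fun_prop, fun s => abs_nonneg _, ?_, ?_⟩
  · intro a b hab
    rw [hsplit a, hsplit b]
    exact hantiOn _ _ (le_max_right _ _) (max_le_max_right _ hab)
  · exact h.integrable.congr_fun (fun s hs => (hEq s (le_of_lt hs)).symm) measurableSet_Ioi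
  · exact setIntegral_congr_fun measurableSet_Ioi fun s hs => hEq s (le_of_lt hs)
  · filter_upwards [hnp] with s hs hs0
    rw [abs_of_nonpos (hs hs0), neg_neg]
  · filter_upwards [hnp, hle] with s hs hs1 hs0
    rw [abs_of_nonpos (hs hs0)]
    linarith [hs1 hs0]

/-! ### Integrals over the past, and their derivative -/

/-- The kernel cut off to positive lags: `κ s` for `s > 0`, and `0` for `s ≤ 0`. Then
`∫₀^∞ κ(s) f(t - s) ds = ∫ causal κ (t - r) f(r) dr`, an integral over a fixed domain. -/
noncomputable def causal (κ : ℝ → ℝ) : ℝ → ℝ := (Ioi (0 : ℝ)).indicator κ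

lemma causal_of_pos {κ : ℝ → ℝ} {s : ℝ} (hs : 0 < s) : causal κ s = κ s :=
  indicator_of_mem (mem_Ioi.2 hs) κ

lemma causal_of_nonpos {κ : ℝ → ℝ} {s : ℝ} (hs : s ≤ 0) : causal κ s = 0 :=
  indicator_of_notMem (by simpa using hs) κ

lemma measurable_causal {κ : ℝ → ℝ} (h : Measurable κ) : Measurable (causal κ) :=
  h.indicator measurableSet_Ioi

lemma causal_nonneg {κ : ℝ → ℝ} (h : ∀ s, 0 ≤ κ s) (s : ℝ) : 0 ≤ causal κ s :=
  indicator_nonneg (fun x _ => h x) s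

lemma setIntegral_Ioi_eq {E : Type*} [NormedAddCommGroup E] [NormedSpace ℝ E] (κ : ℝ → ℝ)
    (f : ℝ → E) (t : ℝ) :
    ∫ s in Ioi 0, κ s • f (t - s) = ∫ r, causal κ (t - r) • f r := by
  rw [← integral_sub_left_eq_self (fun r => causal κ (t - r) • f r) volume t,
    ← integral_indicator measurableSet_Ioi]
  congr 1 with s
  by_cases hs : 0 < s
  · simp [causal, hs]
  · simp [causal, hs]

lemma integrableOn_Ioi_iff {E : Type*} [NormedAddCommGroup E] [NormedSpace ℝ E] (κ : ℝ → ℝ)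
    (f : ℝ → E) (t : ℝ) :
    IntegrableOn (fun s => κ s • f (t - s)) (Ioi 0) ↔
      Integrable (fun r => causal κ (t - r) • f r) := by
  rw [← integrable_indicator_iff measurableSet_Ioi,
    ← integrable_comp_sub_left (fun r => causal κ (t - r) • f r) t]
  refine integrable_congr (Eventually.of_forall fun s => ?_)
  by_cases hs : 0 < s
  · simp [causal, hs]
  · simp [causal, hs]

namespace DecayKernel

variable {μ ν : ℝ → ℝ} {α m : ℝ}

lemma intervalIntegrable_causal_rate (h : DecayKernel μ ν α m) (S T r : ℝ) :
    IntervalIntegrable (fun t => causal ν (t - r)) volume S T := by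
  have : Integrable (fun t => causal ν (t - r)) :=
    (integrable_indicator_iff measurableSet_Ioi).2 h.integrableOn_rate |>.comp_sub_right r
  exact this.intervalIntegrable

/-- The total rate at which the kernel decreases during `[S, T]` at the fixed past time `r`. For
`S < r < T` only the lags in `(0, T - r)` contribute, at most `μ 0 ≤ μ (S - r)`. -/
lemma integral_causal_rate_le (h : DecayKernel μ ν α m) {S T : ℝ} (hST : S ≤ T) (r : ℝ) :
    ∫ t in S..T, causal ν (t - r) ≤ if r < T then μ (S - r) else 0 := by
  rw [intervalIntegral.integral_comp_sub_right (fun s => causal ν s)]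
  have hi : ∀ a b, IntervalIntegrable (causal ν) volume a b := fun a b =>
    ((integrable_indicator_iff measurableSet_Ioi).2 h.integrableOn_rate).intervalIntegrable
  have key : ∀ a b : ℝ, 0 ≤ a → a ≤ b → ∫ s in a..b, causal ν s = μ a - μ b := by
    intro a b ha hab
    rw [← h.integral_rate ha hab]
    refine intervalIntegral.integral_congr_ae (Eventually.of_forall fun s hs => ?_)
    rw [uIoc_of_le hab] at hs
    exact causal_of_pos (ha.trans_lt hs.1)
  have key0 : ∀ a b : ℝ, b ≤ 0 → a ≤ b → ∫ s in a..b, causal ν s = 0 := by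
    intro a b hb hab
    rw [intervalIntegral.integral_congr_ae (g := fun _ => (0 : ℝ))
      (Eventually.of_forall fun s hs => ?_)]
    · simp
    · rw [uIoc_of_le hab] at hs
      exact causal_of_nonpos (hs.2.trans hb)
  split_ifs with hr
  · rcases le_total 0 (S - r) with h0 | h0
    · rw [key _ _ h0 (by linarith)]
      linarith [h.nonneg (T - r)]
    · rw [← intervalIntegral.integral_add_adjacent_intervals (hi _ 0) (hi 0 _), key0 _ _ le_rfl h0,
        key _ _ le_rfl (by linarith)]
      linarith [h.nonneg (T - r), h.anti h0]
  · rw [key0 _ _ (by linarith) (by linarith)]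

/-- By Tonelli, integrating the rate in time first leaves the kernel itself, so a weight which is
integrable against `μ (-r)` is integrable against the rate on `[S, T] × ℝ`. -/
lemma integrable_prod_rate (h : DecayKernel μ ν α m) {S T : ℝ} (hS : 0 ≤ S) (hST : S ≤ T)
    {B : ℝ → ℝ} (hB0 : ∀ r, 0 ≤ B r) (hB : IntegrableOn (fun r => μ (-r) * B r) (Iio T))
    (hBm : AEStronglyMeasurable B) :
    Integrable (fun p : ℝ × ℝ => causal ν (p.1 - p.2) * B p.2)
      ((volume.restrict (Ioc S T)).prod volume) := by
  have hm : AEStronglyMeasurable (fun p : ℝ × ℝ => causal ν (p.1 - p.2) * B p.2)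
      ((volume.restrict (Ioc S T)).prod volume) := by
    refine AEStronglyMeasurable.mul ?_ hBm.comp_snd
    exact ((measurable_causal h.meas_rate).comp (by fun_prop)).aestronglyMeasurable
  rw [integrable_prod_iff' hm]
  refine ⟨Eventually.of_forall fun r => ?_, ?_⟩
  · have := (intervalIntegrable_iff_integrableOn_Ioc_of_le hST).1
      (h.intervalIntegrable_causal_rate S T r)
    exact Integrable.mul_const this (B r)
  · have hdom : Integrable ((Iio T).indicator fun r => μ (-r) * B r) :=
      (integrable_indicator_iff measurableSet_Iio).2 hB
    refine hdom.mono' hm.norm.prod_swap.integral_prod_right' (Eventually.of_forall fun r => ?_)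
    rw [Real.norm_of_nonneg (integral_nonneg fun t => norm_nonneg _)]
    simp_rw [norm_mul, Real.norm_of_nonneg (hB0 r),
      Real.norm_of_nonneg (causal_nonneg h.rate_nonneg _)]
    rw [integral_mul_const, ← intervalIntegral.integral_of_le hST]
    have := h.integral_causal_rate_le hST r
    by_cases hr : r < T
    · rw [if_pos hr] at this
      rw [indicator_of_mem (mem_Iio.2 hr)]
      exact mul_le_mul_of_nonneg_right (this.trans (h.anti (by linarith))) (hB0 r)
    · rw [if_neg hr] at this
      rw [indicator_of_notMem (by simpa using hr)]
      exact mul_nonpos_of_nonpos_of_nonneg this (hB0 r)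

lemma integrable_prod_kernel (h : DecayKernel μ ν α m) {S T : ℝ} (hS : 0 ≤ S) (hST : S ≤ T)
    {B : ℝ → ℝ} (hB0 : ∀ r, 0 ≤ B r) (hB : IntegrableOn (fun r => μ (-r) * B r) (Iio T))
    (hBm : AEStronglyMeasurable B) :
    Integrable (fun p : ℝ × ℝ => causal μ (p.1 - p.2) * B p.2)
      ((volume.restrict (Ioc S T)).prod volume) := by
  have hm : AEStronglyMeasurable (fun p : ℝ × ℝ => causal μ (p.1 - p.2) * B p.2)
      ((volume.restrict (Ioc S T)).prod volume) := by
    refine AEStronglyMeasurable.mul ?_ hBm.comp_snd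
    exact ((measurable_causal h.cont.measurable).comp (by fun_prop)).aestronglyMeasurable
  rw [integrable_prod_iff' hm]
  have hle : ∀ t r, t ∈ Ioc S T → causal μ (t - r) ≤ (Iio T).indicator (fun r => μ (-r)) r := by
    intro t r ht
    by_cases hr : r < t
    · rw [causal_of_pos (by linarith), indicator_of_mem (mem_Iio.2 (by linarith [ht.2]))]
      exact h.anti (by linarith [ht.1])
    · rw [causal_of_nonpos (by linarith)]
      exact indicator_nonneg (fun x _ => h.nonneg _) r
  refine ⟨Eventually.of_forall fun r => ?_, ?_⟩
  · have hmr : Measurable fun t => causal μ (t - r) :=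
      (measurable_causal h.cont.measurable).comp (by fun_prop)
    refine Integrable.mul_const (f := fun t => causal μ (t - r))
      (Measure.integrableOn_of_bounded (M := μ (-r)) (s := Ioc S T) (by simp)
        hmr.aestronglyMeasurable ?_) (B r)
    filter_upwards [ae_restrict_mem measurableSet_Ioc] with t ht
    rw [Real.norm_of_nonneg (causal_nonneg h.nonneg _)]
    exact (hle t r ht).trans (indicator_le_self' (fun x _ => h.nonneg _) r)
  · have hdom : Integrable ((Iio T).indicator fun r => (μ (-r) * B r) * (T - S)) :=
      (integrable_indicator_iff measurableSet_Iio).2 (hB.mul_const _)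
    refine hdom.mono' hm.norm.prod_swap.integral_prod_right' (Eventually.of_forall fun r => ?_)
    rw [Real.norm_of_nonneg (integral_nonneg fun t => norm_nonneg _)]
    have hb : ∀ t ∈ Ioc S T, ‖‖causal μ (t - r) * B r‖‖ ≤
        (Iio T).indicator (fun r => μ (-r)) r * B r := by
      intro t ht
      rw [norm_norm, norm_mul, Real.norm_of_nonneg (hB0 r),
        Real.norm_of_nonneg (causal_nonneg h.nonneg _)]
      exact mul_le_mul_of_nonneg_right (hle t r ht) (hB0 r)
    have := norm_setIntegral_le_of_norm_le_const (μ := volume) (by simp) hb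
    rw [Real.norm_of_nonneg (integral_nonneg fun t => norm_nonneg _)] at this
    refine this.trans (le_of_eq ?_)
    by_cases hr : r < T <;> simp [indicator, hr, hST]

/-- The fundamental theorem of calculus for `t ↦ causal μ (t - r) * g t` at a fixed past time `r`.
The cut-off at `t = r` creates no jump because `g r = 0`. -/
lemma integral_section (h : DecayKernel μ ν α m) {S T r : ℝ} (hST : S ≤ T)
    {g g' : ℝ → ℝ} (hg : ∀ t ∈ Icc S T, HasDerivWithinAt g (g' t) (Icc S T) t)
    (hg' : ContinuousOn g' (Icc S T)) (hr : r ∈ Icc S T → g r = 0) :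
    ∫ t in S..T, (causal μ (t - r) * g' t - causal ν (t - r) * g t) =
      causal μ (T - r) * g T - causal μ (S - r) * g S := by
  have hgc : ContinuousOn g (Icc S T) := fun t ht => (hg t ht).continuousWithinAt
  -- On `[a, T]` with `r ≤ a` only positive lags occur, and both factors are absolutely continuous.
  have main : ∀ a, S ≤ a → a ≤ T → r ≤ a →
      ∫ t in a..T, (causal μ (t - r) * g' t - causal ν (t - r) * g t) =
        μ (T - r) * g T - μ (a - r) * g a := by
    intro a hSa haT hra
    have hsub : Icc a T ⊆ Icc S T := Icc_subset_Icc_left hSa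
    obtain ⟨C, hC⟩ := isCompact_Icc.exists_bound_of_continuousOn hg'
    have hlip : LipschitzOnWith C.toNNReal (fun s => g (s + r)) (uIcc (a - r) (T - r)) := by
      rw [uIcc_of_le (by linarith)]
      refine (convex_Icc _ _).lipschitzOnWith_of_nnnorm_hasDerivWithin_le
        (f' := fun s => g' (s + r)) (fun s hs => ?_) fun s hs => ?_
      · have h1 := hg (s + r) (hsub ⟨by linarith [hs.1], by linarith [hs.2]⟩)
        have h2 : HasDerivWithinAt (fun s => s + r) 1 (Icc (a - r) (T - r)) s :=
          (hasDerivWithinAt_id s _).add_const r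
        have := h1.scomp s h2 (fun x hx => hsub ⟨by linarith [hx.1], by linarith [hx.2]⟩)
        simpa [Function.comp_def] using this
      · have := hC (s + r) (hsub ⟨by linarith [hs.1], by linarith [hs.2]⟩)
        rw [← NNReal.coe_le_coe, coe_nnnorm, Real.coe_toNNReal']
        exact this.trans (le_max_left _ _)
    have hft := (h.acOn (a := a - r) (b := T - r) (by linarith)
      (by linarith)).integral_deriv_mul_eq_sub hlip.absolutelyContinuousOnInterval
    simp only [sub_add_cancel] at hft
    have hch := intervalIntegral.integral_comp_sub_right (a := a) (b := T)
      (fun s => causal μ s * g' (s + r) - causal ν s * g (s + r)) r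
    simp only [sub_add_cancel] at hch
    rw [hch, ← hft]
    refine intervalIntegral.integral_congr_ae ?_
    have hne : ∀ᵐ s : ℝ, s ≠ T - r := by simp [ae_iff, measure_singleton]
    filter_upwards [h.deriv_eq, hne] with s hs hsT hmem
    rw [uIoc_of_le (by linarith)] at hmem
    have hs0 : 0 < s := by linarith [hmem.1]
    have hlt : s < T - r := lt_of_le_of_ne hmem.2 hsT
    have hder : HasDerivAt g (g' (s + r)) (s + r) :=
      (hg (s + r) (hsub ⟨by linarith [hmem.1], by linarith⟩)).hasDerivAt
        (Icc_mem_nhds (by linarith [hmem.1]) (by linarith))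
    rw [(hder.comp_add_const s r).deriv, hs hs0, causal_of_pos hs0, causal_of_pos hs0]
    ring
  have hi : ∀ a b, S ≤ a → a ≤ b → b ≤ T →
      IntervalIntegrable (fun t => causal μ (t - r) * g' t - causal ν (t - r) * g t)
        volume a b := by
    intro a b hSa hab hbT
    have hsub : uIcc a b ⊆ Icc S T := by
      rw [uIcc_of_le hab]
      exact Icc_subset_Icc hSa hbT
    have hmr : Measurable fun t => causal μ (t - r) :=
      (measurable_causal h.cont.measurable).comp (by fun_prop)
    have h1 : IntervalIntegrable (fun t => causal μ (t - r)) volume a b := by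
      rw [intervalIntegrable_iff_integrableOn_Ioc_of_le hab]
      refine Measure.integrableOn_of_bounded (M := μ 0) (s := Ioc a b) (by simp)
        hmr.aestronglyMeasurable (Eventually.of_forall fun t => ?_)
      rw [Real.norm_of_nonneg (causal_nonneg h.nonneg _)]
      rcases le_or_gt (t - r) 0 with ht | ht
      · rw [causal_of_nonpos ht]
        exact h.nonneg _
      · rw [causal_of_pos ht]
        exact h.anti ht.le
    exact (h1.mul_continuousOn (hg'.mono hsub)).sub
      ((h.intervalIntegrable_causal_rate a b r).mul_continuousOn (hgc.mono hsub))
  have hzero : ∀ a b, a ≤ b → b ≤ r →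
      ∫ t in a..b, (causal μ (t - r) * g' t - causal ν (t - r) * g t) = 0 := by
    intro a b hab hbr
    rw [intervalIntegral.integral_congr (g := fun _ => (0 : ℝ))]
    · simp
    · intro t ht
      rw [uIcc_of_le hab] at ht
      simp [causal_of_nonpos (show t - r ≤ 0 by linarith [ht.2])]
  rcases lt_or_ge r S with hrS | hrS
  · rw [main S le_rfl hST hrS.le, causal_of_pos (by linarith), causal_of_pos (by linarith)]
  · rcases lt_or_ge r T with hrT | hrT
    · rw [← intervalIntegral.integral_add_adjacent_intervals (hi S r le_rfl hrS hrT.le)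
        (hi r T hrS hrT.le le_rfl), hzero S r hrS le_rfl, main r hrS hrT.le le_rfl,
        hr ⟨hrS, hrT.le⟩, causal_of_pos (by linarith),
        causal_of_nonpos (show S - r ≤ 0 by linarith)]
      ring
    · rw [hzero S T hST hrT, causal_of_nonpos (show T - r ≤ 0 by linarith),
        causal_of_nonpos (show S - r ≤ 0 by linarith)]
      ring

/-- Leibniz rule for memory integrals: the derivative of `∫ causal μ (t - r) g(t, r) dr` is
`∫ causal μ (t - r) ∂ₜg(t, r) dr - ∫ causal ν (t - r) g(t, r) dr`, in integrated form, when `g`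
vanishes on the diagonal and `g`, `∂ₜg` are dominated by a weight `B` integrable against the kernel.
It follows from `integral_section` by Fubini. -/
lemma integral_memory_sub (h : DecayKernel μ ν α m) {S T : ℝ} (hS : 0 ≤ S) (hST : S ≤ T)
    {B : ℝ → ℝ} (hB0 : ∀ r, 0 ≤ B r) (hB : IntegrableOn (fun r => μ (-r) * B r) (Iio T))
    (hBm : AEStronglyMeasurable B) {g g' : ℝ → ℝ → ℝ}
    (hg : ∀ r, ∀ t ∈ Icc S T, HasDerivWithinAt (fun t => g t r) (g' t r) (Icc S T) t)
    (hg' : ∀ r, ContinuousOn (fun t => g' t r) (Icc S T)) (hgr : ∀ r ∈ Icc S T, g r r = 0)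
    (hgm : AEStronglyMeasurable (fun p : ℝ × ℝ => g p.1 p.2)
      ((volume.restrict (Ioc S T)).prod volume))
    (hgm' : AEStronglyMeasurable (fun p : ℝ × ℝ => g' p.1 p.2)
      ((volume.restrict (Ioc S T)).prod volume))
    (hgB : ∀ r, ∀ t ∈ Icc S T, |g t r| ≤ B r) (hgB' : ∀ r, ∀ t ∈ Icc S T, |g' t r| ≤ B r)
    (hiT : Integrable fun r => causal μ (T - r) * g T r)
    (hiS : Integrable fun r => causal μ (S - r) * g S r) :
    Integrable (fun p : ℝ × ℝ => causal μ (p.1 - p.2) * g' p.1 p.2)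
      ((volume.restrict (Ioc S T)).prod volume) ∧
    Integrable (fun p : ℝ × ℝ => causal ν (p.1 - p.2) * g p.1 p.2)
      ((volume.restrict (Ioc S T)).prod volume) ∧
    (∫ r, causal μ (T - r) * g T r) - ∫ r, causal μ (S - r) * g S r =
      ∫ t in S..T, ((∫ r, causal μ (t - r) * g' t r) - ∫ r, causal ν (t - r) * g t r) := by
  have hae : ∀ {P : ℝ → ℝ → Prop}, (∀ r, ∀ t ∈ Icc S T, P t r) →
      ∀ᵐ p : ℝ × ℝ ∂((volume.restrict (Ioc S T)).prod volume), P p.1 p.2 := by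
    intro P hP
    have : ∀ᵐ t ∂(volume.restrict (Ioc S T)), t ∈ Ioc S T := ae_restrict_mem measurableSet_Ioc
    filter_upwards [Measure.quasiMeasurePreserving_fst.ae this] with p hp
    exact hP _ _ (Ioc_subset_Icc_self hp)
  have h1 : Integrable (fun p : ℝ × ℝ => causal μ (p.1 - p.2) * g' p.1 p.2)
      ((volume.restrict (Ioc S T)).prod volume) := by
    refine (h.integrable_prod_kernel hS hST hB0 hB hBm).mono' ?_ ?_
    · exact ((measurable_causal h.cont.measurable).comp (by fun_prop)).aestronglyMeasurable.mul hgm'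
    · filter_upwards [hae hgB'] with p hp
      rw [norm_mul, Real.norm_of_nonneg (causal_nonneg h.nonneg _)]
      exact mul_le_mul_of_nonneg_left hp (causal_nonneg h.nonneg _)
  have h2 : Integrable (fun p : ℝ × ℝ => causal ν (p.1 - p.2) * g p.1 p.2)
      ((volume.restrict (Ioc S T)).prod volume) := by
    refine (h.integrable_prod_rate hS hST hB0 hB hBm).mono' ?_ ?_
    · exact ((measurable_causal h.meas_rate).comp (by fun_prop)).aestronglyMeasurable.mul hgm
    · filter_upwards [hae hgB] with p hp
      rw [norm_mul, Real.norm_of_nonneg (causal_nonneg h.rate_nonneg _)]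
      exact mul_le_mul_of_nonneg_left hp (causal_nonneg h.rate_nonneg _)
  refine ⟨h1, h2, ?_⟩
  rw [← integral_sub hiT hiS, intervalIntegral.integral_of_le hST]
  have e1 : ∀ᵐ t ∂(volume.restrict (Ioc S T)),
      (∫ r, causal μ (t - r) * g' t r) - ∫ r, causal ν (t - r) * g t r =
        ∫ r, (causal μ (t - r) * g' t r - causal ν (t - r) * g t r) := by
    filter_upwards [h1.prod_right_ae, h2.prod_right_ae] with t ht1 ht2
    rw [integral_sub ht1 ht2]
  rw [integral_congr_ae e1, integral_integral_swap (h1.sub h2)]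
  congr 1 with r
  rw [← intervalIntegral.integral_of_le hST,
    h.integral_section hST (hg r) (hg' r) (fun hr => hgr r hr)]

end DecayKernel

/-! ### Histories of finite memory energy -/

section Abstract

variable {V W : Type*} [NormedAddCommGroup V] [NormedSpace ℝ V]
  [NormedAddCommGroup W] [InnerProductSpace ℝ W]
  {μ ν : ℝ → ℝ} {α m : ℝ} {G : V →L[ℝ] W} {u : ℝ → V}

/-- A function `u : ℝ → V`, continuous on `[0, ∞)`, whose past has finite memory energy at time `0`:
`∫₀^∞ μ(s) ‖G (u 0 - u (-s))‖² ds < ∞`. -/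
structure Admissible (μ : ℝ → ℝ) (G : V →L[ℝ] W) (u : ℝ → V) : Prop where
  meas : AEStronglyMeasurable u
  cont : ContinuousOn u (Ici 0)
  hist : Integrable fun r => causal μ (0 - r) * ‖G (u 0 - u r)‖ ^ 2

lemma DecayKernel.integrable_causal (h : DecayKernel μ ν α m) (t : ℝ) :
    Integrable fun r => causal μ (t - r) :=
  ((integrable_indicator_iff measurableSet_Ioi).2 h.integrable).comp_sub_left t

lemma DecayKernel.integral_causal (h : DecayKernel μ ν α m) (t : ℝ) :
    ∫ r, causal μ (t - r) = m := by
  rw [integral_sub_left_eq_self (causal μ) volume t, causal, integral_indicator measurableSet_Ioi,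
    h.mass]

lemma DecayKernel.measurable_causal_sub (h : DecayKernel μ ν α m) (t : ℝ) :
    Measurable fun r => causal μ (t - r) :=
  (measurable_causal h.cont.measurable).comp (by fun_prop)

lemma DecayKernel.causal_le (h : DecayKernel μ ν α m) {t r : ℝ} (ht : 0 ≤ t) :
    causal μ (t - r) ≤ μ (-r) := by
  rcases le_or_gt (t - r) 0 with h0 | h0
  · rw [causal_of_nonpos h0]
    exact h.nonneg _
  · rw [causal_of_pos h0]
    exact h.anti (by linarith)

namespace Admissible

/-- The past is square integrable against the kernel frozen at time `0`. Since
`causal μ (t - r) ≤ μ (-r)` for `t ≥ 0`, this one weight dominates all the memory integrals over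
bounded time intervals. -/
lemma integrableOn_weight (hu : Admissible μ G u) (h : DecayKernel μ ν α m) {K : ℝ}
    (hK : ∀ x, ‖x‖ ≤ K * ‖G x‖) (T : ℝ) :
    IntegrableOn (fun r => μ (-r) * (1 + ‖u r‖ ^ 2)) (Iio T) := by
  have hm : AEStronglyMeasurable (fun r => μ (-r) * (1 + ‖u r‖ ^ 2)) := by
    refine AEStronglyMeasurable.mul (h.cont.comp continuous_neg).aestronglyMeasurable ?_
    exact aestronglyMeasurable_const.add (hu.meas.norm.pow 2)
  have h1 : IntegrableOn (fun r => μ (-r) * (1 + ‖u r‖ ^ 2)) (Iio 0) := by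
    have hd : IntegrableOn (fun r => causal μ (0 - r) * (1 + 2 * ‖u 0‖ ^ 2)
        + 2 * K ^ 2 * (causal μ (0 - r) * ‖G (u 0 - u r)‖ ^ 2)) (Iio 0) :=
      (((h.integrable_causal 0).mul_const _).add (hu.hist.const_mul _)).integrableOn
    refine Integrable.mono' hd hm.restrict ?_
    filter_upwards [ae_restrict_mem measurableSet_Iio] with r hr
    have hr0 : r < 0 := hr
    rw [causal_of_pos (by linarith), zero_sub]
    have hμ := h.nonneg (-r)
    rw [Real.norm_of_nonneg (by positivity)]
    have a1 : ‖u r‖ ≤ ‖u 0‖ + ‖u 0 - u r‖ := by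
      have := norm_sub_le (u 0) (u 0 - u r)
      simpa using this
    have a2 := hK (u 0 - u r)
    have a3 : ‖u r‖ ^ 2 ≤ 2 * ‖u 0‖ ^ 2 + 2 * ‖u 0 - u r‖ ^ 2 := by
      nlinarith [sq_nonneg (‖u 0‖ - ‖u 0 - u r‖), norm_nonneg (u r)]
    have a4 : ‖u 0 - u r‖ ^ 2 ≤ K ^ 2 * ‖G (u 0 - u r)‖ ^ 2 := by
      rw [← mul_pow]
      exact pow_le_pow_left₀ (norm_nonneg _) a2 2
    nlinarith
  have h2 : IntegrableOn (fun r => μ (-r) * (1 + ‖u r‖ ^ 2)) (Icc 0 (max T 0)) := by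
    refine ContinuousOn.integrableOn_Icc ?_
    refine ContinuousOn.mul (h.cont.comp continuous_neg).continuousOn ?_
    exact continuousOn_const.add ((hu.cont.mono Icc_subset_Ici_self).norm.pow 2)
  refine (h1.union h2).mono_set fun r hr => ?_
  rcases lt_or_ge r 0 with h0 | h0
  · exact Or.inl h0
  · exact Or.inr ⟨h0, (le_of_lt hr).trans (le_max_left _ _)⟩

lemma integrable_causal_weight (hu : Admissible μ G u) (h : DecayKernel μ ν α m) {K : ℝ}
    (hK : ∀ x, ‖x‖ ≤ K * ‖G x‖) {t : ℝ} (ht : 0 ≤ t) :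
    Integrable fun r => causal μ (t - r) * (1 + ‖u r‖ ^ 2) := by
  have hd := (integrable_indicator_iff measurableSet_Iio).2 (hu.integrableOn_weight h hK t)
  refine hd.mono' ?_ (Eventually.of_forall fun r => ?_)
  · exact (h.measurable_causal_sub t).aestronglyMeasurable.mul
      (aestronglyMeasurable_const.add (hu.meas.norm.pow 2))
  · rw [Real.norm_of_nonneg (mul_nonneg (causal_nonneg h.nonneg _) (by positivity))]
    by_cases hr : r < t
    · rw [indicator_of_mem (mem_Iio.2 hr)]
      exact mul_le_mul_of_nonneg_right (h.causal_le ht) (by positivity)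
    · rw [indicator_of_notMem (by simpa using hr), causal_of_nonpos (by linarith), zero_mul]

lemma integrable_causal_smul {E : Type*} [NormedAddCommGroup E] [NormedSpace ℝ E]
    (hu : Admissible μ G u) (h : DecayKernel μ ν α m) {K : ℝ}
    (hK : ∀ x, ‖x‖ ≤ K * ‖G x‖) {t : ℝ} (ht : 0 ≤ t) {f : ℝ → E} (hf : AEStronglyMeasurable f)
    {C : ℝ} (hC : ∀ r, ‖f r‖ ≤ C * (1 + ‖u r‖ ^ 2)) :
    Integrable fun r => causal μ (t - r) • f r := by
  refine ((hu.integrable_causal_weight h hK ht).const_mul C).mono'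
    ((h.measurable_causal_sub t).aestronglyMeasurable.smul hf) (Eventually.of_forall fun r => ?_)
  rw [norm_smul, Real.norm_of_nonneg (causal_nonneg h.nonneg _)]
  calc causal μ (t - r) * ‖f r‖ ≤ causal μ (t - r) * (C * (1 + ‖u r‖ ^ 2)) :=
        mul_le_mul_of_nonneg_left (hC r) (causal_nonneg h.nonneg _)
    _ = C * (causal μ (t - r) * (1 + ‖u r‖ ^ 2)) := by ring

lemma integrable_causal_mul
    (hu : Admissible μ G u) (h : DecayKernel μ ν α m) {K : ℝ}
    (hK : ∀ x, ‖x‖ ≤ K * ‖G x‖) {t : ℝ} (ht : 0 ≤ t) {f : ℝ → ℝ} (hf : AEStronglyMeasurable f)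
    {C : ℝ} (hC : ∀ r, |f r| ≤ C * (1 + ‖u r‖ ^ 2)) :
    Integrable fun r => causal μ (t - r) * f r :=
  hu.integrable_causal_smul h hK ht hf hC

end Admissible

lemma norm_sub_le_weight {E : Type*} [NormedAddCommGroup E] [NormedSpace ℝ E]
    (L : V →L[ℝ] E) {x : V} {R : ℝ} (hx : ‖x‖ ≤ R) (y : V) :
    ‖L (x - y)‖ ≤ ‖L‖ * (R + 1) * (1 + ‖y‖ ^ 2) := by
  have h1 : ‖L (x - y)‖ ≤ ‖L‖ * (R + ‖y‖) :=
    (L.le_opNorm _).trans (mul_le_mul_of_nonneg_left ((norm_sub_le _ _).trans (by linarith))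
      (norm_nonneg _))
  have hR : 0 ≤ R := (norm_nonneg x).trans hx
  have h2 : R + ‖y‖ ≤ (R + 1) * (1 + ‖y‖ ^ 2) := by
    nlinarith [sq_nonneg (‖y‖ - 1), norm_nonneg y, mul_nonneg hR (sq_nonneg ‖y‖)]
  rw [mul_assoc]
  exact h1.trans (mul_le_mul_of_nonneg_left h2 (norm_nonneg _))

lemma norm_sub_sq_le_weight {E : Type*} [NormedAddCommGroup E] [NormedSpace ℝ E]
    (L : V →L[ℝ] E) {x : V} {R : ℝ} (hx : ‖x‖ ≤ R) (y : V) :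
    ‖L (x - y)‖ ^ 2 ≤ ‖L‖ ^ 2 * (2 * R ^ 2 + 2) * (1 + ‖y‖ ^ 2) := by
  have h1 : ‖L (x - y)‖ ≤ ‖L‖ * (R + ‖y‖) :=
    (L.le_opNorm _).trans (mul_le_mul_of_nonneg_left ((norm_sub_le _ _).trans (by linarith))
      (norm_nonneg _))
  have hR : 0 ≤ R := (norm_nonneg x).trans hx
  have h2 : (R + ‖y‖) ^ 2 ≤ (2 * R ^ 2 + 2) * (1 + ‖y‖ ^ 2) := by
    nlinarith [sq_nonneg (R - ‖y‖), mul_nonneg (sq_nonneg R) (sq_nonneg ‖y‖)]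
  calc ‖L (x - y)‖ ^ 2 ≤ (‖L‖ * (R + ‖y‖)) ^ 2 := pow_le_pow_left₀ (norm_nonneg _) h1 2
    _ = ‖L‖ ^ 2 * (R + ‖y‖) ^ 2 := by ring
    _ ≤ ‖L‖ ^ 2 * ((2 * R ^ 2 + 2) * (1 + ‖y‖ ^ 2)) :=
      mul_le_mul_of_nonneg_left h2 (by positivity)
    _ = _ := by ring

/-- Twice the memory part of the energy: `∫₀^∞ μ(s) ‖G (u t - u (t - s))‖² ds`, written as an
integral over the past time `r = t - s`. -/
noncomputable def memory (μ : ℝ → ℝ) (G : V →L[ℝ] W) (u : ℝ → V) (t : ℝ) : ℝ :=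
  ∫ r, causal μ (t - r) * ‖G (u t - u r)‖ ^ 2

/-- The mean history `∫₀^∞ μ(s) (u t - u (t - s)) ds`, written as an integral over the past time. It
is the second multiplier. -/
noncomputable def memoryMean (μ : ℝ → ℝ) (u : ℝ → V) (t : ℝ) : V :=
  ∫ r, causal μ (t - r) • (u t - u r)

namespace Admissible

lemma integrable_memory (hu : Admissible μ G u) (h : DecayKernel μ ν α m) {K : ℝ}
    (hK : ∀ x, ‖x‖ ≤ K * ‖G x‖) {t : ℝ} (ht : 0 ≤ t) :
    Integrable fun r => causal μ (t - r) * ‖G (u t - u r)‖ ^ 2 := by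
  refine hu.integrable_causal_mul h hK ht
    ((G.continuous.comp_aestronglyMeasurable (aestronglyMeasurable_const.sub hu.meas)).norm.pow 2)
    (C := ‖G‖ ^ 2 * (2 * ‖u t‖ ^ 2 + 2)) fun r => ?_
  rw [abs_of_nonneg (by positivity)]
  exact norm_sub_sq_le_weight G le_rfl _

lemma integrable_memoryMean (hu : Admissible μ G u) (h : DecayKernel μ ν α m) {K : ℝ}
    (hK : ∀ x, ‖x‖ ≤ K * ‖G x‖) {t : ℝ} (ht : 0 ≤ t) :
    Integrable fun r => causal μ (t - r) • (u t - u r) := by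
  refine hu.integrable_causal_smul h hK ht (aestronglyMeasurable_const.sub hu.meas)
    (C := ‖ContinuousLinearMap.id ℝ V‖ * (‖u t‖ + 1)) fun r => ?_
  exact norm_sub_le_weight (ContinuousLinearMap.id ℝ V) le_rfl (u r)

lemma memory_nonneg (h : DecayKernel μ ν α m) (t : ℝ) : 0 ≤ memory μ G u t :=
  integral_nonneg fun r => mul_nonneg (causal_nonneg h.nonneg _) (by positivity)

lemma continuousOn_memory (hu : Admissible μ G u) (h : DecayKernel μ ν α m) {K : ℝ}
    (hK : ∀ x, ‖x‖ ≤ K * ‖G x‖) : ContinuousOn (memory μ G u) (Ici 0) := by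
  intro t₀ ht₀
  have ht₀' : (0 : ℝ) ≤ t₀ := ht₀
  obtain ⟨R, hR⟩ := (isCompact_Icc (a := (0 : ℝ)) (b := t₀ + 1)).exists_bound_of_continuousOn
    (hu.cont.mono Icc_subset_Ici_self)
  have hev : ∀ᶠ t in 𝓝[Ici 0] t₀, t ∈ Icc 0 (t₀ + 1) := by
    filter_upwards [self_mem_nhdsWithin,
      mem_nhdsWithin_of_mem_nhds (Iic_mem_nhds (show t₀ < t₀ + 1 by linarith))] with t h1 h2
    exact ⟨h1, h2⟩
  set C := ‖G‖ ^ 2 * (2 * R ^ 2 + 2) with hC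
  have hbound : Integrable ((Iio (t₀ + 1)).indicator
      fun r => C * (μ (-r) * (1 + ‖u r‖ ^ 2))) :=
    (integrable_indicator_iff measurableSet_Iio).2
      ((hu.integrableOn_weight h hK (t₀ + 1)).const_mul C)
  refine continuousWithinAt_of_dominated (bound := (Iio (t₀ + 1)).indicator
      fun r => C * (μ (-r) * (1 + ‖u r‖ ^ 2))) ?_ ?_ hbound ?_
  · refine Eventually.of_forall fun t => ?_
    exact (h.measurable_causal_sub t).aestronglyMeasurable.mul
      ((G.continuous.comp_aestronglyMeasurable (aestronglyMeasurable_const.sub hu.meas)).norm.pow 2)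
  · filter_upwards [hev] with t ht
    refine Eventually.of_forall fun r => ?_
    rw [Real.norm_of_nonneg (mul_nonneg (causal_nonneg h.nonneg _) (by positivity))]
    have hG := norm_sub_sq_le_weight G (hR t ht) (u r)
    by_cases hr : r < t₀ + 1
    · rw [indicator_of_mem (mem_Iio.2 hr)]
      calc causal μ (t - r) * ‖G (u t - u r)‖ ^ 2
          ≤ μ (-r) * (C * (1 + ‖u r‖ ^ 2)) :=
            mul_le_mul (h.causal_le ht.1) hG (by positivity) (h.nonneg _)
        _ = _ := by ring
    · rw [indicator_of_notMem (by simpa using hr), causal_of_nonpos (by linarith [ht.2]), zero_mul]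
  · have hne : ∀ᵐ r : ℝ, r ≠ t₀ := by simp [ae_iff, measure_singleton]
    filter_upwards [hne] with r hr
    refine ContinuousWithinAt.mul ?_ ?_
    · refine ContinuousAt.continuousWithinAt ?_
      rcases lt_or_gt_of_ne hr with hlt | hgt
      · have : ContinuousAt (fun t => μ (t - r)) t₀ := (h.cont.comp (by fun_prop)).continuousAt
        refine this.congr ?_
        filter_upwards [lt_mem_nhds hlt] with t ht
        rw [causal_of_pos (by linarith)]
      · refine (continuousAt_const (y := (0 : ℝ))).congr ?_
        filter_upwards [gt_mem_nhds hgt] with t ht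
        rw [causal_of_nonpos (by linarith)]
    · exact (G.continuous.continuousAt.comp_continuousWithinAt
        ((hu.cont t₀ ht₀).sub continuousWithinAt_const)).norm.pow 2

lemma integrable_inner {E : Type*} [NormedAddCommGroup E] [InnerProductSpace ℝ E]
    (L : V →L[ℝ] E) (y : E) (hu : Admissible μ G u) (h : DecayKernel μ ν α m) {K : ℝ}
    (hK : ∀ x, ‖x‖ ≤ K * ‖G x‖) {t : ℝ} (ht : 0 ≤ t) :
    Integrable fun r => causal μ (t - r) * ⟪y, L (u t - u r)⟫_ℝ := by
  have hi := (L.integrable_comp (hu.integrable_memoryMean h hK ht)).const_inner (𝕜 := ℝ) y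
  simpa [inner_smul_right] using hi

variable [CompleteSpace V]

lemma inner_memoryMean {E : Type*} [NormedAddCommGroup E] [InnerProductSpace ℝ E] [CompleteSpace E]
    (L : V →L[ℝ] E) (y : E) (hu : Admissible μ G u) (h : DecayKernel μ ν α m) {K : ℝ}
    (hK : ∀ x, ‖x‖ ≤ K * ‖G x‖) {t : ℝ} (ht : 0 ≤ t) :
    ∫ r, causal μ (t - r) * ⟪y, L (u t - u r)⟫_ℝ = ⟪y, L (memoryMean μ u t)⟫_ℝ := by
  have hi := hu.integrable_memoryMean h hK ht
  rw [memoryMean, ← L.integral_comp_comm hi, ← integral_inner (L.integrable_comp hi)]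
  congr 1 with r
  rw [map_smul, inner_smul_right]

variable [CompleteSpace W]

/-- Young's inequality under the memory integral. -/
lemma inner_memoryMean_le (y : W) (hu : Admissible μ G u) (h : DecayKernel μ ν α m) {K : ℝ}
    (hK : ∀ x, ‖x‖ ≤ K * ‖G x‖) {t : ℝ} (ht : 0 ≤ t) {c : ℝ} (hc : 0 < c) :
    |⟪y, G (memoryMean μ u t)⟫_ℝ| ≤ c * m * ‖y‖ ^ 2 + 1 / (4 * c) * memory μ G u t := by
  rw [← hu.inner_memoryMean G y h hK ht]
  refine abs_integral_le_integral_abs.trans ?_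
  have hi := h.integrable_causal t
  have h2 := (hi.mul_const (c * ‖y‖ ^ 2)).add
    ((hu.integrable_memory h hK ht).const_mul (1 / (4 * c)))
  have h3 : ∫ r, (causal μ (t - r) * (c * ‖y‖ ^ 2)
      + 1 / (4 * c) * (causal μ (t - r) * ‖G (u t - u r)‖ ^ 2)) =
      c * m * ‖y‖ ^ 2 + 1 / (4 * c) * memory μ G u t := by
    rw [integral_add (hi.mul_const _) ((hu.integrable_memory h hK ht).const_mul _),
      integral_mul_const, integral_const_mul, h.integral_causal, memory]
    ring
  rw [← h3]
  refine integral_mono (hu.integrable_inner G y h hK ht).abs h2 fun r => ?_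
  have h4 := abs_real_inner_le_norm y (G (u t - u r))
  have h5 : ‖y‖ * ‖G (u t - u r)‖ ≤ c * ‖y‖ ^ 2 + 1 / (4 * c) * ‖G (u t - u r)‖ ^ 2 := by
    have : c * ‖y‖ ^ 2 + 1 / (4 * c) * ‖G (u t - u r)‖ ^ 2 - ‖y‖ * ‖G (u t - u r)‖ =
        (2 * c * ‖y‖ - ‖G (u t - u r)‖) ^ 2 / (4 * c) := by
      field_simp
      ring
    have h6 : 0 ≤ (2 * c * ‖y‖ - ‖G (u t - u r)‖) ^ 2 / (4 * c) := by positivity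
    linarith
  have hk := causal_nonneg h.nonneg (t - r)
  simp only [abs_mul, abs_of_nonneg hk]
  nlinarith [mul_le_mul_of_nonneg_left (h4.trans h5) hk]

/-- Jensen's inequality for the mean history, as the case `y = G (memoryMean μ u t)`,
`c = 1 / (2m)` of `inner_memoryMean_le`. -/
lemma norm_memoryMean_sq_le (hu : Admissible μ G u) (h : DecayKernel μ ν α m) {K : ℝ}
    (hK : ∀ x, ‖x‖ ≤ K * ‖G x‖) {t : ℝ} (ht : 0 ≤ t) :
    ‖G (memoryMean μ u t)‖ ^ 2 ≤ m * memory μ G u t := by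
  have hm := h.mass_pos
  have h1 := hu.inner_memoryMean_le (G (memoryMean μ u t)) h hK ht (c := 1 / (2 * m))
    (by positivity)
  rw [real_inner_self_eq_norm_sq, abs_of_nonneg (by positivity)] at h1
  have h2 : 1 / (2 * m) * m = 1 / 2 := by field_simp
  have h3 : 1 / (4 * (1 / (2 * m))) = m / 2 := by field_simp; norm_num
  rw [h2, h3] at h1
  linarith

end Admissible

end Abstract

/-! ### Regular solutions -/

section Regular

variable {V H W : Type*} [NormedAddCommGroup V] [NormedSpace ℝ V]
  [NormedAddCommGroup H] [InnerProductSpace ℝ H]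
  [NormedAddCommGroup W] [InnerProductSpace ℝ W]
  {μ ν : ℝ → ℝ} {α m : ℝ} {ι : V →L[ℝ] H} {G : V →L[ℝ] W} {u w : ℝ → V} {v z : ℝ → H}
  {τ a k : ℝ}

/-- A solution `u`, with velocity `v`, regular enough for the multiplier computations: on `[0, ∞)`
it is continuously differentiable in `V` with derivative `w`, its velocity `v = ι w` is continuously
differentiable in `H` with derivative `z`, and the equation, with damping `a` and delayed damping
`k`, holds weakly at each time. On `[-τ, 0)` the velocity `v` is an independent datum, continuous up
to `0`. -/
structure RegularSolution (μ : ℝ → ℝ) (ι : V →L[ℝ] H) (G : V →L[ℝ] W) (τ a k : ℝ)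
    (u w : ℝ → V) (v z : ℝ → H) : Prop extends Admissible μ G u where
  cont_w : ContinuousOn w (Ici 0)
  deriv_u : ∀ t, 0 ≤ t → HasDerivWithinAt u (w t) (Ici 0) t
  val_w : ∀ t, 0 ≤ t → ι (w t) = v t
  cont_v : ContinuousOn v (Ici (-τ))
  cont_z : ContinuousOn z (Ici 0)
  deriv_v : ∀ t, 0 ≤ t → HasDerivWithinAt v (z t) (Ici 0) t
  equation : ∀ φ, ∀ t, 0 ≤ t →
    ⟪z t, ι φ⟫_ℝ + (⟪G (u t), G φ⟫_ℝ - (∫ s in Ioi 0, μ s * ⟪G (u (t - s)), G φ⟫_ℝ)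
      + a * ⟪v t, ι φ⟫_ℝ + k * ⟪v (t - τ), ι φ⟫_ℝ) = 0

/-- The dissipation of the memory, `½ ∫₀^∞ ν(s) ‖G (u t - u (t - s))‖² ds` with `ν = -μ'`. -/
noncomputable def dissipation (ν : ℝ → ℝ) (G : V →L[ℝ] W) (u : ℝ → V) (t : ℝ) : ℝ :=
  ∫ r, causal ν (t - r) * (1 / 2 * ‖G (u t - u r)‖ ^ 2)

namespace RegularSolution

lemma exists_bound (hs : RegularSolution μ ι G τ a k u w v z) {S T : ℝ} (hS : 0 ≤ S) (hτ : 0 < τ) :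
    ∃ R, 0 ≤ R ∧ ∀ t ∈ Icc S T, ‖u t‖ ≤ R ∧ ‖w t‖ ≤ R ∧ ‖v t‖ ≤ R ∧ ‖z t‖ ≤ R := by
  have hsub : Icc S T ⊆ Ici 0 := fun t ht => hS.trans ht.1
  obtain ⟨R₁, h1⟩ := isCompact_Icc.exists_bound_of_continuousOn (hs.cont.mono hsub)
  obtain ⟨R₂, h2⟩ := isCompact_Icc.exists_bound_of_continuousOn (hs.cont_w.mono hsub)
  obtain ⟨R₃, h3⟩ := isCompact_Icc.exists_bound_of_continuousOn
    (hs.cont_v.mono (hsub.trans (Ici_subset_Ici.2 (by linarith))))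
  obtain ⟨R₄, h4⟩ := isCompact_Icc.exists_bound_of_continuousOn (hs.cont_z.mono hsub)
  refine ⟨|R₁| + |R₂| + |R₃| + |R₄|, by positivity, fun t ht => ?_⟩
  have := le_abs_self R₁
  have := le_abs_self R₂
  have := le_abs_self R₃
  have := le_abs_self R₄
  have := abs_nonneg R₁
  have := abs_nonneg R₂
  have := abs_nonneg R₃
  have := abs_nonneg R₄
  exact ⟨by linarith [h1 t ht], by linarith [h2 t ht], by linarith [h3 t ht], by linarith [h4 t ht]⟩

variable [CompleteSpace V]

/-- The equation in terms of the mean history: `-Δu + ∫ μ(s) Δu(t - s) ds` is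
`-(1 - m) Δu - Δψ`, where `ψ` is the mean history. -/
lemma weak_form [CompleteSpace W] (hs : RegularSolution μ ι G τ a k u w v z)
    (h : DecayKernel μ ν α m) {K : ℝ} (hK : ∀ x, ‖x‖ ≤ K * ‖G x‖) (φ : V) {t : ℝ} (ht : 0 ≤ t) :
    ⟪z t, ι φ⟫_ℝ + (1 - m) * ⟪G (u t), G φ⟫_ℝ + ⟪G φ, G (memoryMean μ u t)⟫_ℝ
      + a * ⟪v t, ι φ⟫_ℝ + k * ⟪v (t - τ), ι φ⟫_ℝ = 0 := by
  have h1 := hs.equation φ t ht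
  have h2 : ∫ s in Ioi 0, μ s * ⟪G (u (t - s)), G φ⟫_ℝ =
      m * ⟪G (u t), G φ⟫_ℝ - ⟪G φ, G (memoryMean μ u t)⟫_ℝ := by
    have := setIntegral_Ioi_eq μ (fun r => ⟪G (u r), G φ⟫_ℝ) t
    simp only [smul_eq_mul] at this
    rw [this, ← hs.inner_memoryMean G (G φ) h hK ht, ← h.integral_causal t, ← integral_mul_const,
      ← integral_sub ((h.integrable_causal t).mul_const _)
        (hs.integrable_inner G (G φ) h hK ht)]
    congr 1 with r
    rw [map_sub, inner_sub_right, real_inner_comm (G (u t)), real_inner_comm (G (u r))]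
    ring
  rw [h2] at h1
  linarith

/-- The balance of the memory energy: its derivative is `⟪G w, G ψ⟫ - D`, with `ψ` the mean history
and `D` the dissipation. The integral `D` is only known to converge at almost every time. -/
lemma memory_identity [CompleteSpace W] (hs : RegularSolution μ ι G τ a k u w v z)
    (h : DecayKernel μ ν α m) {K : ℝ} (hK : ∀ x, ‖x‖ ≤ K * ‖G x‖) (hτ : 0 < τ)
    {S T : ℝ} (hS : 0 ≤ S) (hST : S ≤ T) :
    IntervalIntegrable (dissipation ν G u) volume S T ∧
    (∀ᵐ t ∂(volume.restrict (Ioc S T)),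
      Integrable fun r => causal ν (t - r) * (1 / 2 * ‖G (u t - u r)‖ ^ 2)) ∧
    IntervalIntegrable (fun t => ⟪G (w t), G (memoryMean μ u t)⟫_ℝ) volume S T ∧
    1 / 2 * memory μ G u T - 1 / 2 * memory μ G u S =
      ∫ t in S..T, (⟪G (w t), G (memoryMean μ u t)⟫_ℝ - dissipation ν G u t) := by
  have hsub : Icc S T ⊆ Ici 0 := fun t ht => hS.trans ht.1
  have hsub' : Ioc S T ⊆ Ici 0 := Ioc_subset_Icc_self.trans hsub
  obtain ⟨R, hR0, hR⟩ := hs.exists_bound (T := T) hS hτ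
  set C := ‖G‖ ^ 2 * (2 * R ^ 2 + 2) + ‖G‖ * R * (‖G‖ * (R + 1)) with hC
  have hT : 0 ≤ T := hS.trans hST
  have hmu : AEStronglyMeasurable (fun p : ℝ × ℝ => G (u p.1 - u p.2))
      ((volume.restrict (Ioc S T)).prod volume) := by
    refine G.continuous.comp_aestronglyMeasurable (AEStronglyMeasurable.sub ?_ hs.meas.comp_snd)
    exact ((hs.cont.mono hsub').aestronglyMeasurable measurableSet_Ioc).comp_fst
  have hmw : AEStronglyMeasurable (fun p : ℝ × ℝ => G (w p.1))
      ((volume.restrict (Ioc S T)).prod volume) :=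
    G.continuous.comp_aestronglyMeasurable
      ((hs.cont_w.mono hsub').aestronglyMeasurable measurableSet_Ioc).comp_fst
  have hfin : ∀ t, 0 ≤ t →
      Integrable fun r => causal μ (t - r) * (1 / 2 * ‖G (u t - u r)‖ ^ 2) := by
    intro t ht
    refine ((hs.integrable_memory h hK ht).const_mul (1 / 2)).congr
      (Eventually.of_forall fun r => ?_)
    simp only
    ring
  obtain ⟨h1, h2, h3⟩ := h.integral_memory_sub (S := S) (T := T) hS hST
    (B := fun r => C * (1 + ‖u r‖ ^ 2)) (fun r => by positivity)
    (((hs.integrableOn_weight h hK T).const_mul C).congr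
      (Eventually.of_forall fun r => by simp only; ring))
    ((aestronglyMeasurable_const.add (hs.meas.norm.pow 2)).const_mul C)
    (g := fun t r => 1 / 2 * ‖G (u t - u r)‖ ^ 2)
    (g' := fun t r => ⟪G (w t), G (u t - u r)⟫_ℝ)
    (fun r t ht => by
      have hd : HasDerivWithinAt (fun t => G (u t - u r)) (G (w t)) (Icc S T) t :=
        G.hasFDerivAt.comp_hasDerivWithinAt t
          (((hs.deriv_u t (hsub ht)).mono hsub).sub_const (u r))
      have := hd.norm_sq.const_mul (1 / 2)
      refine this.congr_deriv ?_
      rw [real_inner_comm]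
      ring)
    (fun r => by
      refine ContinuousOn.inner (G.continuous.comp_continuousOn (hs.cont_w.mono hsub)) ?_
      exact G.continuous.comp_continuousOn ((hs.cont.mono hsub).sub continuousOn_const))
    (fun r _ => by simp)
    ((hmu.norm.pow 2).const_mul _)
    (hmw.inner hmu)
    (fun r t ht => by
      have h1 := norm_sub_sq_le_weight G (hR t ht).1 (u r)
      have h2 : 0 ≤ ‖G‖ * R * (‖G‖ * (R + 1)) * (1 + ‖u r‖ ^ 2) := by positivity
      rw [abs_of_nonneg (by positivity), hC, add_mul]
      nlinarith [sq_nonneg ‖G (u t - u r)‖])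
    (fun r t ht => by
      have h1 := norm_sub_le_weight G (hR t ht).1 (u r)
      have h2 : 0 ≤ ‖G‖ ^ 2 * (2 * R ^ 2 + 2) * (1 + ‖u r‖ ^ 2) := by positivity
      have h3 : ‖G (w t)‖ ≤ ‖G‖ * R :=
        (G.le_opNorm _).trans (mul_le_mul_of_nonneg_left (hR t ht).2.1 (norm_nonneg _))
      have h4 := (abs_real_inner_le_norm (G (w t)) (G (u t - u r))).trans
        (mul_le_mul h3 h1 (norm_nonneg _) (by positivity))
      rw [hC, add_mul]
      linarith)
    (hfin T hT) (hfin S hS)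
  have e1 : ∀ t ∈ Ioc S T, ∫ r, causal μ (t - r) * ⟪G (w t), G (u t - u r)⟫_ℝ =
      ⟪G (w t), G (memoryMean μ u t)⟫_ℝ :=
    fun t ht => hs.inner_memoryMean G (G (w t)) h hK (hsub' ht)
  have e2 : ∀ t, ∫ r, causal μ (t - r) * (1 / 2 * ‖G (u t - u r)‖ ^ 2) =
      1 / 2 * memory μ G u t := by
    intro t
    rw [memory, ← integral_const_mul]
    congr 1 with r
    ring
  refine ⟨?_, h2.prod_right_ae, ?_, ?_⟩
  · rw [intervalIntegrable_iff_integrableOn_Ioc_of_le hST]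
    exact h2.integral_prod_left
  · rw [intervalIntegrable_iff_integrableOn_Ioc_of_le hST]
    refine h1.integral_prod_left.congr ?_
    filter_upwards [ae_restrict_mem measurableSet_Ioc] with t ht
    exact e1 t ht
  · rw [← e2, ← e2, h3]
    refine intervalIntegral.integral_congr_ae (Eventually.of_forall fun t ht => ?_)
    rw [uIoc_of_le hST] at ht
    rw [e1 t ht, dissipation]

/-- The derivative of `⟪v, ι ψ⟫`, with `ψ` the mean history, in integrated form. The term
`m ‖v‖²` is the gain from the second multiplier. -/
lemma memoryMean_identity [CompleteSpace H]
    (hs : RegularSolution μ ι G τ a k u w v z) (h : DecayKernel μ ν α m) {K : ℝ}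
    (hK : ∀ x, ‖x‖ ≤ K * ‖G x‖) (hτ : 0 < τ) {S T : ℝ} (hS : 0 ≤ S) (hST : S ≤ T) :
    IntervalIntegrable (fun t => ⟪z t, ι (memoryMean μ u t)⟫_ℝ + m * ‖v t‖ ^ 2
      - ∫ r, causal ν (t - r) * ⟪v t, ι (u t - u r)⟫_ℝ) volume S T ∧
    (∀ᵐ t ∂(volume.restrict (Ioc S T)),
      Integrable fun r => causal ν (t - r) * ⟪v t, ι (u t - u r)⟫_ℝ) ∧
    ⟪v T, ι (memoryMean μ u T)⟫_ℝ - ⟪v S, ι (memoryMean μ u S)⟫_ℝ =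
      ∫ t in S..T, (⟪z t, ι (memoryMean μ u t)⟫_ℝ + m * ‖v t‖ ^ 2
        - ∫ r, causal ν (t - r) * ⟪v t, ι (u t - u r)⟫_ℝ) := by
  have hsub : Icc S T ⊆ Ici 0 := fun t ht => hS.trans ht.1
  have hsub' : Ioc S T ⊆ Ici 0 := Ioc_subset_Icc_self.trans hsub
  have hcv : ContinuousOn v (Ici 0) := hs.cont_v.mono (Ici_subset_Ici.2 (by linarith))
  obtain ⟨R, hR0, hR⟩ := hs.exists_bound (T := T) hS hτ
  set C := R * (‖ι‖ * (R + 1)) + R ^ 2 with hC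
  have hT : 0 ≤ T := hS.trans hST
  have hmu : AEStronglyMeasurable (fun p : ℝ × ℝ => ι (u p.1 - u p.2))
      ((volume.restrict (Ioc S T)).prod volume) := by
    refine ι.continuous.comp_aestronglyMeasurable (AEStronglyMeasurable.sub ?_ hs.meas.comp_snd)
    exact ((hs.cont.mono hsub').aestronglyMeasurable measurableSet_Ioc).comp_fst
  have hmv : AEStronglyMeasurable (fun p : ℝ × ℝ => v p.1)
      ((volume.restrict (Ioc S T)).prod volume) :=
    ((hcv.mono hsub').aestronglyMeasurable measurableSet_Ioc).comp_fst
  have hmz : AEStronglyMeasurable (fun p : ℝ × ℝ => z p.1)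
      ((volume.restrict (Ioc S T)).prod volume) :=
    ((hs.cont_z.mono hsub').aestronglyMeasurable measurableSet_Ioc).comp_fst
  have hb : ∀ x : H, ∀ r, ∀ t ∈ Icc S T, ‖x‖ ≤ R →
      |⟪x, ι (u t - u r)⟫_ℝ| ≤ R * (‖ι‖ * (R + 1)) * (1 + ‖u r‖ ^ 2) := by
    intro x r t ht hx
    have h4 := (abs_real_inner_le_norm x (ι (u t - u r))).trans
        (mul_le_mul hx (norm_sub_le_weight ι (hR t ht).1 (u r)) (norm_nonneg _) hR0)
    linarith
  obtain ⟨h1, h2, h3⟩ := h.integral_memory_sub (S := S) (T := T) hS hST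
    (B := fun r => C * (1 + ‖u r‖ ^ 2)) (fun r => by positivity)
    (((hs.integrableOn_weight h hK T).const_mul C).congr
      (Eventually.of_forall fun r => by simp only; ring))
    ((aestronglyMeasurable_const.add (hs.meas.norm.pow 2)).const_mul C)
    (g := fun t r => ⟪v t, ι (u t - u r)⟫_ℝ)
    (g' := fun t r => ⟪v t, v t⟫_ℝ + ⟪z t, ι (u t - u r)⟫_ℝ)
    (fun r t ht => by
      have hd : HasDerivWithinAt (fun t => ι (u t - u r)) (v t) (Icc S T) t := by
        rw [← hs.val_w t (hsub ht)]
        exact ι.hasFDerivAt.comp_hasDerivWithinAt t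
          (((hs.deriv_u t (hsub ht)).mono hsub).sub_const (u r))
      exact ((hs.deriv_v t (hsub ht)).mono hsub).inner ℝ hd)
    (fun r => by
      refine ((hcv.mono hsub).inner (hcv.mono hsub)).add ((hs.cont_z.mono hsub).inner ?_)
      exact ι.continuous.comp_continuousOn ((hs.cont.mono hsub).sub continuousOn_const))
    (fun r _ => by simp)
    (hmv.inner hmu)
    ((hmv.inner hmv).add (hmz.inner hmu))
    (fun r t ht => by
      have h1 := hb (v t) r t ht (hR t ht).2.2.1
      have h2 : 0 ≤ R ^ 2 * (1 + ‖u r‖ ^ 2) := by positivity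
      rw [hC, add_mul]
      linarith)
    (fun r t ht => by
      have h1 := hb (z t) r t ht (hR t ht).2.2.2
      have h2 : |⟪v t, v t⟫_ℝ| ≤ R ^ 2 := by
        rw [real_inner_self_eq_norm_sq, abs_of_nonneg (by positivity)]
        exact pow_le_pow_left₀ (norm_nonneg _) (hR t ht).2.2.1 2
      have h3 : 0 ≤ R ^ 2 * ‖u r‖ ^ 2 := by positivity
      have h4 := abs_add_le ⟪v t, v t⟫_ℝ ⟪z t, ι (u t - u r)⟫_ℝ
      rw [hC, add_mul]
      linarith)
    (hs.integrable_inner ι (v T) h hK hT) (hs.integrable_inner ι (v S) h hK hS)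
  have e1 : ∀ t ∈ Ioc S T,
      ∫ r, causal μ (t - r) * (⟪v t, v t⟫_ℝ + ⟪z t, ι (u t - u r)⟫_ℝ) =
      ⟪z t, ι (memoryMean μ u t)⟫_ℝ + m * ‖v t‖ ^ 2 := by
    intro t ht
    simp_rw [mul_add]
    rw [integral_add ((h.integrable_causal t).mul_const _)
      (hs.integrable_inner ι (z t) h hK (hsub' ht)), integral_mul_const, h.integral_causal,
      hs.inner_memoryMean ι (z t) h hK (hsub' ht), real_inner_self_eq_norm_sq]
    ring
  refine ⟨?_, h2.prod_right_ae, ?_⟩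
  · rw [intervalIntegrable_iff_integrableOn_Ioc_of_le hST]
    refine (h1.integral_prod_left.sub h2.integral_prod_left).congr ?_
    filter_upwards [ae_restrict_mem measurableSet_Ioc] with t ht
    simp only [Pi.sub_apply]
    rw [← e1 t ht]
  · rw [← hs.inner_memoryMean ι (v T) h hK hT, ← hs.inner_memoryMean ι (v S) h hK hS, h3]
    refine intervalIntegral.integral_congr_ae (Eventually.of_forall fun t ht => ?_)
    rw [uIoc_of_le hST] at ht
    rw [e1 t ht]

end RegularSolution

end Regular

/-! ### The energy inequality and the multiplier estimates -/

section Estimates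

variable {V H W : Type*} [NormedAddCommGroup V] [NormedSpace ℝ V]
  [NormedAddCommGroup H]
  [NormedAddCommGroup W] [InnerProductSpace ℝ W]
  {μ ν : ℝ → ℝ} {α m : ℝ} {G : V →L[ℝ] W} {u w : ℝ → V} {v z : ℝ → H} {τ a k : ℝ}

/-- The delay functional `∫_{t-τ}^t e^{-(t-s)} ‖v s‖² ds`. -/
noncomputable def delayEnergy (τ : ℝ) (v : ℝ → H) (t : ℝ) : ℝ :=
  ∫ s in (t - τ)..t, Real.exp (-(t - s)) * ‖v s‖ ^ 2

/-- The energy `½‖v‖² + (1 - m)/2 ‖G u‖² + ½ ∫ μ(s) ‖Gη^t(s)‖² ds + a/2 ∫ e^{-(t-s)} ‖v s‖² ds`; in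
the application `a = θ|k|e^τ`. -/
noncomputable def totalEnergy (μ : ℝ → ℝ) (m : ℝ) (G : V →L[ℝ] W) (τ a : ℝ) (u : ℝ → V)
    (v : ℝ → H) (t : ℝ) : ℝ :=
  1 / 2 * ‖v t‖ ^ 2 + (1 - m) / 2 * ‖G (u t)‖ ^ 2 + 1 / 2 * memory μ G u t
    + a / 2 * delayEnergy τ v t

lemma delayEnergy_nonneg (hτ : 0 ≤ τ) (t : ℝ) : 0 ≤ delayEnergy τ v t :=
  intervalIntegral.integral_nonneg (by linarith) fun s _ => by positivity

lemma totalEnergy_bounds (h : DecayKernel μ ν α m) (hτ : 0 < τ) (ha : 0 ≤ a) (t : ℝ) :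
    1 / 2 * ‖v t‖ ^ 2 + (1 - m) / 2 * ‖G (u t)‖ ^ 2 ≤ totalEnergy μ m G τ a u v t ∧
    1 / 2 * ‖v t‖ ^ 2 + 1 / 2 * memory μ G u t ≤ totalEnergy μ m G τ a u v t ∧
    0 ≤ totalEnergy μ m G τ a u v t := by
  have h1 := Admissible.memory_nonneg (G := G) (u := u) h t
  have h2 := mul_nonneg (show 0 ≤ a / 2 by positivity) (delayEnergy_nonneg (v := v) hτ.le t)
  have h3 : 0 ≤ (1 - m) / 2 * ‖G (u t)‖ ^ 2 :=
    mul_nonneg (by linarith [h.mass_lt_one]) (by positivity)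
  have h4 : 0 ≤ ‖v t‖ ^ 2 := by positivity
  simp only [totalEnergy]
  exact ⟨by linarith, by linarith, by linarith⟩

lemma integral_eq_sub_of_hasDerivWithinAt_Ici {E : Type*} [NormedAddCommGroup E]
    [NormedSpace ℝ E] [CompleteSpace E] {f f' : ℝ → E}
    (hf : ∀ t, 0 ≤ t → HasDerivWithinAt f (f' t) (Ici 0) t) (hf' : ContinuousOn f' (Ici 0))
    {S T : ℝ} (hS : 0 ≤ S) (hST : S ≤ T) : ∫ t in S..T, f' t = f T - f S := by
  have hsub : Icc S T ⊆ Ici 0 := fun t ht => hS.trans ht.1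
  refine intervalIntegral.integral_eq_sub_of_hasDerivAt_of_le hST
    (fun t ht => ((hf t (hsub ht)).mono hsub).continuousWithinAt) (fun t ht => ?_)
    ((hf'.mono hsub).intervalIntegrable_of_Icc hST)
  exact (hf t (hS.trans ht.1.le)).hasDerivAt (Ici_mem_nhds (hS.trans_lt ht.1))

lemma hasDerivWithinAt_delayEnergy (hτ : 0 < τ) (hv : ContinuousOn v (Ici (-τ))) {t : ℝ}
    (ht : 0 ≤ t) :
    HasDerivWithinAt (delayEnergy τ v)
      (‖v t‖ ^ 2 - Real.exp (-τ) * ‖v (t - τ)‖ ^ 2 - delayEnergy τ v t) (Ici 0) t := by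
  set f : ℝ → ℝ := fun s => Real.exp s * ‖v (max s (-τ))‖ ^ 2 with hf
  have hfc : Continuous f := by
    refine Real.continuous_exp.mul (Continuous.pow (Continuous.norm ?_) 2)
    exact hv.comp_continuous (by fun_prop) fun s => mem_Ici.2 (le_max_right _ _)
  have hev : ∀ s, -τ ≤ s → f s = Real.exp s * ‖v s‖ ^ 2 := fun s hs => by
    simp [hf, max_eq_left hs]
  have hΦ : ∀ x, HasDerivAt (fun x => ∫ s in (-τ)..x, f s) (f x) x := fun x =>
    intervalIntegral.integral_hasDerivAt_right (hfc.intervalIntegrable _ _)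
      (hfc.stronglyMeasurableAtFilter _ _) hfc.continuousAt
  have heq : ∀ x, 0 ≤ x → delayEnergy τ v x =
      Real.exp (-x) * ((∫ s in (-τ)..x, f s) - ∫ s in (-τ)..(x - τ), f s) := by
    intro x hx
    rw [intervalIntegral.integral_interval_sub_left (hfc.intervalIntegrable _ _)
      (hfc.intervalIntegrable _ _), ← intervalIntegral.integral_const_mul, delayEnergy]
    refine intervalIntegral.integral_congr fun s hs => ?_
    rw [uIcc_of_le (by linarith)] at hs
    rw [hev s (by linarith [hs.1]), ← mul_assoc, ← Real.exp_add]
    congr 2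
    ring
  have hd : HasDerivAt (fun x => Real.exp (-x) *
      ((∫ s in (-τ)..x, f s) - ∫ s in (-τ)..(x - τ), f s))
      (Real.exp (-t) * (-1) * ((∫ s in (-τ)..t, f s) - ∫ s in (-τ)..(t - τ), f s)
        + Real.exp (-t) * (f t - f (t - τ))) t :=
    ((hasDerivAt_neg t).exp).mul ((hΦ t).sub ((hΦ (t - τ)).comp_sub_const t τ))
  refine (hd.hasDerivWithinAt.congr (fun x hx => heq x hx) (heq t ht)).congr_deriv ?_
  rw [heq t ht, hev t (by linarith), hev (t - τ) (by linarith)]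
  have e1 : Real.exp (-t) * Real.exp t = 1 := by rw [← Real.exp_add]; simp
  have e2 : Real.exp (-t) * Real.exp (t - τ) = Real.exp (-τ) := by
    rw [← Real.exp_add]; congr 1; ring
  linear_combination ‖v t‖ ^ 2 * e1 - ‖v (t - τ)‖ ^ 2 * e2

variable [InnerProductSpace ℝ H] {ι : V →L[ℝ] H}

lemma abs_mul_inner_le {c B : ℝ} {x y : H} (hy : ‖y‖ ^ 2 ≤ B) :
    |c * ⟪x, y⟫_ℝ| ≤ |c| / 2 * (‖x‖ ^ 2 + B) := by
  rw [abs_mul]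
  have h1 : |⟪x, y⟫_ℝ| ≤ 1 / 2 * (‖x‖ ^ 2 + B) := by
    have := abs_real_inner_le_norm x y
    nlinarith [sq_nonneg (‖x‖ - ‖y‖)]
  have := mul_le_mul_of_nonneg_left h1 (abs_nonneg c)
  linarith

/-- Exponential decay of the kernel, `ν ≥ αμ`, bounds the memory by the dissipation. -/
lemma memory_le_dissipation (hs : Admissible μ G u) (h : DecayKernel μ ν α m)
    {K : ℝ} (hK : ∀ x, ‖x‖ ≤ K * ‖G x‖) {t : ℝ} (ht : 0 ≤ t)
    (hi : Integrable fun r => causal ν (t - r) * (1 / 2 * ‖G (u t - u r)‖ ^ 2)) :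
    memory μ G u t ≤ 2 / α * dissipation ν G u t := by
  have hα := h.rate_pos
  rw [memory, dissipation, ← integral_const_mul]
  refine integral_mono_ae (hs.integrable_memory h hK ht) (hi.const_mul _) ?_
  filter_upwards [(Measure.measurePreserving_sub_left volume t).quasiMeasurePreserving.ae h.le_rate]
    with r hr
  have hle : causal μ (t - r) ≤ 1 / α * causal ν (t - r) := by
    rcases le_or_gt (t - r) 0 with h0 | h0
    · rw [causal_of_nonpos h0, causal_of_nonpos h0, mul_zero]
    · rw [causal_of_pos h0, causal_of_pos h0, one_div, ← div_eq_inv_mul, le_div_iff₀ hα]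
      linarith [hr h0]
  have e : 2 / α * (causal ν (t - r) * (1 / 2 * ‖G (u t - u r)‖ ^ 2)) =
      1 / α * causal ν (t - r) * ‖G (u t - u r)‖ ^ 2 := by ring
  rw [e]
  exact mul_le_mul_of_nonneg_right hle (by positivity)

/-- The commutator term of the second multiplier, in which the rate `ν` (of mass at most `μ 0`) acts
instead of the kernel. The weights in Young's inequality are chosen to cost `m/4 ‖y‖²`. -/
lemma rate_inner_le (h : DecayKernel μ ν α m) {P : ℝ}
    (hP : ∀ x, ‖ι x‖ ^ 2 ≤ P * ‖G x‖ ^ 2) (y : H) {t : ℝ}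
    (hi : Integrable fun r => causal ν (t - r) * ⟪y, ι (u t - u r)⟫_ℝ)
    (hd : Integrable fun r => causal ν (t - r) * (1 / 2 * ‖G (u t - u r)‖ ^ 2)) :
    ∫ r, causal ν (t - r) * ⟪y, ι (u t - u r)⟫_ℝ ≤
      m / 4 * ‖y‖ ^ 2 + 2 * μ 0 * P / m * dissipation ν G u t := by
  have hm := h.mass_pos
  have hμ0 := h.pos_zero
  have hint : Integrable fun r => causal ν (t - r) :=
    ((integrable_indicator_iff measurableSet_Ioi).2 h.integrableOn_rate).comp_sub_left t
  have hmass : ∫ r, causal ν (t - r) ≤ μ 0 := by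
    rw [integral_sub_left_eq_self (causal ν) volume t, causal, integral_indicator measurableSet_Ioi]
    exact h.integral_Ioi_rate_le
  have h1 : ∫ r, causal ν (t - r) * ⟪y, ι (u t - u r)⟫_ℝ ≤
      ∫ r, (causal ν (t - r) * (m / (4 * μ 0) * ‖y‖ ^ 2) +
        2 * μ 0 * P / m * (causal ν (t - r) * (1 / 2 * ‖G (u t - u r)‖ ^ 2))) := by
    refine integral_mono hi ((hint.mul_const _).add (hd.const_mul _)) fun r => ?_
    have h2 : ⟪y, ι (u t - u r)⟫_ℝ ≤ m / (4 * μ 0) * ‖y‖ ^ 2 +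
        2 * μ 0 * P / m * (1 / 2 * ‖G (u t - u r)‖ ^ 2) := by
      have h3 := real_inner_le_norm y (ι (u t - u r))
      have h4 : μ 0 / m * ‖ι (u t - u r)‖ ^ 2 ≤
          2 * μ 0 * P / m * (1 / 2 * ‖G (u t - u r)‖ ^ 2) := by
        have := mul_le_mul_of_nonneg_left (hP (u t - u r)) (show 0 ≤ μ 0 / m by positivity)
        refine this.trans (le_of_eq ?_)
        ring
      have h5 : m / (4 * μ 0) * ‖y‖ ^ 2 + μ 0 / m * ‖ι (u t - u r)‖ ^ 2
          - ‖y‖ * ‖ι (u t - u r)‖ = (m * ‖y‖ - 2 * μ 0 * ‖ι (u t - u r)‖) ^ 2 / (4 * μ 0 * m) := by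
        field_simp
        ring
      have h6 : 0 ≤ (m * ‖y‖ - 2 * μ 0 * ‖ι (u t - u r)‖) ^ 2 / (4 * μ 0 * m) := by positivity
      linarith
    have h7 := mul_le_mul_of_nonneg_left h2 (causal_nonneg h.rate_nonneg (t - r))
    refine h7.trans (le_of_eq ?_)
    ring
  rw [integral_add (hint.mul_const _) (hd.const_mul _), integral_mul_const,
    integral_const_mul] at h1
  have h8 : (∫ r, causal ν (t - r)) * (m / (4 * μ 0) * ‖y‖ ^ 2) ≤ m / 4 * ‖y‖ ^ 2 := by
    refine (mul_le_mul_of_nonneg_right hmass (by positivity)).trans (le_of_eq ?_)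
    field_simp
  rw [dissipation]
  linarith

namespace RegularSolution

lemma continuousOn_v (hs : RegularSolution μ ι G τ a k u w v z) (hτ : 0 < τ) :
    ContinuousOn v (Ici 0) := hs.cont_v.mono (Ici_subset_Ici.2 (by linarith))

lemma continuousOn_delay (hs : RegularSolution μ ι G τ a k u w v z) :
    ContinuousOn (fun t => v (t - τ)) (Ici 0) :=
  hs.cont_v.comp (by fun_prop) fun t ht => by
    have : (0 : ℝ) ≤ t := ht
    exact mem_Ici.2 (by linarith)

variable [CompleteSpace V] [CompleteSpace W]

/-- The energy inequality, obtained by testing with `w = u_t`. The delayed force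
`k ⟪v (t - τ), v t⟫` is at most `|k|/2 (‖v (t - τ)‖² + ‖v t‖²)`; the first half is absorbed by the
term `-e^{-τ}‖v (t - τ)‖²` in the derivative of the delay functional, which enters with weight
`a e^{-τ}/2 = θ|k|/2`, and the second half by the half of the damping `a ≥ |k|` which is not
consumed by the term `+‖v t‖²` of that derivative. -/
lemma energy_dissipation (hs : RegularSolution μ ι G τ a k u w v z) (h : DecayKernel μ ν α m)
    {K : ℝ} (hK : ∀ x, ‖x‖ ≤ K * ‖G x‖) (hτ : 0 < τ) {θ : ℝ} (hθ : 1 < θ)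
    (ha : a = θ * |k| * Real.exp τ) {S T : ℝ} (hS : 0 ≤ S) (hST : S ≤ T) :
    (∫ t in S..T, dissipation ν G u t) + |k| * (θ - 1) / 2 * (∫ t in S..T, ‖v (t - τ)‖ ^ 2)
      + (∫ t in S..T, a / 2 * delayEnergy τ v t)
      ≤ totalEnergy μ m G τ a u v S - totalEnergy μ m G τ a u v T := by
  have hsub : uIcc S T ⊆ Ici 0 := by
    rw [uIcc_of_le hST]
    exact fun t ht => hS.trans ht.1
  obtain ⟨hD, -, hψ, hid⟩ := hs.memory_identity h hK hτ hS hST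
  have hcv := hs.continuousOn_v hτ
  have hcd : ContinuousOn (delayEnergy τ v) (Ici 0) := fun t ht =>
    (hasDerivWithinAt_delayEnergy hτ hs.cont_v ht).continuousWithinAt
  have hcGu : ContinuousOn (fun t => G (u t)) (Ici 0) := G.continuous.comp_continuousOn hs.cont
  have hcGw : ContinuousOn (fun t => G (w t)) (Ici 0) := G.continuous.comp_continuousOn hs.cont_w
  have hc1 : ContinuousOn (fun t => ⟪v t, z t⟫_ℝ + (1 - m) * ⟪G (u t), G (w t)⟫_ℝ
      + a / 2 * (‖v t‖ ^ 2 - Real.exp (-τ) * ‖v (t - τ)‖ ^ 2 - delayEnergy τ v t)) (Ici 0) := by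
    refine ((hcv.inner hs.cont_z).add (continuousOn_const.mul (hcGu.inner hcGw))).add
      (continuousOn_const.mul ?_)
    exact ((hcv.norm.pow 2).sub (continuousOn_const.mul (hs.continuousOn_delay.norm.pow 2))).sub hcd
  have hft := integral_eq_sub_of_hasDerivWithinAt_Ici
    (f := fun t => 1 / 2 * ‖v t‖ ^ 2 + (1 - m) / 2 * ‖G (u t)‖ ^ 2 + a / 2 * delayEnergy τ v t)
    (fun t ht => by
      have d1 := ((hs.deriv_v t ht).norm_sq).const_mul (1 / 2)
      have d2 : HasDerivWithinAt (fun t => G (u t)) (G (w t)) (Ici 0) t :=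
        G.hasFDerivAt.comp_hasDerivWithinAt t (hs.deriv_u t ht)
      have d3 := d2.norm_sq.const_mul ((1 - m) / 2)
      have d4 := (hasDerivWithinAt_delayEnergy hτ hs.cont_v ht).const_mul (a / 2)
      refine ((d1.add d3).add d4).congr_deriv ?_
      ring) hc1 hS hST
  have hq : IntervalIntegrable (fun t => ‖v (t - τ)‖ ^ 2) volume S T :=
    ((hs.continuousOn_delay.norm.pow 2).mono hsub).intervalIntegrable
  have hL : IntervalIntegrable (fun t => a / 2 * delayEnergy τ v t) volume S T :=
    ((continuousOn_const.mul hcd).mono hsub).intervalIntegrable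
  have hF : totalEnergy μ m G τ a u v T - totalEnergy μ m G τ a u v S =
      ∫ t in S..T, ((⟪v t, z t⟫_ℝ + (1 - m) * ⟪G (u t), G (w t)⟫_ℝ
      + a / 2 * (‖v t‖ ^ 2 - Real.exp (-τ) * ‖v (t - τ)‖ ^ 2 - delayEnergy τ v t))
      + (⟪G (w t), G (memoryMean μ u t)⟫_ℝ - dissipation ν G u t)) := by
    rw [intervalIntegral.integral_add (hc1.mono hsub).intervalIntegrable (hψ.sub hD), hft, ← hid]
    simp only [totalEnergy]
    ring
  have hle : totalEnergy μ m G τ a u v T - totalEnergy μ m G τ a u v S ≤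
      ∫ t in S..T, -(dissipation ν G u t + |k| * (θ - 1) / 2 * ‖v (t - τ)‖ ^ 2
        + a / 2 * delayEnergy τ v t) := by
    rw [hF]
    refine intervalIntegral.integral_mono_on hST ((hc1.mono hsub).intervalIntegrable.add
      (hψ.sub hD)) ((hD.add (hq.const_mul _)).add hL).neg fun t ht => ?_
    have ht0 : 0 ≤ t := hS.trans ht.1
    have hw := hs.weak_form h hK (w t) ht0
    rw [hs.val_w t ht0, real_inner_self_eq_norm_sq] at hw
    have hi := abs_mul_inner_le (c := k) (x := v (t - τ)) (y := v t) le_rfl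
    have hi' := neg_abs_le (k * ⟪v (t - τ), v t⟫_ℝ)
    have hae : a * Real.exp (-τ) = θ * |k| := by
      rw [ha, mul_assoc, ← Real.exp_add]
      simp
    have hak : |k| ≤ a := by
      have h1 : 1 ≤ Real.exp τ := Real.one_le_exp hτ.le
      have h2 : 1 ≤ θ * Real.exp τ := by nlinarith
      rw [ha]
      nlinarith [abs_nonneg k]
    have hy : |k| / 2 * ‖v t‖ ^ 2 ≤ a / 2 * ‖v t‖ ^ 2 :=
      mul_le_mul_of_nonneg_right (by linarith) (by positivity)
    rw [real_inner_comm] at hw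
    have e3 : a / 2 * (Real.exp (-τ) * ‖v (t - τ)‖ ^ 2) = θ * |k| / 2 * ‖v (t - τ)‖ ^ 2 := by
      rw [← hae]; ring
    have e4 : a / 2 * (‖v t‖ ^ 2 - Real.exp (-τ) * ‖v (t - τ)‖ ^ 2 - delayEnergy τ v t) =
      a / 2 * ‖v t‖ ^ 2 - θ * |k| / 2 * ‖v (t - τ)‖ ^ 2 - a / 2 * delayEnergy τ v t := by
      rw [← e3]; ring
    rw [e4]
    linarith
  rw [intervalIntegral.integral_neg, intervalIntegral.integral_add (hD.add (hq.const_mul _)) hL,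
    intervalIntegral.integral_add hD (hq.const_mul _), intervalIntegral.integral_const_mul] at hle
  linarith

/-- The estimate obtained by testing with `u`. The condition `hk` lets half of `(1 - m)‖G u‖²`
absorb the displacement parts of the damping, the delayed force and the memory. -/
lemma displacement_multiplier [CompleteSpace H] (hs : RegularSolution μ ι G τ a k u w v z)
    (h : DecayKernel μ ν α m)
    {K P : ℝ} (hK : ∀ x, ‖x‖ ≤ K * ‖G x‖) (hP0 : 0 < P) (hP : ∀ x, ‖ι x‖ ^ 2 ≤ P * ‖G x‖ ^ 2)
    (hτ : 0 < τ) {θ : ℝ} (hθ : 1 < θ) (ha : a = θ * |k| * Real.exp τ)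
    (hk : P * (a + |k|) ≤ (1 - m) / 2) {S T : ℝ} (hS : 0 ≤ S) (hST : S ≤ T) :
    (1 - m) / 2 * (∫ t in S..T, ‖G (u t)‖ ^ 2) ≤
      (2 + a) / 2 * (∫ t in S..T, ‖v t‖ ^ 2)
      + 2 * m / (α * (1 - m)) * (∫ t in S..T, dissipation ν G u t)
      + |k| / 2 * (∫ t in S..T, ‖v (t - τ)‖ ^ 2)
      + (1 + P / (1 - m)) * (totalEnergy μ m G τ a u v S + totalEnergy μ m G τ a u v T) := by
  have hm1 : 0 < 1 - m := by linarith [h.mass_lt_one]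
  have hm := h.mass_pos
  have hα := h.rate_pos
  have ha0 : 0 ≤ a := by rw [ha]; positivity
  have hsub : uIcc S T ⊆ Ici 0 := by
    rw [uIcc_of_le hST]
    exact fun t ht => hS.trans ht.1
  obtain ⟨hD, hDi, -, -⟩ := hs.memory_identity h hK hτ hS hST
  have hcv := hs.continuousOn_v hτ
  have hcιu : ContinuousOn (fun t => ι (u t)) (Ici 0) := ι.continuous.comp_continuousOn hs.cont
  have hcGu : ContinuousOn (fun t => G (u t)) (Ici 0) := G.continuous.comp_continuousOn hs.cont
  have hc1 : ContinuousOn (fun t => ⟪v t, v t⟫_ℝ + ⟪z t, ι (u t)⟫_ℝ) (Ici 0) :=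
    (hcv.inner hcv).add (hs.cont_z.inner hcιu)
  have hft := integral_eq_sub_of_hasDerivWithinAt_Ici (f := fun t => ⟪v t, ι (u t)⟫_ℝ)
    (fun t ht => by
      have d2 : HasDerivWithinAt (fun t => ι (u t)) (v t) (Ici 0) t := by
        rw [← hs.val_w t ht]
        exact ι.hasFDerivAt.comp_hasDerivWithinAt t (hs.deriv_u t ht)
      exact (hs.deriv_v t ht).inner ℝ d2) hc1 hS hST
  have hy : IntervalIntegrable (fun t => ‖v t‖ ^ 2) volume S T :=
    ((hcv.norm.pow 2).mono hsub).intervalIntegrable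
  have hx : IntervalIntegrable (fun t => ‖G (u t)‖ ^ 2) volume S T :=
    ((hcGu.norm.pow 2).mono hsub).intervalIntegrable
  have hq : IntervalIntegrable (fun t => ‖v (t - τ)‖ ^ 2) volume S T :=
    ((hs.continuousOn_delay.norm.pow 2).mono hsub).intervalIntegrable
  have hle : ∫ t in S..T, (⟪v t, v t⟫_ℝ + ⟪z t, ι (u t)⟫_ℝ) ≤
      ∫ t in S..T, ((2 + a) / 2 * ‖v t‖ ^ 2 + 2 * m / (α * (1 - m)) * dissipation ν G u t
        + |k| / 2 * ‖v (t - τ)‖ ^ 2 - (1 - m) / 2 * ‖G (u t)‖ ^ 2) := by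
    refine intervalIntegral.integral_mono_ae_restrict hST (hc1.mono hsub).intervalIntegrable
      ((((hy.const_mul _).add (hD.const_mul _)).add (hq.const_mul _)).sub (hx.const_mul _)) ?_
    rw [← restrict_Ioc_eq_restrict_Icc]
    filter_upwards [hDi, ae_restrict_mem measurableSet_Ioc] with t hti ht
    have ht0 : 0 ≤ t := hS.trans ht.1.le
    have hw := hs.weak_form h hK (u t) ht0
    have hN := memory_le_dissipation hs.toAdmissible h hK ht0 hti
    -- With this weight Young's inequality costs `(1 - m)/4 ‖G u‖²`.
    have hψ := hs.inner_memoryMean_le (G (u t)) h hK ht0 (c := (1 - m) / (4 * m)) (by positivity)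
    have e1 : (1 - m) / (4 * m) * m = (1 - m) / 4 := by field_simp
    have e2 : 1 / (4 * ((1 - m) / (4 * m))) = m / (1 - m) := by field_simp
    rw [e1, e2] at hψ
    have e3 : 2 * m / (α * (1 - m)) * dissipation ν G u t =
        m / (1 - m) * (2 / α * dissipation ν G u t) := by field_simp
    have hN' := mul_le_mul_of_nonneg_left hN (show 0 ≤ m / (1 - m) by positivity)
    rw [← e3] at hN'
    have j1 := abs_mul_inner_le (c := a) (x := v t) (hP (u t))
    have j2 := abs_mul_inner_le (c := k) (x := v (t - τ)) (hP (u t))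
    rw [abs_of_nonneg ha0] at j1
    have j3 := mul_le_mul_of_nonneg_right hk (show 0 ≤ ‖G (u t)‖ ^ 2 by positivity)
    have k1 := neg_abs_le (a * ⟪v t, ι (u t)⟫_ℝ)
    have k2 := neg_abs_le (k * ⟪v (t - τ), ι (u t)⟫_ℝ)
    have k3 := neg_abs_le ⟪G (u t), G (memoryMean μ u t)⟫_ℝ
    rw [real_inner_self_eq_norm_sq] at hw
    rw [real_inner_self_eq_norm_sq]
    linarith
  rw [hft, intervalIntegral.integral_sub (((hy.const_mul _).add (hD.const_mul _)).add
    (hq.const_mul _)) (hx.const_mul _), intervalIntegral.integral_add ((hy.const_mul _).add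
    (hD.const_mul _)) (hq.const_mul _), intervalIntegral.integral_add (hy.const_mul _)
    (hD.const_mul _)] at hle
  simp only [intervalIntegral.integral_const_mul] at hle
  have hbd : ∀ t, |⟪v t, ι (u t)⟫_ℝ| ≤ (1 + P / (1 - m)) * totalEnergy μ m G τ a u v t := by
    intro t
    obtain ⟨b1, -, -⟩ := totalEnergy_bounds (G := G) (u := u) (v := v) h hτ ha0 t
    have i1 := abs_mul_inner_le (c := 1) (x := v t) (hP (u t))
    rw [one_mul, abs_one] at i1
    have i4 : P / (1 - m) * ((1 - m) / 2 * ‖G (u t)‖ ^ 2) = 1 / 2 * (P * ‖G (u t)‖ ^ 2) := by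
      field_simp
    have i5 : 0 ≤ P / (1 - m) := by positivity
    have i6 : 0 ≤ (1 - m) / 2 * ‖G (u t)‖ ^ 2 := by positivity
    have i7 := mul_le_mul_of_nonneg_left (show (1 - m) / 2 * ‖G (u t)‖ ^ 2 ≤
      totalEnergy μ m G τ a u v t by linarith [sq_nonneg ‖v t‖]) i5
    linarith
  have b1 := hbd S
  have b2 := hbd T
  have b3 := abs_le.1 b1
  have b4 := abs_le.1 b2
  linarith [b3.2, b4.1]

/-- The estimate obtained by testing with the mean history. The coefficient of
`(1 - m) ∫‖G u‖²` is so small that, after multiplication by `2(3 + a)/m`, it can be absorbed with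
the help of `displacement_multiplier`, whose coefficient of `∫‖v‖²` is `(2 + a)/2`. -/
lemma memory_multiplier [CompleteSpace H] (hs : RegularSolution μ ι G τ a k u w v z)
    (h : DecayKernel μ ν α m) {K P : ℝ} (hK : ∀ x, ‖x‖ ≤ K * ‖G x‖) (hP0 : 0 < P)
    (hP : ∀ x, ‖ι x‖ ^ 2 ≤ P * ‖G x‖ ^ 2) (hτ : 0 < τ) {θ : ℝ} (hθ : 1 < θ)
    (ha : a = θ * |k| * Real.exp τ) (hk : a ≤ m / 2) {S T : ℝ} (hS : 0 ≤ S) (hST : S ≤ T) :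
    m / 2 * (∫ t in S..T, ‖v t‖ ^ 2) ≤
      m / (4 * (3 + a)) * ((1 - m) * ∫ t in S..T, ‖G (u t)‖ ^ 2)
      + (((1 - m) * (3 + a) + m + (a + |k|) / 2 * (P * m)) * (2 / α) + 2 * μ 0 * P / m)
        * (∫ t in S..T, dissipation ν G u t)
      + |k| / 2 * (∫ t in S..T, ‖v (t - τ)‖ ^ 2)
      + (1 + P * m) * (totalEnergy μ m G τ a u v S + totalEnergy μ m G τ a u v T) := by
  have hm1 : 0 < 1 - m := by linarith [h.mass_lt_one]
  have hm := h.mass_pos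
  have hα := h.rate_pos
  have ha0 : 0 ≤ a := by rw [ha]; positivity
  have hsub : uIcc S T ⊆ Ici 0 := by
    rw [uIcc_of_le hST]
    exact fun t ht => hS.trans ht.1
  obtain ⟨hD, hDi, -, -⟩ := hs.memory_identity h hK hτ hS hST
  obtain ⟨hI, hIi, hft⟩ := hs.memoryMean_identity h hK hτ hS hST
  have hcv := hs.continuousOn_v hτ
  have hcGu : ContinuousOn (fun t => G (u t)) (Ici 0) := G.continuous.comp_continuousOn hs.cont
  have hy : IntervalIntegrable (fun t => ‖v t‖ ^ 2) volume S T :=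
    ((hcv.norm.pow 2).mono hsub).intervalIntegrable
  have hx : IntervalIntegrable (fun t => ‖G (u t)‖ ^ 2) volume S T :=
    ((hcGu.norm.pow 2).mono hsub).intervalIntegrable
  have hq : IntervalIntegrable (fun t => ‖v (t - τ)‖ ^ 2) volume S T :=
    ((hs.continuousOn_delay.norm.pow 2).mono hsub).intervalIntegrable
  have hψP : ∀ t, 0 ≤ t → ‖ι (memoryMean μ u t)‖ ^ 2 ≤ P * m * memory μ G u t := by
    intro t ht
    have h1 := mul_le_mul_of_nonneg_left (hs.norm_memoryMean_sq_le h hK ht) hP0.le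
    linarith [hP (memoryMean μ u t)]
  set c := ((1 - m) * (3 + a) + m + (a + |k|) / 2 * (P * m)) with hc
  have hc0 : 0 ≤ c := by positivity
  have hle : ∫ t in S..T, (m / 2 * ‖v t‖ ^ 2 - m / (4 * (3 + a)) * (1 - m) * ‖G (u t)‖ ^ 2
        - (c * (2 / α) + 2 * μ 0 * P / m) * dissipation ν G u t - |k| / 2 * ‖v (t - τ)‖ ^ 2) ≤
      ∫ t in S..T, (⟪z t, ι (memoryMean μ u t)⟫_ℝ + m * ‖v t‖ ^ 2
      - ∫ r, causal ν (t - r) * ⟪v t, ι (u t - u r)⟫_ℝ) := by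
    refine intervalIntegral.integral_mono_ae_restrict hST
      ((((hy.const_mul _).sub (hx.const_mul _)).sub (hD.const_mul _)).sub (hq.const_mul _)) hI ?_
    rw [← restrict_Ioc_eq_restrict_Icc]
    filter_upwards [hDi, hIi, ae_restrict_mem measurableSet_Ioc] with t hti htj ht
    have ht0 : 0 ≤ t := hS.trans ht.1.le
    have hw := hs.weak_form h hK (memoryMean μ u t) ht0
    have hN := mul_le_mul_of_nonneg_left (memory_le_dissipation hs.toAdmissible h hK ht0 hti) hc0
    have hψ := hs.inner_memoryMean_le (G (u t)) h hK ht0 (c := 1 / (4 * (3 + a))) (by positivity)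
    have e1 : 1 / (4 * (1 / (4 * (3 + a)))) = 3 + a := by field_simp
    rw [e1] at hψ
    have hψ' := mul_le_mul_of_nonneg_left ((le_abs_self _).trans hψ) hm1.le
    have hψψ := hs.norm_memoryMean_sq_le h hK ht0
    have hr := rate_inner_le h hP (v t) htj hti
    have j1 := abs_mul_inner_le (c := a) (x := v t) (hψP t ht0)
    have j2 := abs_mul_inner_le (c := k) (x := v (t - τ)) (hψP t ht0)
    rw [abs_of_nonneg ha0] at j1
    have j3 := mul_le_mul_of_nonneg_right hk (show 0 ≤ ‖v t‖ ^ 2 by positivity)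
    have k1 := le_abs_self (a * ⟪v t, ι (memoryMean μ u t)⟫_ℝ)
    have k2 := le_abs_self (k * ⟪v (t - τ), ι (memoryMean μ u t)⟫_ℝ)
    rw [real_inner_self_eq_norm_sq] at hw
    have e2 : (1 - m) * (1 / (4 * (3 + a)) * m * ‖G (u t)‖ ^ 2 + (3 + a) * memory μ G u t) =
      m / (4 * (3 + a)) * (1 - m) * ‖G (u t)‖ ^ 2 + (1 - m) * (3 + a) * memory μ G u t := by ring
    rw [e2] at hψ'
    have e3 : c * memory μ G u t = (1 - m) * (3 + a) * memory μ G u t + m * memory μ G u t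
      + a / 2 * (P * m * memory μ G u t) + |k| / 2 * (P * m * memory μ G u t) := by
      rw [hc]; ring
    rw [e3] at hN
    have e4 : (c * (2 / α) + 2 * μ 0 * P / m) * dissipation ν G u t =
      c * (2 / α * dissipation ν G u t) + 2 * μ 0 * P / m * dissipation ν G u t := by ring
    rw [e4]
    rw [mul_add] at j1 j2
    linarith
  rw [← hft, intervalIntegral.integral_sub (((hy.const_mul _).sub (hx.const_mul _)).sub
    (hD.const_mul _)) (hq.const_mul _), intervalIntegral.integral_sub ((hy.const_mul _).sub
    (hx.const_mul _)) (hD.const_mul _), intervalIntegral.integral_sub (hy.const_mul _)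
    (hx.const_mul _)] at hle
  simp only [intervalIntegral.integral_const_mul] at hle
  have hbd : ∀ t, 0 ≤ t → |⟪v t, ι (memoryMean μ u t)⟫_ℝ| ≤
      (1 + P * m) * totalEnergy μ m G τ a u v t := by
    intro t ht
    obtain ⟨-, b1, -⟩ := totalEnergy_bounds (G := G) (u := u) (v := v) h hτ ha0 t
    have i1 := abs_mul_inner_le (c := 1) (x := v t) (hψP t ht)
    rw [one_mul, abs_one] at i1
    have i5 : 0 ≤ P * m := by positivity
    have i6 := Admissible.memory_nonneg (G := G) (u := u) h t
    have i7 := mul_le_mul_of_nonneg_left (show 1 / 2 * memory μ G u t ≤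
      totalEnergy μ m G τ a u v t by linarith [sq_nonneg ‖v t‖]) i5
    linarith
  have b3 := abs_le.1 (hbd S hS)
  have b4 := abs_le.1 (hbd T (hS.trans hST))
  rw [mul_assoc] at hle
  linarith [b3.1, b4.2]

/-- With `X = ∫‖G u‖²`, `Y = ∫‖v‖²` and `F = F(S)`, the multiplier estimates read
`(1 - m) X ≤ (2 + a) Y + C₁ F` and `Y ≤ (1 - m) X / (2 (3 + a)) + C₂ F`. Adding the first one to
`3 + a` times the second one gives `Y + (1 - m) X ≤ (1 - m) X / 2 + (C₁ + (3 + a) C₂) F`, hence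
`½ Y + (1 - m)/2 X ≤ (C₀ C₂ + C₁ + C₂) F`. The memory and delay parts of the energy cost `1/α` and
`1`. -/
lemma integral_totalEnergy_le [CompleteSpace H] (hs : RegularSolution μ ι G τ a k u w v z)
    (h : DecayKernel μ ν α m) {K P : ℝ} (hK : ∀ x, ‖x‖ ≤ K * ‖G x‖) (hP0 : 0 < P)
    (hP : ∀ x, ‖ι x‖ ^ 2 ≤ P * ‖G x‖ ^ 2) (hτ : 0 < τ) {θ : ℝ} (hθ : 1 < θ)
    (ha : a = θ * |k| * Real.exp τ) (hk1 : P * (a + |k|) ≤ (1 - m) / 2) (hk2 : a ≤ m / 2)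
    {S T : ℝ} (hS : 0 ≤ S) (hST : S ≤ T) :
    ∫ t in S..T, totalEnergy μ m G τ a u v t ≤
      constC (μ 0) m P α τ θ k * totalEnergy μ m G τ a u v S := by
  have hm1 : 0 < 1 - m := by linarith [h.mass_lt_one]
  have hm := h.mass_pos
  have hα := h.rate_pos
  have hμ0 := h.pos_zero
  have hθ1 : 0 < θ - 1 := by linarith
  have ha0 : 0 ≤ a := by rw [ha]; positivity
  have hsub : uIcc S T ⊆ Ici 0 := by
    rw [uIcc_of_le hST]
    exact fun t ht => hS.trans ht.1
  have hen := hs.energy_dissipation h hK hτ hθ ha hS hST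
  have h1 := hs.displacement_multiplier h hK hP0 hP hτ hθ ha hk1 hS hST
  have h2 := hs.memory_multiplier h hK hP0 hP hτ hθ ha hk2 hS hST
  obtain ⟨hD, hDi, -, -⟩ := hs.memory_identity h hK hτ hS hST
  have hcv := hs.continuousOn_v hτ
  have hcGu : ContinuousOn (fun t => G (u t)) (Ici 0) := G.continuous.comp_continuousOn hs.cont
  have hcd : ContinuousOn (delayEnergy τ v) (Ici 0) := fun t ht =>
    (hasDerivWithinAt_delayEnergy hτ hs.cont_v ht).continuousWithinAt
  have hy : IntervalIntegrable (fun t => ‖v t‖ ^ 2) volume S T :=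
    ((hcv.norm.pow 2).mono hsub).intervalIntegrable
  have hx : IntervalIntegrable (fun t => ‖G (u t)‖ ^ 2) volume S T :=
    ((hcGu.norm.pow 2).mono hsub).intervalIntegrable
  have hN : IntervalIntegrable (memory μ G u) volume S T :=
    ((hs.continuousOn_memory h hK).mono hsub).intervalIntegrable
  have hL : IntervalIntegrable (fun t => a / 2 * delayEnergy τ v t) volume S T :=
    ((continuousOn_const.mul hcd).mono hsub).intervalIntegrable
  have hF : ∫ t in S..T, totalEnergy μ m G τ a u v t =
      1 / 2 * (∫ t in S..T, ‖v t‖ ^ 2) + (1 - m) / 2 * (∫ t in S..T, ‖G (u t)‖ ^ 2)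
      + 1 / 2 * (∫ t in S..T, memory μ G u t) + ∫ t in S..T, a / 2 * delayEnergy τ v t := by
    simp only [totalEnergy]
    rw [intervalIntegral.integral_add (((hy.const_mul _).add (hx.const_mul _)).add
      (hN.const_mul _)) hL, intervalIntegral.integral_add ((hy.const_mul _).add (hx.const_mul _))
      (hN.const_mul _), intervalIntegral.integral_add (hy.const_mul _) (hx.const_mul _)]
    simp only [intervalIntegral.integral_const_mul]
  have hNle : ∫ t in S..T, memory μ G u t ≤ ∫ t in S..T, 2 / α * dissipation ν G u t := by
    refine intervalIntegral.integral_mono_ae_restrict hST hN (hD.const_mul _) ?_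
    rw [← restrict_Ioc_eq_restrict_Icc]
    filter_upwards [hDi, ae_restrict_mem measurableSet_Ioc] with t hti ht
    exact memory_le_dissipation hs.toAdmissible h hK (hS.trans ht.1.le) hti
  rw [intervalIntegral.integral_const_mul] at hNle
  have p1 : 0 ≤ ∫ t in S..T, dissipation ν G u t := intervalIntegral.integral_nonneg hST
    fun t _ => integral_nonneg fun r => mul_nonneg (causal_nonneg h.rate_nonneg _) (by positivity)
  have p2 : 0 ≤ ∫ t in S..T, ‖v (t - τ)‖ ^ 2 := intervalIntegral.integral_nonneg hST
    fun t _ => by positivity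
  have p3 : 0 ≤ ∫ t in S..T, a / 2 * delayEnergy τ v t := intervalIntegral.integral_nonneg hST
    fun t _ => mul_nonneg (by positivity) (delayEnergy_nonneg hτ.le t)
  have p4 : 0 ≤ ∫ t in S..T, ‖v t‖ ^ 2 := intervalIntegral.integral_nonneg hST
    fun t _ => by positivity
  have p5 : 0 ≤ ∫ t in S..T, ‖G (u t)‖ ^ 2 := intervalIntegral.integral_nonneg hST
    fun t _ => by positivity
  have p6 := (totalEnergy_bounds (G := G) (u := u) (v := v) h hτ ha0 T).2.2
  have p7 := (totalEnergy_bounds (G := G) (u := u) (v := v) h hτ ha0 S).2.2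
  rw [hF]
  generalize (∫ t in S..T, dissipation ν G u t) = D at *
  generalize (∫ t in S..T, ‖v (t - τ)‖ ^ 2) = Q at *
  generalize (∫ t in S..T, a / 2 * delayEnergy τ v t) = L at *
  generalize (∫ t in S..T, ‖v t‖ ^ 2) = Y at *
  generalize (∫ t in S..T, ‖G (u t)‖ ^ 2) = X at *
  generalize (∫ t in S..T, memory μ G u t) = N at *
  generalize totalEnergy μ m G τ a u v S = F at *
  generalize totalEnergy μ m G τ a u v T = F' at *
  have hQ0 : 0 ≤ |k| * (θ - 1) / 2 * Q := by positivity
  have hDF : D ≤ F := by linarith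
  have hLF : L ≤ F := by linarith
  have hF'F : F' ≤ F := by linarith
  have hQF : |k| / 2 * Q ≤ 1 / (θ - 1) * F := by
    rw [one_div, ← div_eq_inv_mul, le_div_iff₀ hθ1]
    linarith
  -- The dissipation, the delayed velocity and the boundary terms are all bounded by multiples of
  -- the initial energy `F`.
  have h1' : (1 - m) * X ≤ (2 + a) * Y + constC1 m P α θ * F := by
    have q1 := mul_le_mul_of_nonneg_left hDF (show 0 ≤ 2 * m / (α * (1 - m)) by positivity)
    have q2 := mul_le_mul_of_nonneg_left (show F + F' ≤ 2 * F by linarith)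
      (show 0 ≤ 1 + P / (1 - m) by positivity)
    have q3 : constC1 m P α θ * F = 2 * (2 * m / (α * (1 - m)) * F + 1 / (θ - 1) * F
        + (1 + P / (1 - m)) * (2 * F)) := by
      rw [constC1]
      field_simp
      ring
    rw [q3]
    linarith
  have h2' : Y ≤ (1 - m) * X / (2 * (3 + a)) + constC2 (μ 0) m P α τ θ k * F := by
    set c := ((1 - m) * (3 + a) + m + (a + |k|) / 2 * (P * m)) * (2 / α) + 2 * μ 0 * P / m with hc
    have hc0 : 0 ≤ c := by positivity
    have q1 := mul_le_mul_of_nonneg_left hDF hc0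
    have q2 := mul_le_mul_of_nonneg_left (show F + F' ≤ 2 * F by linarith)
      (show 0 ≤ 1 + P * m by positivity)
    have q3 : m / 2 * Y ≤ m / (4 * (3 + a)) * ((1 - m) * X) + (c * F + 1 / (θ - 1) * F
        + (1 + P * m) * (2 * F)) := by linarith
    have q4 : constC2 (μ 0) m P α τ θ k * F = 2 / m * (c * F + 1 / (θ - 1) * F
        + (1 + P * m) * (2 * F)) := by
      have e : P * |k| * (θ * Real.exp τ + 1) = P * (a + |k|) := by rw [ha]; ring
      have e' : 2 * θ * |k| * Real.exp τ = 2 * a := by rw [ha]; ring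
      rw [constC2, e, e', hc]
      field_simp
      ring
    have q5 := mul_le_mul_of_nonneg_left q3 (show 0 ≤ 2 / m by positivity)
    have e1 : 2 / m * (m / 2 * Y) = Y := by field_simp
    have e2 : 2 / m * (m / (4 * (3 + a)) * ((1 - m) * X) + (c * F + 1 / (θ - 1) * F
        + (1 + P * m) * (2 * F))) = (1 - m) * X / (2 * (3 + a)) + 2 / m * (c * F
        + 1 / (θ - 1) * F + (1 + P * m) * (2 * F)) := by field_simp; ring
    rw [e1, e2] at q5
    rw [q4]
    exact q5
  have h3 : (3 + a) * Y ≤ (1 - m) * X / 2 + (3 + a) * (constC2 (μ 0) m P α τ θ k * F) := by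
    have q := mul_le_mul_of_nonneg_left h2' (show 0 ≤ 3 + a by positivity)
    refine q.trans (le_of_eq ?_)
    field_simp
  have hND : 1 / 2 * N ≤ 1 / α * F := by
    have q := mul_le_mul_of_nonneg_left hDF (show 0 ≤ 1 / α by positivity)
    have e : 2 / α * D = 2 * (1 / α * D) := by ring
    linarith
  have e0 : constC0 τ θ k = 2 + a := by rw [constC0, ha]
  rw [constC, e0]
  linarith

end RegularSolution

end Estimates

/-! ### Forward averages -/

section Averages

lemma aestronglyMeasurable_comp_add_sub {X : Type*} [TopologicalSpace X] {f : ℝ → X}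
    (hf : AEStronglyMeasurable f) (t : ℝ) (A : Set ℝ) :
    AEStronglyMeasurable (fun p : ℝ × ℝ => f (t + p.1 - p.2))
      ((volume.restrict A).prod volume) := by
  have h1 : AEStronglyMeasurable (fun x => f (t + x)) :=
    hf.comp_quasiMeasurePreserving (measurePreserving_add_left volume t).quasiMeasurePreserving
  have h2 : Measure.QuasiMeasurePreserving (fun p : ℝ × ℝ => p.1 - p.2)
      ((volume.restrict A).prod volume) volume := by
    refine (quasiMeasurePreserving_sub_of_right_invariant volume volume).mono_left ?_
    exact Measure.absolutelyContinuous_of_le (Measure.prod_mono Measure.restrict_le_self le_rfl)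
  have := h1.comp_quasiMeasurePreserving h2
  simpa [Function.comp_def, add_sub_assoc] using this

variable {E : Type*} [NormedAddCommGroup E] [NormedSpace ℝ E]

/-- The forward (Steklov) average `δ⁻¹ ∫₀^δ f(t + r) dr`. It looks only into the future, so on
`[0, ∞)` it involves only the values of `f` there. -/
noncomputable def steklov (δ : ℝ) (f : ℝ → E) (t : ℝ) : E := δ⁻¹ • ∫ r in (0 : ℝ)..δ, f (t + r)

lemma steklov_eq (δ : ℝ) (f : ℝ → E) (t : ℝ) :
    steklov δ f t = δ⁻¹ • ∫ r in t..(t + δ), f r := by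
  rw [steklov, intervalIntegral.integral_comp_add_left, add_zero]

lemma map_steklov {F : Type*} [NormedAddCommGroup F] [NormedSpace ℝ F] [CompleteSpace E]
    [CompleteSpace F] (L : E →L[ℝ] F) {δ t : ℝ} {f : ℝ → E}
    (hf : IntervalIntegrable (fun r => f (t + r)) volume 0 δ) :
    L (steklov δ f t) = steklov δ (fun r => L (f r)) t := by
  rw [steklov, steklov, map_smul, L.intervalIntegral_comp_comm hf]

lemma norm_average_sq_le {δ : ℝ} (hδ : 0 < δ) {f : ℝ → E}
    (hf2 : IntervalIntegrable (fun r => ‖f r‖ ^ 2) volume 0 δ)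
    (hfm : AEStronglyMeasurable f (volume.restrict (Ioc 0 δ))) :
    ‖δ⁻¹ • ∫ r in (0 : ℝ)..δ, f r‖ ^ 2 ≤ δ⁻¹ * ∫ r in (0 : ℝ)..δ, ‖f r‖ ^ 2 := by
  have hf : IntervalIntegrable f volume 0 δ := by
    rw [intervalIntegrable_iff_integrableOn_Ioc_of_le hδ.le] at hf2 ⊢
    have h1 : IntegrableOn (fun r => 1 + ‖f r‖ ^ 2) (Ioc 0 δ) :=
      Integrable.add (by simp) hf2
    refine Integrable.mono' h1 hfm (Eventually.of_forall fun r => ?_)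
    nlinarith [sq_nonneg (‖f r‖ - 1), norm_nonneg (f r)]
  set c := ‖δ⁻¹ • ∫ r in (0 : ℝ)..δ, f r‖ with hc
  have h1 : c ≤ δ⁻¹ * ∫ r in (0 : ℝ)..δ, ‖f r‖ := by
    rw [hc, norm_smul, Real.norm_of_nonneg (by positivity)]
    exact mul_le_mul_of_nonneg_left (intervalIntegral.norm_integral_le_integral_norm hδ.le)
      (by positivity)
  have h2 : ∫ r in (0 : ℝ)..δ, 2 * c * ‖f r‖ ≤ ∫ r in (0 : ℝ)..δ, (‖f r‖ ^ 2 + c ^ 2) := by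
    refine intervalIntegral.integral_mono_on hδ.le (hf.norm.const_mul _)
      (hf2.add (by simp)) fun r _ => ?_
    nlinarith [sq_nonneg (‖f r‖ - c)]
  rw [intervalIntegral.integral_const_mul, intervalIntegral.integral_add hf2 (by simp),
    intervalIntegral.integral_const, smul_eq_mul, sub_zero] at h2
  have hc0 : 0 ≤ c := norm_nonneg _
  have h3 := mul_le_mul_of_nonneg_left h2 (inv_nonneg.2 hδ.le)
  have h4 := mul_le_mul_of_nonneg_left h1 (show 0 ≤ 2 * c by positivity)
  have e1 : δ⁻¹ * ((∫ r in (0 : ℝ)..δ, ‖f r‖ ^ 2) + δ * c ^ 2) =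
      δ⁻¹ * (∫ r in (0 : ℝ)..δ, ‖f r‖ ^ 2) + c ^ 2 := by
    field_simp
  rw [e1] at h3
  linarith

/-- Jensen's inequality for averages of functions with values in `L²(ρ)`. -/
lemma integral_norm_average_sq_le {X : Type*} [MeasurableSpace X] {ρ : Measure X} [SFinite ρ]
    {δ : ℝ} (hδ : 0 < δ) {g : ℝ → X → E}
    (hgm : AEStronglyMeasurable (fun p : ℝ × X => g p.1 p.2) ((volume.restrict (Ioc 0 δ)).prod ρ))
    (hgi : Integrable (fun p : ℝ × X => ‖g p.1 p.2‖ ^ 2) ((volume.restrict (Ioc 0 δ)).prod ρ)) :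
    Integrable (fun x => ‖δ⁻¹ • ∫ r in (0 : ℝ)..δ, g r x‖ ^ 2) ρ ∧
    ∫ x, ‖δ⁻¹ • ∫ r in (0 : ℝ)..δ, g r x‖ ^ 2 ∂ρ ≤
      δ⁻¹ * ∫ r in (0 : ℝ)..δ, ∫ x, ‖g r x‖ ^ 2 ∂ρ := by
  have hle : ∀ᵐ x ∂ρ, ‖δ⁻¹ • ∫ r in (0 : ℝ)..δ, g r x‖ ^ 2 ≤
      δ⁻¹ * ∫ r in (0 : ℝ)..δ, ‖g r x‖ ^ 2 := by
    filter_upwards [hgi.prod_left_ae, hgm.prodMk_right] with x h1 h2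
    exact norm_average_sq_le hδ ((intervalIntegrable_iff_integrableOn_Ioc_of_le hδ.le).2 h1) h2
  have hi : Integrable (fun x => δ⁻¹ * ∫ r in (0 : ℝ)..δ, ‖g r x‖ ^ 2) ρ := by
    refine Integrable.const_mul ?_ _
    simp_rw [intervalIntegral.integral_of_le hδ.le]
    exact hgi.integral_prod_right
  have hm : AEStronglyMeasurable (fun x => ‖δ⁻¹ • ∫ r in (0 : ℝ)..δ, g r x‖ ^ 2) ρ := by
    simp_rw [intervalIntegral.integral_of_le hδ.le]
    exact (hgm.prod_swap.integral_prod_right'.const_smul _).norm.pow 2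
  have hint : Integrable (fun x => ‖δ⁻¹ • ∫ r in (0 : ℝ)..δ, g r x‖ ^ 2) ρ := by
    refine hi.mono' hm ?_
    filter_upwards [hle] with x hx
    rwa [Real.norm_of_nonneg (by positivity)]
  refine ⟨hint, (integral_mono_ae hint hi hle).trans (le_of_eq ?_)⟩
  rw [integral_const_mul]
  simp_rw [intervalIntegral.integral_of_le hδ.le]
  rw [integral_integral_swap (f := fun x r => ‖g r x‖ ^ 2) hgi.swap]

/-- Convergence of integrals of nonnegative functions when the pointwise limit gives the lower
bound, by Fatou's lemma, and a convergent majorant of the integrals gives the upper bound. -/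
lemma tendsto_integral_of_le_of_tendsto {X : Type*} [MeasurableSpace X] {ρ : Measure X}
    {f : ℕ → X → ℝ} {g : X → ℝ} {c : ℕ → ℝ} (hf0 : ∀ n x, 0 ≤ f n x) (hg0 : ∀ x, 0 ≤ g x)
    (hf : ∀ n, Integrable (f n) ρ) (hg : Integrable g ρ)
    (hlim : ∀ᵐ x ∂ρ, Tendsto (fun n => f n x) atTop (𝓝 (g x)))
    (hle : ∀ n, ∫ x, f n x ∂ρ ≤ c n) (hc : Tendsto c atTop (𝓝 (∫ x, g x ∂ρ))) :
    Tendsto (fun n => ∫ x, f n x ∂ρ) atTop (𝓝 (∫ x, g x ∂ρ)) := by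
  have hpos : ∀ n, 0 ≤ ∫ x, f n x ∂ρ := fun n => integral_nonneg (hf0 n)
  have hfat : ENNReal.ofReal (∫ x, g x ∂ρ) ≤
      liminf (fun n => ENNReal.ofReal (∫ x, f n x ∂ρ)) atTop := by
    have h1 := lintegral_liminf_le' (u := atTop) (μ := ρ) (f := fun n x => ENNReal.ofReal (f n x))
      fun n => (hf n).aestronglyMeasurable.aemeasurable.ennreal_ofReal
    rw [ofReal_integral_eq_lintegral_ofReal hg (Eventually.of_forall hg0)]
    have h2 : ∀ n, ENNReal.ofReal (∫ x, f n x ∂ρ) = ∫⁻ x, ENNReal.ofReal (f n x) ∂ρ := fun n =>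
      ofReal_integral_eq_lintegral_ofReal (hf n) (Eventually.of_forall (hf0 n))
    simp_rw [h2]
    refine le_trans (le_of_eq (lintegral_congr_ae ?_)) h1
    filter_upwards [hlim] with x hx
    exact ((ENNReal.tendsto_ofReal hx).liminf_eq).symm
  have hsup : limsup (fun n => ENNReal.ofReal (∫ x, f n x ∂ρ)) atTop ≤
      ENNReal.ofReal (∫ x, g x ∂ρ) := by
    rw [← (ENNReal.tendsto_ofReal hc).limsup_eq]
    exact limsup_le_limsup (Eventually.of_forall fun n => ENNReal.ofReal_le_ofReal (hle n))
  have ht := tendsto_of_le_liminf_of_limsup_le hfat hsup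
  have ht' := (ENNReal.tendsto_toReal ENNReal.ofReal_ne_top).comp ht
  rw [ENNReal.toReal_ofReal (integral_nonneg hg0)] at ht'
  refine ht'.congr fun n => ?_
  simp [ENNReal.toReal_ofReal (hpos n)]

lemma steklov_hasDerivWithinAt [CompleteSpace E] {f : ℝ → E} (hf : ContinuousOn f (Ici 0)) {δ : ℝ}
    (hδ : 0 < δ) {t : ℝ} (ht : 0 ≤ t) :
    HasDerivWithinAt (steklov δ f) (δ⁻¹ • (f (t + δ) - f t)) (Ici 0) t := by
  set g : ℝ → E := fun s => f (max s 0) with hg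
  have hgc : Continuous g := hf.comp_continuous (by fun_prop) fun s => mem_Ici.2 (le_max_right _ _)
  have hgf : ∀ s, 0 ≤ s → g s = f s := fun s hs => by simp [hg, hs]
  have hΦ : ∀ x, HasDerivAt (fun x => ∫ s in (0 : ℝ)..x, g s) (g x) x := fun x =>
    intervalIntegral.integral_hasDerivAt_right (hgc.intervalIntegrable _ _)
      (hgc.stronglyMeasurableAtFilter _ _) hgc.continuousAt
  have heq : ∀ x, 0 ≤ x → steklov δ f x =
      δ⁻¹ • ((∫ s in (0 : ℝ)..(x + δ), g s) - ∫ s in (0 : ℝ)..x, g s) := by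
    intro x hx
    rw [steklov_eq, intervalIntegral.integral_interval_sub_left (hgc.intervalIntegrable _ _)
      (hgc.intervalIntegrable _ _)]
    congr 1
    refine intervalIntegral.integral_congr fun s hs => ?_
    rw [uIcc_of_le (by linarith)] at hs
    exact (hgf s (hx.trans hs.1)).symm
  have hd := (((hΦ (t + δ)).comp_add_const t δ).sub (hΦ t)).const_smul δ⁻¹
  rw [hgf _ ht, hgf _ (by linarith)] at hd
  exact hd.hasDerivWithinAt.congr (fun x hx => heq x hx) (heq t ht)

lemma tendsto_steklov_of_continuousOn [CompleteSpace E] {f : ℝ → E} (hf : ContinuousOn f (Ici 0))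
    {t : ℝ} (ht : 0 ≤ t) {δ : ℕ → ℝ} (hδ : ∀ n, 0 < δ n) (hδ0 : Tendsto δ atTop (𝓝 0)) :
    Tendsto (fun n => steklov (δ n) f t) atTop (𝓝 (f t)) := by
  set g : ℝ → E := fun s => f (max s 0) with hg
  have hgc : Continuous g := hf.comp_continuous (by fun_prop) fun s => mem_Ici.2 (le_max_right _ _)
  have hgf : ∀ s, 0 ≤ s → g s = f s := fun s hs => by simp [hg, hs]
  have hΦ : HasDerivAt (fun x => ∫ s in t..x, g s) (g t) t :=
    intervalIntegral.integral_hasDerivAt_right (hgc.intervalIntegrable _ _)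
      (hgc.stronglyMeasurableAtFilter _ _) hgc.continuousAt
  have h1 := hΦ.tendsto_slope_zero
  have h2 : Tendsto δ atTop (𝓝[≠] 0) :=
    tendsto_nhdsWithin_iff.2 ⟨hδ0, Eventually.of_forall fun n => (hδ n).ne'⟩
  have h3 := h1.comp h2
  rw [hgf t ht] at h3
  refine h3.congr fun n => ?_
  simp only [Function.comp, intervalIntegral.integral_same, sub_zero]
  rw [steklov_eq]
  congr 1
  refine intervalIntegral.integral_congr fun s hs => ?_
  rw [uIcc_of_le (by linarith [hδ n])] at hs
  exact hgf s (ht.trans hs.1)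

/-- Lebesgue differentiation: `[x, x + δ]` is a closed ball which contains `x`. -/
lemma ae_tendsto_steklov [CompleteSpace E] {f : ℝ → E} {b : ℝ}
    (hf : ∀ T, IntegrableOn f (Icc b T)) {δ : ℕ → ℝ} (hδ : ∀ n, 0 < δ n)
    (hδ0 : Tendsto δ atTop (𝓝 0)) :
    ∀ᵐ x, b ≤ x → Tendsto (fun n => steklov (δ n) f x) atTop (𝓝 (f x)) := by
  set g := (Ici b).indicator f with hg
  have hloc : LocallyIntegrable g := by
    rw [locallyIntegrable_iff]
    intro k hk
    obtain ⟨T, hT⟩ := hk.bddAbove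
    rw [IntegrableOn, hg, integrable_indicator_iff measurableSet_Ici, IntegrableOn,
      Measure.restrict_restrict measurableSet_Ici]
    exact (hf T).mono_set fun x hx => ⟨hx.1, hT hx.2⟩
  filter_upwards [IsUnifLocDoublingMeasure.ae_tendsto_average (μ := volume) hloc 1] with x hx hbx
  have hlim : Tendsto (fun n => δ n / 2) atTop (𝓝[>] 0) := by
    refine tendsto_nhdsWithin_iff.2 ⟨by simpa using hδ0.div_const 2,
      Eventually.of_forall fun n => ?_⟩
    simpa using hδ n
  have h1 := hx (fun n => x + δ n / 2) (fun n => δ n / 2) hlim (Eventually.of_forall fun n => by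
    rw [mem_closedBall_iff_norm]
    simp [abs_of_pos (hδ n)])
  have e : g x = f x := indicator_of_mem (mem_Ici.2 hbx) f
  rw [e] at h1
  refine h1.congr fun n => ?_
  have hp := hδ n
  rw [Real.closedBall_eq_Icc, setAverage_eq, integral_Icc_eq_integral_Ioc,
    show x + δ n / 2 - δ n / 2 = x by ring, show x + δ n / 2 + δ n / 2 = x + δ n by ring,
    steklov_eq, intervalIntegral.integral_of_le (by linarith)]
  congr 1
  · simp [Measure.real, ENNReal.toReal_ofReal hp.le]
  · refine setIntegral_congr_fun measurableSet_Ioc fun y hy => ?_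
    exact indicator_of_mem (mem_Ici.2 (hbx.trans hy.1.le)) f

lemma aestronglyMeasurable_steklov {f : ℝ → E} (hf : AEStronglyMeasurable f) {δ : ℝ} (hδ : 0 < δ) :
    AEStronglyMeasurable (steklov δ f) := by
  have h2 : Measure.QuasiMeasurePreserving (fun p : ℝ × ℝ => p.1 + p.2)
      (volume.prod (volume.restrict (Ioc 0 δ))) volume := by
    refine (quasiMeasurePreserving_add volume volume).mono_left ?_
    exact Measure.absolutelyContinuous_of_le (Measure.prod_mono le_rfl Measure.restrict_le_self)
  have h3 := (hf.comp_quasiMeasurePreserving h2).integral_prod_right'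
  have : steklov δ f = fun t => δ⁻¹ • ∫ r in Ioc 0 δ, f (t + r) := by
    funext t
    rw [steklov, intervalIntegral.integral_of_le hδ.le]
  rw [this]
  exact h3.const_smul _

end Averages

/-! ### The memory of averaged histories -/

section Regularization

variable {V W : Type*} [NormedAddCommGroup V] [NormedSpace ℝ V]
  [NormedAddCommGroup W] [InnerProductSpace ℝ W]
  {μ ν : ℝ → ℝ} {α m : ℝ} {G : V →L[ℝ] W} {u : ℝ → V}

lemma integral_causal_comp_sub {E : Type*} [NormedAddCommGroup E] [NormedSpace ℝ E]
    (κ : ℝ → ℝ) (f : ℝ → E) (t : ℝ) :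
    ∫ s, causal κ s • f (t - s) = ∫ r, causal κ (t - r) • f r := by
  rw [← integral_sub_left_eq_self (fun r => causal κ (t - r) • f r) volume t]
  simp

lemma memory_eq_lag (t : ℝ) :
    memory μ G u t = ∫ s, causal μ s * ‖G (u t - u (t - s))‖ ^ 2 :=
  (integral_causal_comp_sub μ (fun r => ‖G (u t - u r)‖ ^ 2) t).symm

namespace Admissible

/-- In the coordinate `s = t + r - (past time)` the kernel does not depend on the shift `r`; this is
what allows the averaging over `r` and the memory integral over `s` to be interchanged. -/
lemma integrable_lag (hu : Admissible μ G u) (h : DecayKernel μ ν α m) {K : ℝ}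
    (hK : ∀ x, ‖x‖ ≤ K * ‖G x‖) {t : ℝ} (ht : 0 ≤ t) (δ : ℝ) :
    Integrable (fun p : ℝ × ℝ => causal μ p.2 * (1 + ‖u (t + p.1 - p.2)‖ ^ 2))
      ((volume.restrict (Ioc 0 δ)).prod volume) := by
  have hm : AEStronglyMeasurable (fun p : ℝ × ℝ => causal μ p.2 * (1 + ‖u (t + p.1 - p.2)‖ ^ 2))
      ((volume.restrict (Ioc 0 δ)).prod volume) := by
    refine AEStronglyMeasurable.mul ?_ (aestronglyMeasurable_const.add
      ((aestronglyMeasurable_comp_add_sub hu.meas t _).norm.pow 2))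
    exact ((measurable_causal h.cont.measurable).comp measurable_snd).aestronglyMeasurable
  have hi : ∀ r, 0 ≤ r → Integrable fun s => causal μ s * (1 + ‖u (t + r - s)‖ ^ 2) := by
    intro r hr
    have h1 := hu.integrable_causal_weight h hK (show 0 ≤ t + r by linarith)
    simpa using h1.comp_sub_left (t + r)
  have hT := hu.integrableOn_weight h hK (t + δ)
  rw [integrable_prod_iff hm]
  refine ⟨?_, ?_⟩
  · filter_upwards [ae_restrict_mem measurableSet_Ioc] with r hr using hi r hr.1.le
  · refine (integrable_const (∫ r in Iio (t + δ), μ (-r) * (1 + ‖u r‖ ^ 2))).mono'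
      hm.norm.integral_prod_right' ?_
    filter_upwards [ae_restrict_mem measurableSet_Ioc] with r hr
    rw [Real.norm_of_nonneg (integral_nonneg fun s => norm_nonneg _)]
    have e1 : ∀ s, ‖causal μ s * (1 + ‖u (t + r - s)‖ ^ 2)‖ =
        causal μ s * (1 + ‖u (t + r - s)‖ ^ 2) := fun s =>
      Real.norm_of_nonneg (mul_nonneg (causal_nonneg h.nonneg _) (by positivity))
    simp only [e1]
    have e2 := integral_causal_comp_sub μ (fun r => 1 + ‖u r‖ ^ 2) (t + r)
    simp only [smul_eq_mul] at e2
    rw [e2, ← integral_indicator measurableSet_Iio]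
    have h0 : 0 ≤ t + r := by linarith [hr.1]
    refine integral_mono (hu.integrable_causal_weight h hK h0)
      ((integrable_indicator_iff measurableSet_Iio).2 hT) fun x => ?_
    by_cases hx : x < t + δ
    · rw [indicator_of_mem (mem_Iio.2 hx)]
      exact mul_le_mul_of_nonneg_right (h.causal_le h0) (by positivity)
    · rw [indicator_of_notMem (by simpa using hx), causal_of_nonpos (by linarith [hr.2]), zero_mul]

/-- The history is integrable as far back as the kernel is positive. Where the kernel vanishes,
nothing is known about `u`, and its averages may be junk values; they then carry weight zero. -/
lemma integrableOn_Icc (hu : Admissible μ G u) (h : DecayKernel μ ν α m) {K : ℝ}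
    (hK : ∀ x, ‖x‖ ≤ K * ‖G x‖) {b : ℝ} (hb : 0 < μ b) (T : ℝ) :
    IntegrableOn u (Icc (-b) T) := by
  have h1 : IntegrableOn (fun r => (μ b)⁻¹ * (μ (-r) * (1 + ‖u r‖ ^ 2))) (Icc (-b) T) :=
    Integrable.const_mul ((hu.integrableOn_weight h hK (T + 1)).mono_set fun r hr =>
      mem_Iio.2 (by linarith [hr.2])) _
  refine Integrable.mono' h1 hu.meas.restrict ?_
  filter_upwards [ae_restrict_mem measurableSet_Icc] with r hr
  have h2 : μ b ≤ μ (-r) := h.anti (by linarith [hr.1])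
  have h3 : 1 ≤ (μ b)⁻¹ * μ (-r) := by
    rw [← div_eq_inv_mul, one_le_div hb]
    exact h2
  have h4 : ‖u r‖ ≤ 1 + ‖u r‖ ^ 2 := by nlinarith [sq_nonneg (‖u r‖ - 1), norm_nonneg (u r)]
  rw [← mul_assoc]
  nlinarith [sq_nonneg ‖u r‖]

lemma intervalIntegrable_shift (hu : Admissible μ G u) (h : DecayKernel μ ν α m) {K : ℝ}
    (hK : ∀ x, ‖x‖ ≤ K * ‖G x‖) {x : ℝ} (hx : 0 < μ (-x)) {δ : ℝ} (hδ : 0 < δ) :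
    IntervalIntegrable (fun r => u (x + r)) volume 0 δ := by
  have h1 : IntervalIntegrable u volume x (x + δ) := by
    rw [intervalIntegrable_iff_integrableOn_Ioc_of_le (by linarith)]
    refine (hu.integrableOn_Icc h hK hx (x + δ)).mono_set fun r hr => ⟨?_, hr.2⟩
    linarith [hr.1]
  simpa using h1.comp_add_left x

lemma kernel_pos_of_nonneg (h : DecayKernel μ ν α m) {t : ℝ} (ht : 0 ≤ t) : 0 < μ (-t) :=
  h.pos_zero.trans_le (h.anti (by linarith))

lemma steklov_sub (hu : Admissible μ G u) (h : DecayKernel μ ν α m) {K : ℝ}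
    (hK : ∀ x, ‖x‖ ≤ K * ‖G x‖) {δ : ℝ} (hδ : 0 < δ) {t x : ℝ} (ht : 0 ≤ t) (hx : 0 < μ (-x)) :
    steklov δ u t - steklov δ u x = δ⁻¹ • ∫ r in (0 : ℝ)..δ, (u (t + r) - u (x + r)) := by
  rw [intervalIntegral.integral_sub (hu.intervalIntegrable_shift h hK
    (kernel_pos_of_nonneg h ht) hδ) (hu.intervalIntegrable_shift h hK hx hδ), smul_sub]
  rfl

variable [CompleteSpace V]

/-- By Jensen's inequality, the memory of an average is at most the average of the memory. -/
lemma memory_steklov (hu : Admissible μ G u) (h : DecayKernel μ ν α m) {K : ℝ}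
    (hK : ∀ x, ‖x‖ ≤ K * ‖G x‖) [CompleteSpace W] {δ : ℝ} (hδ : 0 < δ) {t : ℝ} (ht : 0 ≤ t) :
    Integrable (fun r => causal μ (t - r) * ‖G (steklov δ u t - steklov δ u r)‖ ^ 2) ∧
    memory μ G (steklov δ u) t ≤ steklov δ (memory μ G u) t := by
  set g : ℝ → ℝ → W := fun r s => Real.sqrt (causal μ s) • G (u (t + r) - u (t + r - s)) with hg
  have hnn : ∀ s, 0 ≤ causal μ s := causal_nonneg h.nonneg
  have hg2 : ∀ r s, ‖g r s‖ ^ 2 = causal μ s * ‖G (u (t + r) - u (t + r - s))‖ ^ 2 := by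
    intro r s
    rw [hg, norm_smul, mul_pow, Real.norm_of_nonneg (Real.sqrt_nonneg _), Real.sq_sqrt (hnn s)]
  have hut : ContinuousOn (fun r => u (t + r)) (Icc 0 δ) :=
    hu.cont.comp (by fun_prop) fun r hr => mem_Ici.2 (by linarith [hr.1])
  have hgm : AEStronglyMeasurable (fun p : ℝ × ℝ => g p.1 p.2)
      ((volume.restrict (Ioc 0 δ)).prod volume) := by
    refine AEStronglyMeasurable.smul ?_ (G.continuous.comp_aestronglyMeasurable
      (AEStronglyMeasurable.sub ?_ (aestronglyMeasurable_comp_add_sub hu.meas t _)))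
    · exact ((measurable_causal h.cont.measurable).comp measurable_snd).sqrt.aestronglyMeasurable
    · exact ((hut.mono Ioc_subset_Icc_self).aestronglyMeasurable measurableSet_Ioc).comp_fst
  obtain ⟨R, hR⟩ := isCompact_Icc.exists_bound_of_continuousOn hut
  have hgi : Integrable (fun p : ℝ × ℝ => ‖g p.1 p.2‖ ^ 2)
      ((volume.restrict (Ioc 0 δ)).prod volume) := by
    refine ((hu.integrable_lag h hK ht δ).const_mul (‖G‖ ^ 2 * (2 * R ^ 2 + 2))).mono'
      (hgm.norm.pow 2) ?_
    have : ∀ᵐ r ∂(volume.restrict (Ioc 0 δ)), r ∈ Ioc 0 δ := ae_restrict_mem measurableSet_Ioc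
    filter_upwards [Measure.quasiMeasurePreserving_fst.ae this] with p hp
    rw [Real.norm_of_nonneg (by positivity), hg2]
    have h1 := norm_sub_sq_le_weight G (hR p.1 (Ioc_subset_Icc_self hp)) (u (t + p.1 - p.2))
    have h2 := mul_le_mul_of_nonneg_left h1 (hnn p.2)
    refine h2.trans (le_of_eq (by ring))
  obtain ⟨hint, hle⟩ := integral_norm_average_sq_le hδ hgm hgi
  have havg : ∀ s, ‖δ⁻¹ • ∫ r in (0 : ℝ)..δ, g r s‖ ^ 2 =
      causal μ s * ‖G (steklov δ u t - steklov δ u (t - s))‖ ^ 2 := by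
    intro s
    rcases le_or_gt s 0 with hs | hs
    · simp [hg, causal_of_nonpos hs]
    rcases (h.nonneg s).eq_or_lt with h0 | h0
    · simp [hg, causal_of_pos hs, ← h0]
    have hpos : 0 < μ (-(t - s)) := h0.trans_le (h.anti (by linarith))
    have e1 : ∫ r in (0 : ℝ)..δ, g r s = Real.sqrt (causal μ s) •
        G (∫ r in (0 : ℝ)..δ, (u (t + r) - u (t - s + r))) := by
      rw [← G.intervalIntegral_comp_comm ((hu.intervalIntegrable_shift h hK
        (kernel_pos_of_nonneg h ht) hδ).sub (hu.intervalIntegrable_shift h hK hpos hδ)),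
        ← intervalIntegral.integral_smul]
      refine intervalIntegral.integral_congr fun r _ => ?_
      simp only [hg]
      rw [show t + r - s = t - s + r by ring]
    rw [hu.steklov_sub h hK hδ ht hpos, e1, smul_comm, ← map_smul, norm_smul, mul_pow,
      Real.norm_of_nonneg (Real.sqrt_nonneg _), Real.sq_sqrt (hnn s)]
  simp only [havg, hg2] at hint hle
  refine ⟨?_, ?_⟩
  · simpa using hint.comp_sub_left t
  · rw [memory_eq_lag]
    refine hle.trans (le_of_eq ?_)
    rw [steklov, smul_eq_mul]
    congr 1
    refine intervalIntegral.integral_congr fun r _ => ?_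
    exact (memory_eq_lag _).symm

lemma steklov_admissible [CompleteSpace W] (hu : Admissible μ G u) (h : DecayKernel μ ν α m) {K : ℝ}
    (hK : ∀ x, ‖x‖ ≤ K * ‖G x‖) {δ : ℝ} (hδ : 0 < δ) : Admissible μ G (steklov δ u) :=
  ⟨aestronglyMeasurable_steklov hu.meas hδ,
    fun _ ht => (steklov_hasDerivWithinAt hu.cont hδ ht).continuousWithinAt,
    (hu.memory_steklov h hK hδ le_rfl).1⟩

lemma ae_tendsto_steklov (hu : Admissible μ G u) (h : DecayKernel μ ν α m) {K : ℝ}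
    (hK : ∀ x, ‖x‖ ≤ K * ‖G x‖) {δ : ℕ → ℝ} (hδ : ∀ n, 0 < δ n)
    (hδ0 : Tendsto δ atTop (𝓝 0)) :
    ∀ᵐ x, 0 < μ (-x) → Tendsto (fun n => steklov (δ n) u x) atTop (𝓝 (u x)) := by
  have h1 : ∀ q : ℚ, ∀ᵐ x : ℝ, 0 < μ q → -(q : ℝ) ≤ x →
      Tendsto (fun n => steklov (δ n) u x) atTop (𝓝 (u x)) := by
    intro q
    by_cases hq : 0 < μ q
    · filter_upwards [ViscoDelay.ae_tendsto_steklov (fun T => hu.integrableOn_Icc h hK hq T) hδ hδ0]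
        with x hx _ hxq using hx hxq
    · exact Eventually.of_forall fun x hx => absurd hx hq
  filter_upwards [ae_all_iff.2 h1] with x hx hpos
  -- By continuity the kernel is still positive at a slightly larger rational lag.
  obtain ⟨ε, hε, H⟩ := Metric.eventually_nhds_iff.1 (h.cont.continuousAt.eventually
    (lt_mem_nhds hpos : ∀ᶠ y in 𝓝 (μ (-x)), 0 < y))
  obtain ⟨q, hq1, hq2⟩ := exists_rat_btwn (show -x < -x + ε by linarith)
  refine hx q (H ?_) (by linarith)
  rw [Real.dist_eq, abs_of_pos (by linarith)]
  linarith

lemma tendsto_memory_steklov [CompleteSpace W] (hu : Admissible μ G u) (h : DecayKernel μ ν α m)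
    {K : ℝ} (hK : ∀ x, ‖x‖ ≤ K * ‖G x‖) {δ : ℕ → ℝ} (hδ : ∀ n, 0 < δ n)
    (hδ0 : Tendsto δ atTop (𝓝 0)) {t : ℝ} (ht : 0 ≤ t) :
    Tendsto (fun n => memory μ G (steklov (δ n) u) t) atTop (𝓝 (memory μ G u t)) := by
  refine tendsto_integral_of_le_of_tendsto
    (fun n r => mul_nonneg (causal_nonneg h.nonneg _) (by positivity))
    (fun r => mul_nonneg (causal_nonneg h.nonneg _) (by positivity))
    (fun n => (hu.memory_steklov h hK (hδ n) ht).1) (hu.integrable_memory h hK ht) ?_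
    (fun n => (hu.memory_steklov h hK (hδ n) ht).2)
    (tendsto_steklov_of_continuousOn (hu.continuousOn_memory h hK) ht hδ hδ0)
  filter_upwards [hu.ae_tendsto_steklov h hK hδ hδ0] with r hr
  rcases le_or_gt (t - r) 0 with h0 | h0
  · simp [causal_of_nonpos h0]
  rcases (h.nonneg (t - r)).eq_or_lt with h1 | h1
  · simp [causal_of_pos h0, ← h1]
  have h2 := hr (h1.trans_le (h.anti (by linarith)))
  have h3 := tendsto_steklov_of_continuousOn hu.cont ht hδ hδ0
  exact ((((G.continuous.tendsto _).comp (h3.sub h2)).norm).pow 2).const_mul _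

end Admissible

end Regularization

/-! ### Weak solutions -/

section Weak

variable {V H W : Type*} [NormedAddCommGroup V] [NormedSpace ℝ V]
  [NormedAddCommGroup H]
  [NormedAddCommGroup W] [InnerProductSpace ℝ W]
  {μ ν : ℝ → ℝ} {α m : ℝ} {G : V →L[ℝ] W} {u : ℝ → V} {v : ℝ → H}
  {τ a k : ℝ}

lemma intervalIntegrable_of_sq (hm : AEStronglyMeasurable v)
    (hsq : ∀ x y, IntervalIntegrable (fun s => ‖v s‖ ^ 2) volume x y) (x y : ℝ) :
    IntervalIntegrable v volume x y := by
  refine ((hsq x y).add (intervalIntegrable_const (c := (1 : ℝ)))).mono_fun hm.restrict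
    (Eventually.of_forall fun r => ?_)
  simp only
  rw [Real.norm_of_nonneg (by positivity)]
  nlinarith [sq_nonneg (‖v r‖ - 1), norm_nonneg (v r)]

lemma continuous_delayEnergy (hsq : ∀ x y, IntervalIntegrable (fun s => ‖v s‖ ^ 2) volume x y) :
    Continuous (delayEnergy τ v) := by
  have hi : ∀ x y, IntervalIntegrable (fun s => Real.exp s * ‖v s‖ ^ 2) volume x y := fun x y =>
    (hsq x y).continuousOn_mul Real.continuous_exp.continuousOn
  have heq : delayEnergy τ v = fun x => Real.exp (-x) *
      ((∫ s in (0 : ℝ)..x, Real.exp s * ‖v s‖ ^ 2)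
        - ∫ s in (0 : ℝ)..(x - τ), Real.exp s * ‖v s‖ ^ 2) := by
    funext x
    rw [intervalIntegral.integral_interval_sub_left (hi _ _) (hi _ _),
      ← intervalIntegral.integral_const_mul, delayEnergy]
    refine intervalIntegral.integral_congr fun s _ => ?_
    rw [← mul_assoc, ← Real.exp_add]
    congr 2
    ring
  have hc := intervalIntegral.continuous_primitive hi 0
  rw [heq]
  exact (Real.continuous_exp.comp continuous_neg).mul (hc.sub (hc.comp (by fun_prop)))

/-- By Jensen's inequality, the delay functional of an average is at most the average of the delay
functional. -/
lemma delayEnergy_steklov [NormedSpace ℝ H] (hm : AEStronglyMeasurable v)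
    (hsq : ∀ x y, IntervalIntegrable (fun s => ‖v s‖ ^ 2) volume x y) (hτ : 0 < τ) {δ : ℝ}
    (hδ : 0 < δ) (t : ℝ) :
    IntegrableOn (fun s => Real.exp (-(t - s)) * ‖steklov δ v s‖ ^ 2) (Ioc (t - τ) t) ∧
    delayEnergy τ (steklov δ v) t ≤ steklov δ (delayEnergy τ v) t := by
  set g : ℝ → ℝ → H := fun r s => Real.exp (-(t - s) / 2) • v (s + r) with hg
  have hexp : ∀ s, Real.exp (-(t - s) / 2) ^ 2 = Real.exp (-(t - s)) := by
    intro s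
    rw [← Real.exp_nat_mul]
    congr 1
    push_cast
    ring
  have hg2 : ∀ r s, ‖g r s‖ ^ 2 = Real.exp (-(t - s)) * ‖v (s + r)‖ ^ 2 := by
    intro r s
    rw [hg, norm_smul, mul_pow, Real.norm_of_nonneg (Real.exp_pos _).le, hexp]
  have h2 : Measure.QuasiMeasurePreserving (fun p : ℝ × ℝ => p.1 + p.2)
      ((volume.restrict (Ioc 0 δ)).prod (volume.restrict (Ioc (t - τ) t))) volume := by
    refine (quasiMeasurePreserving_add volume volume).mono_left ?_
    exact Measure.absolutelyContinuous_of_le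
      (Measure.prod_mono Measure.restrict_le_self Measure.restrict_le_self)
  have hgm : AEStronglyMeasurable (fun p : ℝ × ℝ => g p.1 p.2)
      ((volume.restrict (Ioc 0 δ)).prod (volume.restrict (Ioc (t - τ) t))) := by
    refine AEStronglyMeasurable.smul (Continuous.aestronglyMeasurable (by fun_prop)) ?_
    have := hm.comp_quasiMeasurePreserving h2
    simpa [Function.comp_def, add_comm] using this
  have hiF : ∀ c x y, IntervalIntegrable (fun s => Real.exp (-(c - s)) * ‖v s‖ ^ 2) volume x y :=
    fun c x y => (hsq x y).continuousOn_mul (Continuous.continuousOn (by fun_prop))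
  have hshift : ∀ r, (fun s => ‖g r s‖ ^ 2) =
      fun s => (fun s => Real.exp (-((t + r) - s)) * ‖v s‖ ^ 2) (s + r) := by
    intro r
    funext s
    rw [hg2]
    simp only
    congr 3
    ring
  have hQ : ∀ r, ∫ s in Ioc (t - τ) t, ‖g r s‖ ^ 2 = delayEnergy τ v (t + r) := by
    intro r
    rw [hshift, ← intervalIntegral.integral_of_le (by linarith),
      intervalIntegral.integral_comp_add_right
        (fun s => Real.exp (-((t + r) - s)) * ‖v s‖ ^ 2), delayEnergy]
    congr 1
    ring
  have hc := continuous_delayEnergy (τ := τ) hsq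
  have hgi : Integrable (fun p : ℝ × ℝ => ‖g p.1 p.2‖ ^ 2)
      ((volume.restrict (Ioc 0 δ)).prod (volume.restrict (Ioc (t - τ) t))) := by
    have hgm2 : AEStronglyMeasurable (fun p : ℝ × ℝ => ‖g p.1 p.2‖ ^ 2)
      ((volume.restrict (Ioc 0 δ)).prod (volume.restrict (Ioc (t - τ) t))) := hgm.norm.pow 2
    rw [integrable_prod_iff hgm2]
    refine ⟨Eventually.of_forall fun r => ?_, ?_⟩
    · have h3 := (hiF (t + r) (t - τ + r) (t + r)).comp_add_right r
      simp only [add_sub_cancel_right] at h3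
      have h4 := (intervalIntegrable_iff_integrableOn_Ioc_of_le (by linarith)).1 h3
      simp only
      rw [hshift]
      exact h4
    · have e : ∀ r, ∫ s in Ioc (t - τ) t, ‖‖g r s‖ ^ 2‖ = delayEnergy τ v (t + r) := by
        intro r
        rw [← hQ]
        refine integral_congr_ae (Eventually.of_forall fun s => ?_)
        simp
      simp only [e]
      exact (hc.comp (by fun_prop : Continuous fun r => t + r)).integrableOn_Ioc
  obtain ⟨hint, hle⟩ := integral_norm_average_sq_le hδ hgm hgi
  have havg : ∀ s, ‖δ⁻¹ • ∫ r in (0 : ℝ)..δ, g r s‖ ^ 2 =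
      Real.exp (-(t - s)) * ‖steklov δ v s‖ ^ 2 := by
    intro s
    simp only [hg]
    rw [intervalIntegral.integral_smul, smul_comm, norm_smul, mul_pow,
      Real.norm_of_nonneg (Real.exp_pos _).le, hexp, steklov]
  simp only [havg, hQ] at hint hle
  refine ⟨hint, ?_⟩
  rw [delayEnergy, intervalIntegral.integral_of_le (by linarith)]
  exact hle

lemma tendsto_delayEnergy_steklov [NormedSpace ℝ H] [CompleteSpace H] (hm : AEStronglyMeasurable v)
    (hsq : ∀ x y, IntervalIntegrable (fun s => ‖v s‖ ^ 2) volume x y) (hτ : 0 < τ) {δ : ℕ → ℝ}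
    (hδ : ∀ n, 0 < δ n) (hδ0 : Tendsto δ atTop (𝓝 0)) {t : ℝ} (ht : 0 ≤ t) :
    Tendsto (fun n => delayEnergy τ (steklov (δ n) v) t) atTop (𝓝 (delayEnergy τ v t)) := by
  have hle : t - τ ≤ t := by linarith
  have hlim := tendsto_steklov_of_continuousOn
    (continuous_delayEnergy (τ := τ) hsq).continuousOn ht hδ hδ0
  have hb : ∀ n, delayEnergy τ (steklov (δ n) v) t ≤ steklov (δ n) (delayEnergy τ v) t := fun n =>
    (delayEnergy_steklov hm hsq hτ (hδ n) t).2
  simp only [delayEnergy, intervalIntegral.integral_of_le hle] at hlim hb ⊢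
  refine tendsto_integral_of_le_of_tendsto (fun n r => by positivity) (fun r => by positivity)
    (fun n => (delayEnergy_steklov hm hsq hτ (hδ n) t).1) ?_ ?_ hb hlim
  · exact (intervalIntegrable_iff_integrableOn_Ioc_of_le hle).1
      ((hsq _ _).continuousOn_mul (Continuous.continuousOn (by fun_prop)))
  · have h1 := ViscoDelay.ae_tendsto_steklov (f := v) (b := t - τ) (fun T => by
      rcases le_or_gt (t - τ) T with hT | hT
      · rw [integrableOn_Icc_iff_integrableOn_Ioc]
        exact (intervalIntegrable_iff_integrableOn_Ioc_of_le hT).1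
          (intervalIntegrable_of_sq hm hsq _ _)
      · simp [Icc_eq_empty (not_le.2 hT)]) hδ hδ0
    filter_upwards [ae_restrict_of_ae h1, ae_restrict_mem measurableSet_Ioc] with s hs hst
    exact ((hs hst.1.le).norm.pow 2).const_mul _

variable [InnerProductSpace ℝ H] {ι : V →L[ℝ] H}

/-- Finite-energy solutions in the abstract setting. The velocity `v` is defined for all times and
locally square integrable; it is the derivative of `ι u` for `t ≥ 0` and an independent datum for
`t < 0`. The equation is tested with `φ ∈ V` and integrated over `(0, t)`. -/
structure WeakSolution (μ : ℝ → ℝ) (ι : V →L[ℝ] H) (G : V →L[ℝ] W) (τ a k : ℝ)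
    (u : ℝ → V) (v : ℝ → H) : Prop extends Admissible μ G u where
  meas_v : AEStronglyMeasurable v
  sq_integrable : ∀ x y, IntervalIntegrable (fun s => ‖v s‖ ^ 2) volume x y
  cont_v : ContinuousOn v (Ici 0)
  deriv_u : ∀ t, 0 ≤ t → HasDerivWithinAt (fun r => ι (u r)) (v t) (Ici 0) t
  equation : ∀ φ : V, ∀ t, 0 ≤ t →
    ⟪v t, ι φ⟫_ℝ - ⟪v 0, ι φ⟫_ℝ
      + ∫ r in (0 : ℝ)..t,
          (⟪G (u r), G φ⟫_ℝ - (∫ s in Ioi (0 : ℝ), μ s * ⟪G (u (r - s)), G φ⟫_ℝ)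
            + a * ⟪v r, ι φ⟫_ℝ + k * ⟪v (r - τ), ι φ⟫_ℝ) = 0

/-- Averaging in time commutes with the memory force. -/
lemma Admissible.memoryForce_steklov [CompleteSpace V] (hu : Admissible μ G u)
    (h : DecayKernel μ ν α m) {K : ℝ} (hK : ∀ x, ‖x‖ ≤ K * ‖G x‖) (y : W) {δ : ℝ} (hδ : 0 < δ)
    {t : ℝ} (ht : 0 ≤ t) :
    IntervalIntegrable (fun r => ∫ s in Ioi (0 : ℝ), μ s * ⟪G (u (t + r - s)), y⟫_ℝ) volume 0 δ ∧
    steklov δ (fun r => ∫ s in Ioi (0 : ℝ), μ s * ⟪G (u (r - s)), y⟫_ℝ) t =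
      ∫ s in Ioi (0 : ℝ), μ s * ⟪G (steklov δ u (t - s)), y⟫_ℝ := by
  have hnn : ∀ s, 0 ≤ causal μ s := causal_nonneg h.nonneg
  set L : V →L[ℝ] ℝ := (innerSL ℝ y).comp G with hL
  have hLx : ∀ x, ⟪G x, y⟫_ℝ = L x := fun x => by simp [hL, real_inner_comm]
  have hcausal : ∀ f : ℝ → ℝ, ∫ s in Ioi (0 : ℝ), μ s * f s = ∫ s, causal μ s * f s := by
    intro f
    rw [← integral_indicator measurableSet_Ioi]
    congr 1 with s
    by_cases hs : 0 < s <;> simp [causal, hs]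
  simp only [hLx, hcausal]
  have hint : Integrable (fun p : ℝ × ℝ => causal μ p.2 * L (u (t + p.1 - p.2)))
      ((volume.restrict (Ioc 0 δ)).prod volume) := by
    refine ((hu.integrable_lag h hK ht δ).const_mul ‖L‖).mono' ?_
      (Eventually.of_forall fun p => ?_)
    · refine AEStronglyMeasurable.mul ?_ (L.continuous.comp_aestronglyMeasurable
        (aestronglyMeasurable_comp_add_sub hu.meas t _))
      exact ((measurable_causal h.cont.measurable).comp measurable_snd).aestronglyMeasurable
    · rw [norm_mul, Real.norm_of_nonneg (hnn _)]
      have h1 := L.le_opNorm (u (t + p.1 - p.2))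
      have h2 : ‖u (t + p.1 - p.2)‖ ≤ 1 + ‖u (t + p.1 - p.2)‖ ^ 2 := by
        nlinarith [sq_nonneg (‖u (t + p.1 - p.2)‖ - 1), norm_nonneg (u (t + p.1 - p.2))]
      have h3 := mul_le_mul_of_nonneg_left
        (h1.trans (mul_le_mul_of_nonneg_left h2 (norm_nonneg L))) (hnn p.2)
      linarith
  refine ⟨?_, ?_⟩
  · rw [intervalIntegrable_iff_integrableOn_Ioc_of_le hδ.le]
    exact hint.integral_prod_left
  · rw [steklov, intervalIntegral.integral_of_le hδ.le,
      integral_integral_swap (f := fun r s => causal μ s * L (u (t + r - s))) hint,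
      smul_eq_mul, ← integral_const_mul]
    congr 1 with s
    rcases le_or_gt s 0 with hs | hs
    · simp [causal_of_nonpos hs]
    rcases (h.nonneg s).eq_or_lt with h0 | h0
    · simp [causal_of_pos hs, ← h0]
    have hpos : 0 < μ (-(t - s)) := h0.trans_le (h.anti (by linarith))
    rw [map_steklov L (hu.intervalIntegrable_shift h hK hpos hδ), steklov, smul_eq_mul,
      intervalIntegral.integral_of_le hδ.le, integral_const_mul]
    simp only [show ∀ r, t - s + r = t + r - s from fun r => by ring]
    ring

namespace WeakSolution

lemma continuousOn_totalEnergy (hs : WeakSolution μ ι G τ a k u v) (h : DecayKernel μ ν α m)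
    {K : ℝ} (hK : ∀ x, ‖x‖ ≤ K * ‖G x‖) : ContinuousOn (totalEnergy μ m G τ a u v) (Ici 0) := by
  refine ((ContinuousOn.add ?_ ?_).add ?_).add ?_
  · exact continuousOn_const.mul (hs.cont_v.norm.pow 2)
  · exact continuousOn_const.mul ((G.continuous.comp_continuousOn hs.cont).norm.pow 2)
  · exact continuousOn_const.mul (hs.continuousOn_memory h hK)
  · exact continuousOn_const.mul (continuous_delayEnergy hs.sq_integrable).continuousOn

variable [CompleteSpace V] [CompleteSpace W]

lemma totalEnergy_steklov_le (hs : WeakSolution μ ι G τ a k u v) (h : DecayKernel μ ν α m)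
    {K : ℝ} (hK : ∀ x, ‖x‖ ≤ K * ‖G x‖) (hτ : 0 < τ) (ha : 0 ≤ a) {δ : ℝ} (hδ : 0 < δ) {t : ℝ}
    (ht : 0 ≤ t) :
    totalEnergy μ m G τ a (steklov δ u) (steklov δ v) t ≤
      steklov δ (totalEnergy μ m G τ a u v) t := by
  have hm1 : 0 < 1 - m := by linarith [h.mass_lt_one]
  have hii : ∀ {f : ℝ → ℝ}, ContinuousOn f (Ici 0) →
      IntervalIntegrable (fun r => f (t + r)) volume 0 δ := by
    intro f hf
    refine ContinuousOn.intervalIntegrable (hf.comp (by fun_prop) fun r hr => ?_)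
    rw [uIcc_of_le hδ.le] at hr
    exact mem_Ici.2 (by linarith [hr.1])
  have hsub : MapsTo (fun r => t + r) (Ioc 0 δ) (Ici 0) := fun r hr =>
    mem_Ici.2 (by linarith [hr.1])
  have hGu : ContinuousOn (fun r => G (u r)) (Ici 0) := G.continuous.comp_continuousOn hs.cont
  have c1 : ContinuousOn (fun r => ‖v r‖ ^ 2) (Ici 0) := hs.cont_v.norm.pow 2
  have c2 : ContinuousOn (fun r => ‖G (u r)‖ ^ 2) (Ici 0) := hGu.norm.pow 2
  have c3 := hs.continuousOn_memory h hK
  have c4 : ContinuousOn (delayEnergy τ v) (Ici 0) :=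
    (continuous_delayEnergy hs.sq_integrable).continuousOn
  have b1 : ‖steklov δ v t‖ ^ 2 ≤ δ⁻¹ * ∫ r in (0 : ℝ)..δ, ‖v (t + r)‖ ^ 2 :=
    norm_average_sq_le hδ (hii c1)
      ((hs.cont_v.comp (by fun_prop) hsub).aestronglyMeasurable measurableSet_Ioc)
  have b2 : ‖G (steklov δ u t)‖ ^ 2 ≤ δ⁻¹ * ∫ r in (0 : ℝ)..δ, ‖G (u (t + r))‖ ^ 2 := by
    rw [map_steklov G (hs.intervalIntegrable_shift h hK
      (Admissible.kernel_pos_of_nonneg h ht) hδ)]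
    exact norm_average_sq_le hδ (hii c2)
      ((hGu.comp (by fun_prop) hsub).aestronglyMeasurable measurableSet_Ioc)
  have b3 := (hs.memory_steklov h hK hδ ht).2
  have b4 := (delayEnergy_steklov hs.meas_v hs.sq_integrable hτ hδ t).2
  have e : steklov δ (totalEnergy μ m G τ a u v) t =
      1 / 2 * (δ⁻¹ * ∫ r in (0 : ℝ)..δ, ‖v (t + r)‖ ^ 2)
      + (1 - m) / 2 * (δ⁻¹ * ∫ r in (0 : ℝ)..δ, ‖G (u (t + r))‖ ^ 2)
      + 1 / 2 * steklov δ (memory μ G u) t + a / 2 * steklov δ (delayEnergy τ v) t := by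
    simp only [steklov, totalEnergy, smul_eq_mul]
    rw [intervalIntegral.integral_add ((((hii c1).const_mul _).add ((hii c2).const_mul _)).add
      ((hii c3).const_mul _)) ((hii c4).const_mul _), intervalIntegral.integral_add
      (((hii c1).const_mul _).add ((hii c2).const_mul _)) ((hii c3).const_mul _),
      intervalIntegral.integral_add ((hii c1).const_mul _) ((hii c2).const_mul _)]
    simp only [intervalIntegral.integral_const_mul]
    ring
  rw [e, totalEnergy]
  have d1 := mul_le_mul_of_nonneg_left b1 (show (0 : ℝ) ≤ 1 / 2 by norm_num)
  have d2 := mul_le_mul_of_nonneg_left b2 (show 0 ≤ (1 - m) / 2 by linarith)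
  have d3 := mul_le_mul_of_nonneg_left b3 (show (0 : ℝ) ≤ 1 / 2 by norm_num)
  have d4 := mul_le_mul_of_nonneg_left b4 (show 0 ≤ a / 2 by linarith)
  linarith

variable [CompleteSpace H]

/-- The average of a weak solution is a regular solution: its time derivatives are difference
quotients, and the equation at time `t` is `δ⁻¹` times the difference of the integrated equations at
`t + δ` and `t`. -/
lemma regular_steklov (hs : WeakSolution μ ι G τ a k u v) (h : DecayKernel μ ν α m)
    {K : ℝ} (hK : ∀ x, ‖x‖ ≤ K * ‖G x‖) {δ : ℝ} (hδ : 0 < δ) :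
    RegularSolution μ ι G τ a k (steklov δ u) (fun t => δ⁻¹ • (u (t + δ) - u t))
      (steklov δ v) (fun t => δ⁻¹ • (v (t + δ) - v t)) := by
  have hshift : ContinuousOn (fun t => t + δ) (Ici (0 : ℝ)) := by fun_prop
  have hmaps : MapsTo (fun t => t + δ) (Ici (0 : ℝ)) (Ici 0) := fun t ht =>
    mem_Ici.2 (by have : (0 : ℝ) ≤ t := ht; linarith)
  have hvi := intervalIntegrable_of_sq hs.meas_v hs.sq_integrable
  refine ⟨hs.steklov_admissible h hK hδ, ?_, fun t ht => steklov_hasDerivWithinAt hs.cont hδ ht,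
    ?_, ?_, ?_, fun t ht => steklov_hasDerivWithinAt hs.cont_v hδ ht, ?_⟩
  · exact ((hs.cont.comp hshift hmaps).sub hs.cont).const_smul _
  · intro t ht
    have := integral_eq_sub_of_hasDerivWithinAt_Ici hs.deriv_u hs.cont_v ht
      (show t ≤ t + δ by linarith)
    rw [steklov_eq, this, map_smul, map_sub]
  · have hc := intervalIntegral.continuous_primitive hvi 0
    have : steklov δ v =
        fun t => δ⁻¹ • ((∫ s in (0 : ℝ)..(t + δ), v s) - ∫ s in (0 : ℝ)..t, v s) := by
      funext t
      rw [steklov_eq, intervalIntegral.integral_interval_sub_left (hvi _ _) (hvi _ _)]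
    rw [this]
    exact (((hc.comp (by fun_prop : Continuous fun t => t + δ)).sub hc).const_smul _).continuousOn
  · exact ((hs.cont_v.comp hshift hmaps).sub hs.cont_v).const_smul _
  · intro φ t ht
    set f₁ : ℝ → ℝ := fun r => ⟪G (u r), G φ⟫_ℝ with hf₁
    set f₂ : ℝ → ℝ := fun r => ∫ s in Ioi (0 : ℝ), μ s * ⟪G (u (r - s)), G φ⟫_ℝ with hf₂
    set f₃ : ℝ → ℝ := fun r => ⟪v r, ι φ⟫_ℝ with hf₃
    set f₄ : ℝ → ℝ := fun r => ⟪v (r - τ), ι φ⟫_ℝ with hf₄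
    have hinn : ∀ x : H, ⟪x, ι φ⟫_ℝ = innerSL ℝ (ι φ) x := fun x => by simp [real_inner_comm]
    have hinnG : ∀ x : V, ⟪G x, G φ⟫_ℝ = (innerSL ℝ (G φ)).comp G x := fun x => by
      simp [real_inner_comm]
    have i1 : ∀ x y, 0 ≤ x → x ≤ y → IntervalIntegrable f₁ volume x y := by
      intro x y hx hxy
      refine ContinuousOn.intervalIntegrable ?_
      rw [uIcc_of_le hxy]
      exact (G.continuous.comp_continuousOn (hs.cont.mono fun r hr => hx.trans hr.1)).inner
        continuousOn_const
    have i2 : ∀ x y, 0 ≤ x → x ≤ y → IntervalIntegrable f₂ volume x y := by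
      intro x y hx hxy
      rcases hxy.eq_or_lt with rfl | hlt
      · simp
      have := (hs.memoryForce_steklov h hK (G φ) (sub_pos.2 hlt) hx).1
      have h2 := this.comp_sub_right x
      simpa [hf₂] using h2
    have i3 : ∀ x y, IntervalIntegrable f₃ volume x y := by
      intro x y
      simp only [hf₃, hinn]
      exact ⟨(innerSL ℝ (ι φ)).integrable_comp (hvi x y).1,
        (innerSL ℝ (ι φ)).integrable_comp (hvi x y).2⟩
    have i4 : ∀ x y, IntervalIntegrable f₄ volume x y := by
      intro x y
      have := (i3 (x - τ) (y - τ)).comp_sub_right τ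
      simpa [hf₄, hf₃] using this
    have htδ : t ≤ t + δ := by linarith
    have i12 : ∀ x y, 0 ≤ x → x ≤ y →
        IntervalIntegrable (fun r => f₁ r - f₂ r + a * f₃ r) volume x y :=
      fun x y hx hxy => ((i1 x y hx hxy).sub (i2 x y hx hxy)).add ((i3 x y).const_mul a)
    have iall : ∀ x y, 0 ≤ x → x ≤ y →
        IntervalIntegrable (fun r => f₁ r - f₂ r + a * f₃ r + k * f₄ r) volume x y :=
      fun x y hx hxy => (i12 x y hx hxy).add ((i4 x y).const_mul k)
    have hdiff : ⟪v (t + δ) - v t, ι φ⟫_ℝ +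
        ∫ r in t..(t + δ), (f₁ r - f₂ r + a * f₃ r + k * f₄ r) = 0 := by
      have q1 := hs.equation φ t ht
      have q2 := hs.equation φ (t + δ) (by linarith)
      have q3 := intervalIntegral.integral_add_adjacent_intervals (iall 0 t le_rfl ht)
        (iall t (t + δ) ht htδ)
      rw [inner_sub_left]
      linarith
    rw [intervalIntegral.integral_add (i12 _ _ ht htδ) ((i4 _ _).const_mul k),
      intervalIntegral.integral_add ((i1 _ _ ht htδ).sub (i2 _ _ ht htδ)) ((i3 _ _).const_mul a),
      intervalIntegral.integral_sub (i1 _ _ ht htδ) (i2 _ _ ht htδ),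
      intervalIntegral.integral_const_mul, intervalIntegral.integral_const_mul] at hdiff
    have e1 : ⟪G (steklov δ u t), G φ⟫_ℝ = δ⁻¹ * ∫ r in t..(t + δ), f₁ r := by
      rw [hinnG, map_steklov _ (hs.intervalIntegrable_shift h hK
        (Admissible.kernel_pos_of_nonneg h ht) hδ), steklov_eq]
      simp only [← hinnG, smul_eq_mul, hf₁]
    have e2 : ∫ s in Ioi (0 : ℝ), μ s * ⟪G (steklov δ u (t - s)), G φ⟫_ℝ =
        δ⁻¹ * ∫ r in t..(t + δ), f₂ r := by
      rw [← (hs.memoryForce_steklov h hK (G φ) hδ ht).2, steklov_eq, smul_eq_mul]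
    have e3 : ∀ x, ⟪steklov δ v x, ι φ⟫_ℝ = δ⁻¹ * ∫ r in x..(x + δ), f₃ r := by
      intro x
      have hi : IntervalIntegrable (fun r => v (x + r)) volume 0 δ := by
        simpa using (hvi x (x + δ)).comp_add_left x
      rw [hinn, map_steklov _ hi, steklov_eq]
      simp only [← hinn, smul_eq_mul, hf₃]
    have e4 : ⟪steklov δ v (t - τ), ι φ⟫_ℝ = δ⁻¹ * ∫ r in t..(t + δ), f₄ r := by
      rw [e3]
      congr 1
      have := intervalIntegral.integral_comp_sub_right (a := t) (b := t + δ) f₃ τ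
      simp only [hf₄]
      rw [show t - τ + δ = t + δ - τ by ring]
      exact this.symm
    rw [e1, e2, e3 t, e4, real_inner_smul_left]
    linear_combination δ⁻¹ * hdiff

lemma tendsto_totalEnergy_steklov (hs : WeakSolution μ ι G τ a k u v) (h : DecayKernel μ ν α m)
    {K : ℝ} (hK : ∀ x, ‖x‖ ≤ K * ‖G x‖) (hτ : 0 < τ) {δ : ℕ → ℝ} (hδ : ∀ n, 0 < δ n)
    (hδ0 : Tendsto δ atTop (𝓝 0)) {t : ℝ} (ht : 0 ≤ t) :
    Tendsto (fun n => totalEnergy μ m G τ a (steklov (δ n) u) (steklov (δ n) v) t) atTop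
      (𝓝 (totalEnergy μ m G τ a u v t)) := by
  have l1 := tendsto_steklov_of_continuousOn hs.cont_v ht hδ hδ0
  have l2 := (G.continuous.tendsto _).comp (tendsto_steklov_of_continuousOn hs.cont ht hδ hδ0)
  have l3 := hs.tendsto_memory_steklov h hK hδ hδ0 ht
  have l4 := tendsto_delayEnergy_steklov hs.meas_v hs.sq_integrable hτ hδ hδ0 ht
  exact ((((l1.norm.pow 2).const_mul _).add ((l2.norm.pow 2).const_mul _)).add
    (l3.const_mul _)).add (l4.const_mul _)

/-- The estimate for the averages passes to the limit `δ → 0`. The energies are dominated on `[S,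
T]` because the energy of an average is at most the average of a locally bounded function. -/
lemma integral_totalEnergy_le (hs : WeakSolution μ ι G τ a k u v)
    (h : DecayKernel μ ν α m) {K P : ℝ} (hK : ∀ x, ‖x‖ ≤ K * ‖G x‖) (hP0 : 0 < P)
    (hP : ∀ x, ‖ι x‖ ^ 2 ≤ P * ‖G x‖ ^ 2) (hτ : 0 < τ) {θ : ℝ} (hθ : 1 < θ)
    (ha : a = θ * |k| * Real.exp τ) (hk1 : P * (a + |k|) ≤ (1 - m) / 2) (hk2 : a ≤ m / 2)
    {S T : ℝ} (hS : 0 ≤ S) (hST : S ≤ T) :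
    ∫ t in S..T, totalEnergy μ m G τ a u v t ≤
      constC (μ 0) m P α τ θ k * totalEnergy μ m G τ a u v S := by
  have ha0 : 0 ≤ a := by rw [ha]; positivity
  set δ : ℕ → ℝ := fun n => 1 / ((n : ℝ) + 1) with hδdef
  have hδ : ∀ n, 0 < δ n := fun n => by positivity
  have hδ1 : ∀ n, δ n ≤ 1 := fun n => by
    rw [hδdef]
    simp only
    rw [div_le_one (by positivity)]
    linarith [Nat.cast_nonneg (α := ℝ) n]
  have hδ0 : Tendsto δ atTop (𝓝 0) := tendsto_one_div_add_atTop_nhds_zero_nat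
  have hreg := fun n => hs.regular_steklov h hK (hδ n)
  have hle := fun n => (hreg n).integral_totalEnergy_le h hK hP0 hP hτ hθ ha hk1 hk2 hS hST
  have hcF := hs.continuousOn_totalEnergy h hK
  have hsub : Icc S (T + 1) ⊆ Ici 0 := fun t ht => hS.trans ht.1
  obtain ⟨C, hC⟩ := isCompact_Icc.exists_bound_of_continuousOn (hcF.mono hsub)
  have hlim : Tendsto (fun n => ∫ t in S..T, totalEnergy μ m G τ a (steklov (δ n) u)
      (steklov (δ n) v) t) atTop (𝓝 (∫ t in S..T, totalEnergy μ m G τ a u v t)) := by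
    refine intervalIntegral.tendsto_integral_filter_of_dominated_convergence (fun _ => C)
      (Eventually.of_forall fun n => ?_) (Eventually.of_forall fun n =>
        Eventually.of_forall fun t ht => ?_) (by simp) (Eventually.of_forall fun t ht => ?_)
    · rw [uIoc_of_le hST]
      refine ContinuousOn.aestronglyMeasurable ?_ measurableSet_Ioc
      have hIoc : Ioc S T ⊆ Ici 0 := fun t ht => hS.trans ht.1.le
      refine ContinuousOn.mono (((ContinuousOn.add ?_ ?_).add ?_).add ?_) hIoc
      · exact continuousOn_const.mul (((hreg n).continuousOn_v hτ).norm.pow 2)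
      · exact continuousOn_const.mul
          ((G.continuous.comp_continuousOn (hreg n).cont).norm.pow 2)
      · exact continuousOn_const.mul ((hreg n).continuousOn_memory h hK)
      · exact continuousOn_const.mul fun t ht =>
          (hasDerivWithinAt_delayEnergy hτ (hreg n).cont_v ht).continuousWithinAt
    · rw [uIoc_of_le hST] at ht
      have ht0 : 0 ≤ t := hS.trans ht.1.le
      rw [Real.norm_of_nonneg (totalEnergy_bounds h hτ ha0 t).2.2]
      refine (hs.totalEnergy_steklov_le h hK hτ ha0 (hδ n) ht0).trans ?_
      have h1 : ∀ r ∈ uIoc (0 : ℝ) (δ n), ‖totalEnergy μ m G τ a u v (t + r)‖ ≤ C := by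
        intro r hr
        rw [uIoc_of_le (hδ n).le] at hr
        exact hC _ ⟨by linarith [ht.1, hr.1], by linarith [ht.2, hr.2, hδ1 n]⟩
      have h2 := intervalIntegral.norm_integral_le_of_norm_le_const h1
      rw [sub_zero, abs_of_pos (hδ n)] at h2
      have h3 := mul_le_mul_of_nonneg_left ((le_abs_self _).trans h2) (inv_nonneg.2 (hδ n).le)
      rw [steklov, smul_eq_mul]
      refine h3.trans (le_of_eq ?_)
      have := (hδ n).ne'
      field_simp
    · rw [uIoc_of_le hST] at ht
      exact hs.tendsto_totalEnergy_steklov h hK hτ hδ hδ0 (hS.trans ht.1.le)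
  exact le_of_tendsto_of_tendsto' hlim
    ((hs.tendsto_totalEnergy_steklov h hK hτ hδ hδ0 hS).const_mul _) hle

end WeakSolution

end Weak

/-! ### The Poincaré inequality -/

section Sobolev

variable {n : ℕ} {Ω : Set (Space n)}

/-- `val` as a continuous linear map. -/
noncomputable def valL (Ω : Set (Space n)) : H10 Ω →L[ℝ] L2 Ω :=
  (WithLp.fstL 2 ℝ (L2 Ω) (L2Vec Ω)).comp (H10 Ω).subtypeL

/-- `grad` as a continuous linear map. -/
noncomputable def gradL (Ω : Set (Space n)) : H10 Ω →L[ℝ] L2Vec Ω :=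
  (WithLp.sndL 2 ℝ (L2 Ω) (L2Vec Ω)).comp (H10 Ω).subtypeL

lemma gradL_apply (w : H10 Ω) : gradL Ω w = grad w := rfl

lemma completeSpace_H10 : CompleteSpace (H10 Ω) :=
  (Submodule.isClosed_topologicalClosure (testPairs Ω)).completeSpace_coe

lemma norm_sq_H10 (w : H10 Ω) : ‖w‖ ^ 2 = ‖val w‖ ^ 2 + ‖grad w‖ ^ 2 := by
  change ‖(w : L2Pair Ω)‖ ^ 2 = _
  exact WithLp.prod_norm_sq_eq_of_L2 _

lemma Lp_norm_sq_eq {E : Type*} [NormedAddCommGroup E] [InnerProductSpace ℝ E] {X : Type*}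
    [MeasurableSpace X] {ρ : Measure X} (f : Lp E 2 ρ) : ‖f‖ ^ 2 = ∫ x, ‖f x‖ ^ 2 ∂ρ := by
  rw [← real_inner_self_eq_norm_sq, L2.inner_def]
  simp_rw [real_inner_self_eq_norm_sq]

/-- Poincaré's inequality for test functions supported in the ball `‖x‖ ≤ R`: integrate `φ²` by
parts against the linear function `⟪e, ·⟫`, whose derivative in the direction of the unit vector `e`
is `1`. -/
lemma integral_sq_le_of_tsupport {E : Type*} [NormedAddCommGroup E] [InnerProductSpace ℝ E]
    [FiniteDimensional ℝ E] [MeasurableSpace E] [BorelSpace E] {e : E} (hen : ‖e‖ = 1)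
    {φ : E → ℝ} (hφ : ContDiff ℝ ∞ φ) (hc : HasCompactSupport φ) {R : ℝ}
    (hR : ∀ x ∈ tsupport φ, ‖x‖ ≤ R) :
    ∫ x, ‖φ x‖ ^ 2 ≤ 4 * R ^ 2 * ∫ x, ‖gradient φ x‖ ^ 2 := by
  obtain ⟨ℓ, hℓx, hℓe⟩ : ∃ ℓ : E →L[ℝ] ℝ, (∀ x, |ℓ x| ≤ ‖x‖) ∧ ℓ e = 1 := by
    refine ⟨innerSL ℝ e, fun x => ?_, ?_⟩
    · have := abs_real_inner_le_norm e x
      rwa [hen, one_mul] at this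
    · rw [innerSL_apply_apply, real_inner_self_eq_norm_sq, hen, one_pow]
  have hdiff : Differentiable ℝ φ := hφ.differentiable (by simp)
  have hdc : Continuous fun x => fderiv ℝ φ x := hφ.continuous_fderiv (by simp)
  have hd2 : ∀ x, fderiv ℝ (fun y => φ y ^ 2) x e = 2 * φ x * fderiv ℝ φ x e := by
    intro x
    have := ((hdiff x).hasFDerivAt.pow 2).fderiv
    rw [this]
    simp
  have hdℓ : ∀ x, fderiv ℝ (fun y => ℓ y) x e = 1 := fun x => by
    rw [ℓ.fderiv, hℓe]
  have h0 : ∀ x, x ∉ tsupport φ → φ x = 0 := fun x hx => image_eq_zero_of_notMem_tsupport hx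
  have h0' : ∀ x, x ∉ tsupport φ → fderiv ℝ φ x = 0 := fun x hx =>
    image_eq_zero_of_notMem_tsupport fun h => hx (tsupport_fderiv_subset ℝ h)
  have hint : ∀ f : E → ℝ, Continuous f → (∀ x, x ∉ tsupport φ → f x = 0) → Integrable f :=
    fun f hf hf0 => hf.integrable_of_hasCompactSupport (HasCompactSupport.intro hc hf0)
  have i1 : Integrable fun x => φ x ^ 2 := hint _ (hφ.continuous.pow 2) fun x hx => by
    rw [h0 x hx, zero_pow two_ne_zero]
  have i2 : Integrable fun x => 2 * φ x * fderiv ℝ φ x e * ℓ x :=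
    hint _ (((continuous_const.mul hφ.continuous).mul (hdc.clm_apply continuous_const)).mul
      ℓ.continuous) fun x hx => by rw [h0 x hx, mul_zero, zero_mul, zero_mul]
  have i3 : Integrable fun x => φ x ^ 2 * ℓ x :=
    hint _ ((hφ.continuous.pow 2).mul ℓ.continuous) fun x hx => by
      rw [h0 x hx, zero_pow two_ne_zero, zero_mul]
  have hgn : ∀ x, ‖gradient φ x‖ = ‖fderiv ℝ φ x‖ := fun x => by simp [gradient]
  have i4 : Integrable fun x => ‖gradient φ x‖ ^ 2 := by
    simp only [hgn]
    exact hint _ (hdc.norm.pow 2) fun x hx => by rw [h0' x hx, norm_zero, zero_pow two_ne_zero]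
  have key := integral_mul_fderiv_eq_neg_fderiv_mul_of_integrable (μ := volume) (v := e)
    (f := fun x => φ x ^ 2) (g := fun x => ℓ x) (by simpa only [hd2] using i2)
    (by simpa only [hdℓ, mul_one] using i1) i3 (fun x _ => (hdiff x).pow 2)
    (fun x _ => ℓ.differentiableAt)
  simp only [hd2, hdℓ, mul_one] at key
  have hpt : ∀ x, -(2 * φ x * fderiv ℝ φ x e * ℓ x) ≤
      1 / 2 * φ x ^ 2 + 2 * R ^ 2 * ‖gradient φ x‖ ^ 2 := by
    intro x
    by_cases hx : x ∈ tsupport φ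
    · have h1 : |fderiv ℝ φ x e| ≤ ‖gradient φ x‖ := by
        have := (fderiv ℝ φ x).le_opNorm e
        rwa [hen, mul_one, Real.norm_eq_abs, ← hgn] at this
      have h2 := (hℓx x).trans (hR x hx)
      have h3 : |fderiv ℝ φ x e * ℓ x| ≤ ‖gradient φ x‖ * R := by
        rw [abs_mul]
        exact mul_le_mul h1 h2 (abs_nonneg _) (norm_nonneg _)
      have h4 : (fderiv ℝ φ x e * ℓ x) ^ 2 ≤ (‖gradient φ x‖ * R) ^ 2 := sq_le_sq' (by
        linarith [neg_abs_le (fderiv ℝ φ x e * ℓ x)]) ((le_abs_self _).trans h3)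
      linarith [sq_nonneg (φ x + 2 * (fderiv ℝ φ x e * ℓ x))]
    · rw [h0 x hx]
      simp only [mul_zero, zero_mul, neg_zero]
      positivity
  have hle : ∫ x, φ x ^ 2 ≤ ∫ x, (1 / 2 * φ x ^ 2 + 2 * R ^ 2 * ‖gradient φ x‖ ^ 2) := by
    rw [key, ← integral_neg]
    exact integral_mono i2.neg ((i1.const_mul _).add (i4.const_mul _)) hpt
  rw [integral_add (i1.const_mul _) (i4.const_mul _), integral_const_mul, integral_const_mul] at hle
  simp only [Real.norm_eq_abs, sq_abs]
  linarith

lemma exists_poincare (hn : 0 < n) (hb : Bornology.IsBounded Ω) :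
    ∃ C, 0 < C ∧ ∀ w : H10 Ω, ‖val w‖ ^ 2 ≤ C * ‖grad w‖ ^ 2 := by
  obtain ⟨R, hR0, hR⟩ := hb.exists_pos_norm_le
  refine ⟨4 * R ^ 2, by positivity, fun w => ?_⟩
  have hclosed : IsClosed {p : L2Pair Ω | ‖p.fst‖ ^ 2 ≤ 4 * R ^ 2 * ‖p.snd‖ ^ 2} :=
    isClosed_le (((WithLp.fstL 2 ℝ (L2 Ω) (L2Vec Ω)).continuous.norm).pow 2)
      (continuous_const.mul (((WithLp.sndL 2 ℝ (L2 Ω) (L2Vec Ω)).continuous.norm).pow 2))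
  refine closure_minimal (s := (testPairs Ω : Set (L2Pair Ω))) ?_ hclosed w.2
  rintro p ⟨φ, h1, h2, h3, h4, h5⟩
  have hs : ∀ x, x ∉ Ω → φ x = 0 := fun x hx =>
    image_eq_zero_of_notMem_tsupport fun h => hx (h3 h)
  have hs' : ∀ x, x ∉ Ω → gradient φ x = 0 := fun x hx => by
    have : fderiv ℝ φ x = 0 :=
      image_eq_zero_of_notMem_tsupport fun h => hx (h3 (tsupport_fderiv_subset ℝ h))
    simp [gradient, this]
  have e1 : ‖p.fst‖ ^ 2 = ∫ x, ‖φ x‖ ^ 2 := by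
    rw [Lp_norm_sq_eq, ← setIntegral_eq_integral_of_forall_compl_eq_zero (s := Ω)
      (f := fun x => ‖φ x‖ ^ 2) (fun x hx => by simp [hs x hx])]
    refine integral_congr_ae ?_
    filter_upwards [h4] with x hx
    rw [hx]
  have e2 : ‖p.snd‖ ^ 2 = ∫ x, ‖gradient φ x‖ ^ 2 := by
    rw [Lp_norm_sq_eq, ← setIntegral_eq_integral_of_forall_compl_eq_zero (s := Ω)
      (f := fun x => ‖gradient φ x‖ ^ 2) (fun x hx => by simp [hs' x hx])]
    refine integral_congr_ae ?_
    filter_upwards [h5] with x hx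
    rw [hx]
  change ‖p.fst‖ ^ 2 ≤ 4 * R ^ 2 * ‖p.snd‖ ^ 2
  rw [e1, e2]
  exact integral_sq_le_of_tsupport (e := EuclideanSpace.single ⟨0, hn⟩ (1 : ℝ)) (by simp) h1 h2
    fun x hx => hR x (h3 hx)

lemma exists_val_ne_zero (hΩ : IsOpen Ω) (hne : Ω.Nonempty) : ∃ w : H10 Ω, val w ≠ 0 := by
  obtain ⟨c, hc⟩ := hne
  obtain ⟨ε, hε, hball⟩ := Metric.isOpen_iff.1 hΩ c hc
  let φ : ContDiffBump c := ⟨ε / 4, ε / 2, by positivity, by linarith⟩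
  have hφ : ContDiff ℝ ∞ φ := φ.contDiff
  have hcs : HasCompactSupport φ := φ.hasCompactSupport
  have hdc : Continuous fun x => fderiv ℝ φ x := hφ.continuous_fderiv (by simp)
  have hgc : Continuous (gradient φ) :=
    (InnerProductSpace.toDual ℝ (Space n)).symm.continuous.comp hdc
  have hgs : HasCompactSupport (gradient φ) :=
    (hcs.fderiv ℝ).comp_left (g := fun y => (InnerProductSpace.toDual ℝ (Space n)).symm y)
      (by simp)
  have m1 : MemLp φ 2 (volume.restrict Ω) :=
    (hφ.continuous.memLp_of_hasCompactSupport hcs).restrict Ω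
  have m2 : MemLp (gradient φ) 2 (volume.restrict Ω) :=
    (hgc.memLp_of_hasCompactSupport hgs).restrict Ω
  have hp : WithLp.toLp 2 (m1.toLp φ, m2.toLp (gradient φ)) ∈ testPairs Ω := by
    refine ⟨φ, hφ, hcs, ?_, m1.coeFn_toLp, m2.coeFn_toLp⟩
    rw [φ.tsupport_eq]
    exact (Metric.closedBall_subset_ball (by change ε / 2 < ε; linarith)).trans hball
  refine ⟨⟨_, Submodule.le_topologicalClosure _ hp⟩, fun h0 => ?_⟩
  have h1 : m1.toLp φ = 0 := h0
  have h2 : (φ : Space n → ℝ) =ᵐ[volume.restrict Ω] fun _ => (0 : ℝ) := by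
    have := m1.coeFn_toLp
    rw [h1] at this
    exact this.symm.trans (Lp.coeFn_zero _ _ _)
  have h3 := Measure.eqOn_open_of_ae_eq h2 hΩ hφ.continuous.continuousOn continuousOn_const hc
  have h4 : φ c = 1 := φ.one_of_mem_closedBall (by simp [φ.rIn_pos.le])
  rw [h4] at h3
  exact one_ne_zero h3

/-- The infimum which defines the Poincaré constant is attained. -/
lemma norm_val_sq_le_poincareConst (hn : 0 < n) (hb : Bornology.IsBounded Ω)
    (w : H10 Ω) : ‖val w‖ ^ 2 ≤ poincareConst Ω * ‖grad w‖ ^ 2 := by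
  obtain ⟨C, hC0, hC⟩ := exists_poincare hn hb
  rcases (norm_nonneg (grad w)).eq_or_lt with h0 | h0
  · have := hC w
    rw [← h0] at this ⊢
    simpa using this
  · rw [← div_le_iff₀ (by positivity)]
    refine le_csInf ⟨C, hC0, hC⟩ fun c hc => ?_
    rw [div_le_iff₀ (by positivity)]
    exact hc.2 w

lemma poincareConst_pos (hn : 0 < n) (hΩ : IsOpen Ω) (hb : Bornology.IsBounded Ω)
    (hne : Ω.Nonempty) : 0 < poincareConst Ω := by
  obtain ⟨w, hw⟩ := exists_val_ne_zero hΩ hne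
  have h1 := norm_val_sq_le_poincareConst hn hb w
  have h2 : 0 < ‖val w‖ ^ 2 := by
    have := norm_pos_iff.2 hw
    positivity
  by_contra h
  have := mul_nonpos_of_nonpos_of_nonneg (not_lt.1 h) (sq_nonneg ‖grad w‖)
  linarith

end Sobolev

/-! ### The constants -/

section Constants

variable {μ₀ m P α τ θ k : ℝ}

lemma kBar_pos (hm : 0 < m) (hm1 : m < 1) (hP : 0 < P) (hθ : 1 < θ) : 0 < kBar m P τ θ := by
  have h1 : 0 < 1 - m := by linarith
  have h2 : 0 < θ := by linarith
  have h3 := Real.exp_pos τ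
  exact lt_min (by positivity) (by positivity)

/-- The two smallness conditions on `k` used by the two multiplier estimates, with
`a = θ|k|e^τ`. -/
lemma le_of_abs_lt_kBar (hP : 0 < P) (hθ : 1 < θ) (hk : |k| < kBar m P τ θ) :
    P * (θ * |k| * Real.exp τ + |k|) ≤ (1 - m) / 2 ∧ θ * |k| * Real.exp τ ≤ m / 2 := by
  have h2 : 0 < θ := by linarith
  have h3 := Real.exp_pos τ
  obtain ⟨a1, a2⟩ := lt_min_iff.1 hk
  constructor
  · rw [lt_div_iff₀ (by positivity)] at a1
    linarith
  · have h4 := mul_le_mul_of_nonneg_left a2.le (show 0 ≤ θ * Real.exp τ by positivity)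
    have h5 : θ * Real.exp τ * (m / (2 * θ) * Real.exp (-τ)) = m / 2 := by
      rw [Real.exp_neg]
      field_simp
    linarith

lemma constC_pos (h0 : 0 < μ₀) (hm : 0 < m) (hm1 : m < 1) (hP : 0 < P) (hα : 0 < α)
    (hθ : 1 < θ) : 0 < constC μ₀ m P α τ θ k := by
  have h1 : 0 < 1 - m := by linarith
  have h2 : 0 < θ := by linarith
  have h3 : 0 < θ - 1 := by linarith
  have h4 := Real.exp_pos τ
  have h5 := abs_nonneg k
  unfold constC constC0 constC1 constC2
  positivity

lemma constC_mono {k' : ℝ} (h0 : 0 < μ₀) (hm : 0 < m) (hm1 : m < 1) (hP : 0 < P) (hα : 0 < α)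
    (hθ : 1 < θ) (hk : |k| ≤ |k'|) : constC μ₀ m P α τ θ k ≤ constC μ₀ m P α τ θ k' := by
  have h1 : 0 < 1 - m := by linarith
  have h2 : 0 < θ := by linarith
  have h3 : 0 < θ - 1 := by linarith
  have h4 := Real.exp_pos τ
  have h5 := abs_nonneg k
  have h6 : constC0 τ θ k ≤ constC0 τ θ k' := by
    unfold constC0
    gcongr
  have h7 : constC2 μ₀ m P α τ θ k ≤ constC2 μ₀ m P α τ θ k' := by
    unfold constC2
    gcongr
  have h8 : 0 ≤ constC2 μ₀ m P α τ θ k := by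
    unfold constC2
    positivity
  have h9 : 0 ≤ constC0 τ θ k' := by
    unfold constC0
    positivity
  have h10 := mul_le_mul h6 h7 h8 h9
  unfold constC
  linarith

end Constants

/-! ### Solutions on `Ω` as abstract weak solutions -/

/-- A nonnegative continuous function whose integrals over `[S, T]` are bounded uniformly in `T`
is integrable on `(S, ∞)`, with the same bound. -/
lemma integrableOn_Ioi_and_integral_le {f : ℝ → ℝ} {S B : ℝ} (hf : ContinuousOn f (Ici S))
    (h0 : ∀ t, S ≤ t → 0 ≤ f t) (hB : ∀ T, S ≤ T → ∫ t in S..T, f t ≤ B) :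
    IntegrableOn f (Ioi S) ∧ ∫ t in Ioi S, f t ≤ B := by
  have hi : IntegrableOn f (Ioi S) := by
    refine integrableOn_Ioi_of_intervalIntegral_norm_bounded B S (l := atTop) (b := id)
      (fun T => ?_) tendsto_id ?_
    · exact ((hf.mono fun t ht => ht.1).integrableOn_Icc (a := S) (b := T)).mono_set
        Ioc_subset_Icc_self
    · filter_upwards [eventually_ge_atTop S] with T hT
      refine (le_of_eq ?_).trans (hB T hT)
      refine intervalIntegral.integral_congr fun t ht => ?_
      rw [id, uIcc_of_le hT] at ht
      exact Real.norm_of_nonneg (h0 t ht.1)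
  refine ⟨hi, le_of_tendsto (intervalIntegral_tendsto_integral_Ioi S hi tendsto_id) ?_⟩
  filter_upwards [eventually_ge_atTop S] with T hT
  exact hB T hT

section Solutions

variable {n : ℕ} {Ω : Set (Space n)} {μ : ℝ → ℝ} {α τ θ k : ℝ} {u : ℝ → H10 Ω} {v : ℝ → L2 Ω}

lemma causal_clamp (s : ℝ) : causal (fun s => μ (max s 0)) s = causal μ s := by
  rcases le_or_gt s 0 with h | h
  · rw [causal_of_nonpos h, causal_of_nonpos h]
  · rw [causal_of_pos h, causal_of_pos h, max_eq_left h.le]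

lemma aestronglyMeasurable_of_continuousOn_Ici {E : Type*} [NormedAddCommGroup E] {f : ℝ → E}
    {s t : Set ℝ} (hs : AEStronglyMeasurable f (volume.restrict s)) (hf : ContinuousOn f (Ici 0))
    (ht : t ⊆ s ∪ Ici 0) : AEStronglyMeasurable f (volume.restrict t) :=
  (aestronglyMeasurable_union_iff.2 ⟨hs, hf.aestronglyMeasurable measurableSet_Ici⟩).mono_measure
    (Measure.restrict_mono ht le_rfl)

lemma IsSolution.aestronglyMeasurable_u (hs : IsSolution Ω μ τ θ k u v) :
    AEStronglyMeasurable u := by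
  have := aestronglyMeasurable_of_continuousOn_Ici (t := univ) hs.history_meas hs.cont_u
    Iio_union_Ici.ge
  rwa [Measure.restrict_univ] at this

lemma IsSolution.admissible (hs : IsSolution Ω μ τ θ k u v) :
    Admissible (fun s => μ (max s 0)) (gradL Ω) u where
  meas := hs.aestronglyMeasurable_u
  cont := hs.cont_u
  hist := by
    have := (integrableOn_Ioi_iff μ (fun r => ‖gradL Ω (u 0 - u r)‖ ^ 2) 0).1
      hs.history_integrable
    simpa only [causal_clamp, smul_eq_mul] using this

lemma IsSolution.aestronglyMeasurable_v (hs : IsSolution Ω μ τ θ k u v) :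
    AEStronglyMeasurable ((Ioi (-τ)).indicator v) := by
  rw [aestronglyMeasurable_indicator_iff measurableSet_Ioi]
  refine aestronglyMeasurable_of_continuousOn_Ici hs.delay_memLp.1 hs.cont_v fun t ht => ?_
  rcases lt_or_ge t 0 with h | h
  · exact Or.inl ⟨ht, h⟩
  · exact Or.inr h

lemma IsSolution.sq_integrable (hs : IsSolution Ω μ τ θ k u v) (x y : ℝ) :
    IntervalIntegrable (fun s => ‖(Ioi (-τ)).indicator v s‖ ^ 2) volume x y := by
  set b := max (max x y) 0
  have h1 : IntegrableOn (fun s => ‖v s‖ ^ 2) (Ioo (-τ) 0) := hs.delay_memLp.integrable_norm_pow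
    two_ne_zero
  have h2 : IntegrableOn (fun s => ‖v s‖ ^ 2) (Icc 0 b) :=
    ((hs.cont_v.mono Icc_subset_Ici_self).norm.pow 2).integrableOn_Icc
  have h3 : IntegrableOn (fun s => ‖(Ioi (-τ)).indicator v s‖ ^ 2) (Iic b) := by
    have e : (fun s => ‖(Ioi (-τ)).indicator v s‖ ^ 2) =
        (Ioi (-τ)).indicator fun s => ‖v s‖ ^ 2 := by
      funext s
      by_cases h : s ∈ Ioi (-τ) <;> simp [h]
    rw [e, IntegrableOn, integrable_indicator_iff measurableSet_Ioi, IntegrableOn,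
      Measure.restrict_restrict measurableSet_Ioi]
    refine (h1.union h2).mono_set fun t ht => ?_
    rcases lt_or_ge t 0 with h | h
    · exact Or.inl ⟨ht.1, h⟩
    · exact Or.inr ⟨h, ht.2⟩
  rw [intervalIntegrable_iff]
  refine h3.mono_set fun t ht => ?_
  exact (le_trans ht.2 (le_max_left _ _) : t ≤ b)

/-- A solution is a weak solution in the abstract sense once the velocity is replaced by `0` before
`-τ`, where nothing is assumed about it; neither the equation nor the energy involves these values
at times `t ≥ 0`. -/
lemma IsSolution.weakSolution (hs : IsSolution Ω μ τ θ k u v) (hτ : 0 < τ) :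
    WeakSolution (fun s => μ (max s 0)) (valL Ω) (gradL Ω) τ (θ * |k| * Real.exp τ) k u
      ((Ioi (-τ)).indicator v) := by
  have hv : ∀ t, -τ < t → (Ioi (-τ)).indicator v t = v t := fun t ht =>
    indicator_of_mem (mem_Ioi.2 ht) v
  have hv0 : ∀ t, 0 ≤ t → (Ioi (-τ)).indicator v t = v t := fun t ht => hv t (by linarith)
  refine { hs.admissible with
    meas_v := hs.aestronglyMeasurable_v
    sq_integrable := hs.sq_integrable
    cont_v := hs.cont_v.congr fun t ht => hv0 t ht
    deriv_u := fun t ht => ?_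
    equation := fun φ t ht => ?_ }
  · rw [hv0 t ht]
    exact hs.deriv_u t ht
  · rw [hv0 t ht, hv0 0 le_rfl]
    refine Eq.trans ?_ (hs.equation φ t ht)
    refine congrArg₂ (· + ·) rfl (intervalIntegral.integral_congr_ae (Eventually.of_forall
      fun r hr => ?_))
    rw [uIoc_of_le ht] at hr
    rw [hv0 r hr.1.le, hv (r - τ) (by linarith [hr.1])]
    have : ∫ s in Ioi (0 : ℝ), μ (max s 0) * ⟪gradL Ω (u (r - s)), gradL Ω φ⟫_ℝ =
        ∫ s in Ioi (0 : ℝ), μ s * ⟪grad (u (r - s)), grad φ⟫_ℝ := by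
      refine setIntegral_congr_fun measurableSet_Ioi fun s hs => ?_
      simp only [max_eq_left (le_of_lt (mem_Ioi.1 hs)), gradL_apply]
    rw [this]
    rfl

lemma energy_eq_totalEnergy (hτ : 0 < τ) {t : ℝ} (ht : 0 ≤ t) :
    energy μ τ θ k u v t = totalEnergy (fun s => μ (max s 0)) (muTilde μ) (gradL Ω) τ
      (θ * |k| * Real.exp τ) u ((Ioi (-τ)).indicator v) t := by
  have hv : ∀ t, -τ < t → (Ioi (-τ)).indicator v t = v t := fun t ht =>
    indicator_of_mem (mem_Ioi.2 ht) v
  have h1 : memory (fun s => μ (max s 0)) (gradL Ω) u t =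
      ∫ s in Ioi (0 : ℝ), μ s * ‖grad (eta u t s)‖ ^ 2 := by
    have := setIntegral_Ioi_eq μ (fun r => ‖gradL Ω (u t - u r)‖ ^ 2) t
    simp only [smul_eq_mul] at this
    simp only [memory, causal_clamp]
    exact this.symm
  have h2 : delayEnergy τ ((Ioi (-τ)).indicator v) t =
      ∫ s in (t - τ)..t, Real.exp (-(t - s)) * ‖v s‖ ^ 2 := by
    refine intervalIntegral.integral_congr_ae (Eventually.of_forall fun s hs => ?_)
    rw [uIoc_of_le (by linarith)] at hs
    rw [hv s (by linarith [hs.1])]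
  rw [energy, totalEnergy, h1, h2, hv t (by linarith)]
  rfl

end Solutions

end ViscoDelay

open ViscoDelay in
theorem theorem3p3 {n : ℕ} (hn : 0 < n) (Ω : Set (ViscoDelay.Space n))
    (hΩ_open : IsOpen Ω) (hΩ_bdd : Bornology.IsBounded Ω) (hΩ_ne : Ω.Nonempty)
    (μ : ℝ → ℝ) (α : ℝ) (hμ : ViscoDelay.IsMemoryKernel μ α)
    (τ : ℝ) (hτ : 0 < τ) (θ : ℝ) (hθ : 1 < θ) :
    0 < ViscoDelay.kBar (ViscoDelay.muTilde μ) (ViscoDelay.poincareConst Ω) τ θ ∧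
    ∃ Cmax : ℝ, 0 < Cmax ∧
      ∀ k : ℝ,
        |k| < ViscoDelay.kBar (ViscoDelay.muTilde μ) (ViscoDelay.poincareConst Ω) τ θ →
        0 < ViscoDelay.constC (μ 0) (ViscoDelay.muTilde μ) (ViscoDelay.poincareConst Ω) α τ θ k ∧
        ViscoDelay.constC (μ 0) (ViscoDelay.muTilde μ) (ViscoDelay.poincareConst Ω) α τ θ k
          ≤ Cmax ∧
        ∀ (u : ℝ → ViscoDelay.H10 Ω) (v : ℝ → ViscoDelay.L2 Ω),
          ViscoDelay.IsSolution Ω μ τ θ k u v →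
          ∀ S : ℝ, 0 < S →
            IntegrableOn (ViscoDelay.energy μ τ θ k u v) (Ioi S) ∧
            ∫ t in Ioi S, ViscoDelay.energy μ τ θ k u v t
              ≤ ViscoDelay.constC (μ 0) (ViscoDelay.muTilde μ) (ViscoDelay.poincareConst Ω)
                  α τ θ k * ViscoDelay.energy μ τ θ k u v S := by
  have h := hμ.decayKernel
  have hm := h.mass_pos
  have hm1 := hμ.mass_lt_one
  have hP0 := poincareConst_pos hn hΩ_open hΩ_bdd hΩ_ne
  have hP := norm_val_sq_le_poincareConst (Ω := Ω) hn hΩ_bdd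
  have hkb := kBar_pos (τ := τ) hm hm1 hP0 hθ
  -- As `C(k)` is nondecreasing in `|k|`, its value at `k̄ > 0` serves as the upper bound.
  refine ⟨hkb, _, constC_pos (τ := τ) (k := kBar (muTilde μ) (poincareConst Ω) τ θ)
    hμ.pos_zero hm hm1 hP0 hμ.rate_pos hθ, fun k hk => ⟨constC_pos hμ.pos_zero hm hm1 hP0
    hμ.rate_pos hθ, constC_mono hμ.pos_zero hm hm1 hP0 hμ.rate_pos hθ
    (by rw [abs_of_pos hkb]; exact hk.le), fun u v hs S hS => ?_⟩⟩
  have : CompleteSpace (H10 Ω) := completeSpace_H10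
  have hw := hs.weakSolution hτ
  have hK : ∀ x : H10 Ω, ‖x‖ ≤ √(poincareConst Ω + 1) * ‖gradL Ω x‖ := fun x => by
    refine abs_le_of_sq_le_sq' ?_ (by positivity) |>.2
    rw [mul_pow, Real.sq_sqrt (by positivity), norm_sq_H10, gradL_apply]
    linarith [hP x]
  obtain ⟨hk1, hk2⟩ := le_of_abs_lt_kBar hP0 hθ hk
  have ha : 0 ≤ θ * |k| * Real.exp τ :=
    mul_nonneg (mul_nonneg (by linarith) (abs_nonneg k)) (Real.exp_pos τ).le
  have hE : ∀ t, S ≤ t → energy μ τ θ k u v t = _ := fun t ht =>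
    energy_eq_totalEnergy hτ (hS.le.trans ht)
  refine integrableOn_Ioi_and_integral_le
    (((hw.continuousOn_totalEnergy h hK).mono (Ici_subset_Ici.2 hS.le)).congr hE)
    (fun t ht => ?_) fun T hT => ?_
  · rw [hE t ht]
    exact (totalEnergy_bounds h hτ ha t).2.2
  · have := hw.integral_totalEnergy_le h hK hP0 hP hτ hθ rfl hk1 hk2 hS.le hT
    rw [hE S le_rfl, intervalIntegral.integral_congr (g := totalEnergy (fun s => μ (max s 0))
      (muTilde μ) (gradL Ω) τ (θ * |k| * Real.exp τ) u ((Ioi (-τ)).indicator v))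
      fun t ht => hE t (by rw [uIcc_of_le hT] at ht; exact ht.1)]
    simpa only [max_self] using this
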